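/- Work with manifolds which are either all $C^\infty$, or all real-analytic, or all complex (finite-dimensional, without boundary). Let $\mathcal O_X$ be the sheaf of $C^\infty$, real-analytic or holomorphic functions on $X$ with values in $\mathbb k$, where $\mathbb k\in\{\mathbb R,\mathbb C\}$ (and $\mathbb k=\mathbb C$ for complex manifolds). Let $\mathcal T_X$ be the sheaf of $\mathbb k$-linear derivations of $\mathcal O_X$ and $\Omega^1_X=\mathcal Hom_{\mathcal O_X}(\mathcal T_X,\mathcal O_X)$. A *Lie algebroid* on $X$ is an $\mathcal O_X$-module $\mathcal A$ with a $\mathbb k$-linear Lie bracket and an $\mathcal O_X$-linear map of Lie algebras $\sigma\colon\mathcal A\to\mathcal T_X$ such that $[a,gb]=g[a,b]+\sigma(a)(g)b$. A *Courant algebroid* on $X$ is an $\mathcal O_X$-module $\mathcal Q$ with a (left) Leibniz bracket $\{\ ,\ \}$, an $\mathcal O_X$-linear map of Leibniz algebras $\pi\colon\mathcal Q\to\mathcal T_X$, a symmetric $\mathcal O_X$-bilinear (possibly degenerate) pairing $\langle\ ,\ \rangle$ and an $\mathcal O_X$-linear map $\pi^\dagger\colon\Omega^1_X\to\mathcal Q$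 such that $$\pi\pi^\dagger=0,\quad \{q_1,gq_2\}=g\{q_1,q_2\}+\pi(q_1)(g)q_2,\quad \langle\{q,q_1\},q_2\rangle+\langle q_1,\{q,q_2\}\rangle=\pi(q)\langle q_1,q_2\rangle,$$ $$\{q,\pi^\dagger\alpha\}=\pi^\dagger(L_{\pi(q)}\alpha),\quad \langle q,\pi^\dagger\alpha\rangle=\iota_{\pi(q)}\alpha,\quad \{q_1,q_2\}+\{q_2,q_1\}=\pi^\dagger d\langle q_1,q_2\rangle .$$ A *Courant extension* of a Lie algebroid $\mathcal A$ is a Courant algebroid $\mathcal Q$ with a morphism $\mathcal Q\to\mathcal A$ compatible with brackets and anchors, such that $0\to\Omega^1_X\xrightarrow{\pi^\dagger}\mathcal Q\to\mathcal A\to0$ is exact. The category $\mathrm{CExt}(\mathcal A)$ has as morphisms the $\mathcal O_X$-linear maps over $\mathcal A$ which preserve brackets, anchors, co-anchors and pairings; it is a groupoid. For $\lambda_1,\dots,\lambda_n\in\mathbb k$ and $\mathcal Q_1,\dots,\mathcal Q_n\in\mathrm{CExt}(\mathcal A)$ the linear combination $\lambda_1\mathcal Q_1\dotplus\cdots\dotplus\lambda_n\mathcal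 Q_n$ is the push-out of $\mathcal Q_1\times_{\mathcal A}\cdots\times_{\mathcal A}\mathcal Q_n$ along $(\Omega^1_X)^n\to\Omega^1_X$, $(\alpha_i)\mapsto\sum_i\lambda_i\alpha_i$, with the component-wise bracket and the pairing $\langle(q_i),(q_i')\rangle=\sum_i\lambda_i\langle q_i,q_i'\rangle$ on the image of the fibre product. With its evident functoriality and the evident coherent isomorphisms $\dotplus_j\delta_{ij}\mathcal Q_j\cong\mathcal Q_i$ and $\dotplus_i\bigl(\sum_j\mu_j\lambda_{ji}\bigr)\mathcal Q_i\cong\dotplus_j\mu_j\bigl(\dotplus_i\lambda_{ji}\mathcal Q_i\bigr)$ it makes $\mathrm{CExt}(\mathcal A)$ a $\mathbb k$-vector space in categories; restricting to integral coefficients gives the underlying (strictly commutative) Picard groupoid. Let $f\colon Y\to X$ be a map of manifolds (of the class under consideration). Put $f^+\mathcal A=f^*\mathcal A\times_{f^*\mathcal T_X}\mathcal T_Y$ with the bracket $$[(h\otimes a,\xi),(j\otimes b,\eta)]=(hj\otimes[a,b]+\xi(j)\otimes b-\eta(h)\otimes a,[\xi,\eta])$$ and the anchor $(t,\xi)\mapsto\xi$.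 Let $f^{++}\mathcal Q$ be the quotient of $\Omega^1_Y\oplus(f^*\mathcal Q\times_{f^*\mathcal T_X}\mathcal T_Y)$ by the elements $(f^*\alpha,-\pi^\dagger\alpha,0)$, $\alpha\in f^*\Omega^1_X$, with the anchor $(\alpha,t,\xi)\mapsto\xi$, the co-anchor $\alpha\mapsto(\alpha,0,0)$, the pairing induced by $$\langle(\alpha,h\otimes q,\xi),(\beta,j\otimes p,\eta)\rangle=\iota_\xi\beta+\iota_\eta\alpha+hj\langle q,p\rangle$$ and the bracket induced by $$[(\alpha,h\otimes q,\xi),(\beta,j\otimes p,\eta)]=\bigl(L_\xi\beta-\iota_\eta d\alpha+j\langle q,p\rangle\,dh,\ hj\otimes\{q,p\}-\eta(h)\otimes q+\xi(j)\otimes p,\ [\xi,\eta]\bigr).$$ **Proposition.** Let $\mathcal A$ be a Lie algebroid on $X$ which is locally free of finite rank over $\mathcal O_X$. Then $f^{++}$ carries Courant extensions of $\mathcal A$ to Courant extensions of $f^+\mathcal A$, and the functor $$f^{++}\colon\mathrm{CExt}(\mathcal A)\to\mathrm{CExt}(f^+\mathcal A)$$ is a morphism of $\mathbb k$-vector spaces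 in categories: the canonical maps are isomorphisms $$f^{++}(\lambda_1\mathcal Q_1\dotplus\cdots\dotplus\lambda_n\mathcal Q_n)\cong\lambda_1f^{++}\mathcal Q_1\dotplus\cdots\dotplus\lambda_nf^{++}\mathcal Q_n$$ in $\mathrm{CExt}(f^+\mathcal A)$, natural in the $\mathcal Q_i$ and compatible with the structure isomorphisms of both sides. In particular $f^{++}$ is a morphism of Picard groupoids. -/

import Mathlib

open scoped TensorProduct Topology Manifold
open Filter

universe u

/-- The Cartan calculus of an algebra of functions `R` with its vector fields `T` and one-forms
`Ω`: action of fields on functions, Lie bracket, de Rham differential of functions, contraction and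
Lie derivative of one-forms. (For `α ∈ Ω` the form `ι_η dα` is `L η α - d (ι η α)`.)
This is only a record of the operations and of their usual identities; it is instantiated below
by the stalks of the sheaves of vector fields and of one-forms of a space. -/
structure Cartan (k : Type) (R T Ω : Type u) [Field k] [CommRing R] [Algebra k R]
    [AddCommGroup T] [Module R T] [AddCommGroup Ω] [Module R Ω] where
  act : T →+ R →+ R
  lie : T →+ T →+ T
  d : R →+ Ω
  ι : T →ₗ[R] Ω →ₗ[R] R
  L : T →+ Ω →+ Ω
  act_smul : ∀ (f : R) (D : T) (g : R), act (f • D) g = f * act D g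
  act_mul : ∀ (D : T) (f g : R), act D (f * g) = f * act D g + act D f * g
  act_const : ∀ (D : T) (c : k), act D (algebraMap k R c) = 0
  act_lie : ∀ (D D' : T) (f : R), act (lie D D') f = act D (act D' f) - act D' (act D f)
  lie_self : ∀ D : T, lie D D = 0
  lie_jacobi : ∀ D D' D'' : T, lie D (lie D' D'') = lie (lie D D') D'' + lie D' (lie D D'')
  lie_smul : ∀ (D : T) (f : R) (D' : T), lie D (f • D') = act D f • D' + f • lie D D'
  d_mul : ∀ f g : R, d (f * g) = f • d g + g • d f
  d_const : ∀ c : k, d (algebraMap k R c) = 0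
  ι_d : ∀ (D : T) (f : R), ι D (d f) = act D f
  L_smul : ∀ (D : T) (f : R) (α : Ω), L D (f • α) = act D f • α + f • L D α
  L_smul_left : ∀ (f : R) (D : T) (α : Ω), L (f • D) α = f • L D α + ι D α • d f
  L_d : ∀ (D : T) (f : R), L D (d f) = d (act D f)
  L_lie : ∀ (D D' : T) (α : Ω), L (lie D D') α = L D (L D' α) - L D' (L D α)
  ι_L : ∀ (D D' : T) (α : Ω), ι D' (L D α) = act D (ι D' α) - ι (lie D D') α

section Algebra

variable {k : Type} {R T Ω : Type u} [Field k] [CommRing R] [Algebra k R]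
  [AddCommGroup T] [Module R T] [AddCommGroup Ω] [Module R Ω]

/-- The structure of a Lie algebroid on (the stalk of) a module `A`: Lie bracket, linear anchor,
Leibniz rule. (`k`-bilinearity of the bracket follows from the Leibniz rule, since vector fields
annihilate constants.) -/
structure LieStr (𝒞 : Cartan k R T Ω) (A : Type u) [AddCommGroup A] [Module R A] where
  br : A →+ A →+ A
  anchor : A →ₗ[R] T
  br_self : ∀ a, br a a = 0
  jacobi : ∀ a b c, br a (br b c) = br (br a b) c + br b (br a c)
  anchor_br : ∀ a b, anchor (br a b) = 𝒞.lie (anchor a) (anchor b)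
  leibniz : ∀ (a : A) (f : R) (b : A), br a (f • b) = 𝒞.act (anchor a) f • b + f • br a b

/-- The structure of a Courant algebroid on (the stalk of) a module `Q`: a (left) Leibniz bracket,
anchor, symmetric pairing (not assumed to be non-degenerate), co-anchor, and their identities. -/
structure CourantStr (𝒞 : Cartan k R T Ω) (Q : Type u) [AddCommGroup Q] [Module R Q] where
  br : Q →+ Q →+ Q
  anchor : Q →ₗ[R] T
  pair : Q →ₗ[R] Q →ₗ[R] R
  coanchor : Ω →ₗ[R] Q
  pair_symm : ∀ q q', pair q q' = pair q' q
  jacobi : ∀ a b c, br a (br b c) = br (br a b) c + br b (br a c)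
  anchor_br : ∀ a b, anchor (br a b) = 𝒞.lie (anchor a) (anchor b)
  anchor_coanchor : ∀ α, anchor (coanchor α) = 0
  leibniz : ∀ (q : Q) (f : R) (q' : Q),
    br q (f • q') = f • br q q' + 𝒞.act (anchor q) f • q'
  pair_invariant : ∀ q q₁ q₂,
    pair (br q q₁) q₂ + pair q₁ (br q q₂) = 𝒞.act (anchor q) (pair q₁ q₂)
  br_coanchor : ∀ q α, br q (coanchor α) = coanchor (𝒞.L (anchor q) α)
  pair_coanchor : ∀ q α, pair q (coanchor α) = 𝒞.ι (anchor q) α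
  br_symm : ∀ q₁ q₂, br q₁ q₂ + br q₂ q₁ = coanchor (𝒞.d (pair q₁ q₂))

theorem Cartan.lie_skew (𝒞 : Cartan k R T Ω) (D D' : T) : 𝒞.lie D D' = - 𝒞.lie D' D := by
  have h := 𝒞.lie_self (D + D')
  simp only [map_add, AddMonoidHom.add_apply, 𝒞.lie_self, zero_add, add_zero] at h
  exact eq_neg_of_add_eq_zero_right h

theorem LieStr.skew {𝒞 : Cartan k R T Ω} {A : Type u} [AddCommGroup A] [Module R A]
    (S : LieStr 𝒞 A) (a b : A) : S.br a b = - S.br b a := by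
  have h := S.br_self (a + b)
  simp only [map_add, AddMonoidHom.add_apply, S.br_self, zero_add, add_zero] at h
  exact eq_neg_of_add_eq_zero_right h

theorem CourantStr.coanchor_br {𝒞 : Cartan k R T Ω} {Q : Type u} [AddCommGroup Q] [Module R Q]
    (S : CourantStr 𝒞 Q) (α : Ω) (q : Q) :
    S.br (S.coanchor α) q =
      S.coanchor (𝒞.d (𝒞.ι (S.anchor q) α) - 𝒞.L (S.anchor q) α) := by
  have h := S.br_symm q (S.coanchor α)
  rw [S.br_coanchor, S.pair_coanchor] at h
  rw [map_sub, ← h]; abel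

theorem CourantStr.smul_br {𝒞 : Cartan k R T Ω} {Q : Type u} [AddCommGroup Q] [Module R Q]
    (S : CourantStr 𝒞 Q) (f : R) (q p : Q) :
    S.br (f • q) p = f • S.br q p - 𝒞.act (S.anchor p) f • q
      + S.pair q p • S.coanchor (𝒞.d f) := by
  have h := S.br_symm (f • q) p
  have h' := S.br_symm q p
  rw [S.leibniz, map_smul S.pair, LinearMap.smul_apply, smul_eq_mul, 𝒞.d_mul, map_add,
    map_smul S.coanchor, map_smul S.coanchor, ← h', smul_add] at h
  rw [eq_sub_of_add_eq h]
  abel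

/-- A biadditive operation on `P` which preserves a submodule `C` and for which `N` is an ideal
of `C` descends to `C / (C ∩ N)`. -/
def quotBr {P : Type u} [AddCommGroup P] [Module R P] (C N : Submodule R P) (b : P →+ P →+ P)
    (hC : ∀ p ∈ C, ∀ p' ∈ C, b p p' ∈ C)
    (hl : ∀ n ∈ N, n ∈ C → ∀ p ∈ C, b n p ∈ N) (hr : ∀ n ∈ N, n ∈ C → ∀ p ∈ C, b p n ∈ N) :
    (C ⧸ N.comap C.subtype) →+ (C ⧸ N.comap C.subtype) →+ (C ⧸ N.comap C.subtype) :=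
  QuotientAddGroup.lift (N.comap C.subtype).toAddSubgroup
    (AddMonoidHom.mk' (fun p : C => QuotientAddGroup.lift (N.comap C.subtype).toAddSubgroup
      (AddMonoidHom.mk' (fun p' : C => (N.comap C.subtype).mkQ ⟨b p p', hC _ p.2 _ p'.2⟩)
        (fun x y => by
          rw [← map_add]; congr 1; ext; simp))
      (fun n hn => (Submodule.Quotient.mk_eq_zero _).2 (hr _ hn n.2 _ p.2)))
      (fun x y => by
        apply AddMonoidHom.ext; intro z
        induction z using QuotientAddGroup.induction_on with | H z => ?_
        change (N.comap C.subtype).mkQ _ = (N.comap C.subtype).mkQ _ + (N.comap C.subtype).mkQ _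
        rw [← map_add]; congr 1; ext; simp))
    (fun n hn => by
      apply AddMonoidHom.ext; intro z
      induction z using QuotientAddGroup.induction_on with | H z => ?_
      exact (Submodule.Quotient.mk_eq_zero _).2 (hl _ hn n.2 _ z.2))

theorem quotBr_mk {P : Type u} [AddCommGroup P] [Module R P] (C N : Submodule R P)
    (b : P →+ P →+ P) (hC hl hr) (p p' : C) :
    quotBr C N b hC hl hr ((N.comap C.subtype).mkQ p) ((N.comap C.subtype).mkQ p') =
      (N.comap C.subtype).mkQ ⟨b p p', hC _ p.2 _ p'.2⟩ := rfl

/-- A symmetric pairing on `P` for which `N` is orthogonal to `C` descends to `C / (C ∩ N)`. -/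
def quotPair {P : Type u} [AddCommGroup P] [Module R P] (C N : Submodule R P)
    (b : P →ₗ[R] P →ₗ[R] R) (hN : ∀ n ∈ N, ∀ p ∈ C, b n p = 0)
    (hs : ∀ p p', b p p' = b p' p) :
    (C ⧸ N.comap C.subtype) →ₗ[R] (C ⧸ N.comap C.subtype) →ₗ[R] R :=
  (N.comap C.subtype).liftQ
    ((N.comap C.subtype).liftQ (b.domRestrict₁₂ C C)
      (fun n hn => LinearMap.ext fun p => hN _ hn _ p.2)).flip
    (fun n hn => LinearMap.ext fun z => by
      obtain ⟨z, rfl⟩ := Submodule.mkQ_surjective _ z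
      exact (hs _ _).trans (hN _ hn _ z.2))

theorem quotPair_mk {P : Type u} [AddCommGroup P] [Module R P] (C N : Submodule R P)
    (b : P →ₗ[R] P →ₗ[R] R) (hN hs) (p p' : C) :
    quotPair C N b hN hs ((N.comap C.subtype).mkQ p) ((N.comap C.subtype).mkQ p') = b p p' :=
  hs _ _

/-- Data and identities on a module `P` that induce a Lie algebroid structure on the subquotient
`C / (C ∩ N)`. -/
structure LieSubquotient (𝒞 : Cartan k R T Ω) (P : Type u) [AddCommGroup P] [Module R P] where
  C : Submodule R P
  N : Submodule R P
  br : P →+ P →+ P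
  anchor : P →ₗ[R] T
  C_br : ∀ p ∈ C, ∀ p' ∈ C, br p p' ∈ C
  N_br : ∀ n ∈ N, n ∈ C → ∀ p ∈ C, br n p ∈ N
  N_anchor : ∀ n ∈ N, anchor n = 0
  br_self : ∀ p, br p p = 0
  jacobi : ∀ a ∈ C, ∀ b ∈ C, ∀ c ∈ C, br a (br b c) - (br (br a b) c + br b (br a c)) ∈ N
  anchor_br : ∀ a b, anchor (br a b) = 𝒞.lie (anchor a) (anchor b)
  leibniz : ∀ (a : P) (f : R) (b : P), br a (f • b) = 𝒞.act (anchor a) f • b + f • br a b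

/-- Data and identities on a module `P` that induce a Courant algebroid structure on the
subquotient `C / (C ∩ N)`. -/
structure CourantSubquotient (𝒞 : Cartan k R T Ω) (P : Type u) [AddCommGroup P] [Module R P] where
  C : Submodule R P
  N : Submodule R P
  br : P →+ P →+ P
  anchor : P →ₗ[R] T
  pair : P →ₗ[R] P →ₗ[R] R
  coanchor : Ω →ₗ[R] P
  C_br : ∀ p ∈ C, ∀ p' ∈ C, br p p' ∈ C
  C_coanchor : ∀ α, coanchor α ∈ C
  N_br : ∀ n ∈ N, n ∈ C → ∀ p ∈ C, br n p ∈ N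
  br_N : ∀ n ∈ N, n ∈ C → ∀ p ∈ C, br p n ∈ N
  N_anchor : ∀ n ∈ N, anchor n = 0
  N_pair : ∀ n ∈ N, ∀ p ∈ C, pair n p = 0
  pair_symm : ∀ q q', pair q q' = pair q' q
  jacobi : ∀ a ∈ C, ∀ b ∈ C, ∀ c ∈ C, br a (br b c) - (br (br a b) c + br b (br a c)) ∈ N
  anchor_br : ∀ a b, anchor (br a b) = 𝒞.lie (anchor a) (anchor b)
  anchor_coanchor : ∀ α, anchor (coanchor α) = 0
  leibniz : ∀ q ∈ C, ∀ (f : R) (q' : P),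
    br q (f • q') = f • br q q' + 𝒞.act (anchor q) f • q'
  pair_invariant : ∀ q ∈ C, ∀ q₁ ∈ C, ∀ q₂ ∈ C,
    pair (br q q₁) q₂ + pair q₁ (br q q₂) = 𝒞.act (anchor q) (pair q₁ q₂)
  br_coanchor : ∀ q α, br q (coanchor α) = coanchor (𝒞.L (anchor q) α)
  pair_coanchor : ∀ q α, pair q (coanchor α) = 𝒞.ι (anchor q) α
  br_symm : ∀ q₁ ∈ C, ∀ q₂ ∈ C, br q₁ q₂ + br q₂ q₁ - coanchor (𝒞.d (pair q₁ q₂)) ∈ N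

namespace LieSubquotient
variable {𝒞 : Cartan k R T Ω} {P : Type u} [AddCommGroup P] [Module R P]

theorem br_skew (S : LieSubquotient 𝒞 P) (a b : P) : S.br a b = - S.br b a := by
  have h := S.br_self (a + b)
  simp only [map_add, AddMonoidHom.add_apply, S.br_self, zero_add, add_zero] at h
  exact eq_neg_of_add_eq_zero_right h

/-- The induced Lie algebroid structure on the subquotient. -/
def str (S : LieSubquotient 𝒞 P) : LieStr 𝒞 (S.C ⧸ S.N.comap S.C.subtype) where
  br := quotBr S.C S.N S.br S.C_br S.N_br
    (fun n hn hn' p hp => by rw [S.br_skew]; exact S.N.neg_mem (S.N_br n hn hn' p hp))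
  anchor := (S.N.comap S.C.subtype).liftQ (S.anchor ∘ₗ S.C.subtype)
    (fun n hn => S.N_anchor _ hn)
  br_self a := by
    obtain ⟨a, rfl⟩ := Submodule.mkQ_surjective _ a
    rw [quotBr_mk]
    exact (Submodule.Quotient.mk_eq_zero _).2 (by simp [S.br_self])
  jacobi a b c := by
    obtain ⟨a, rfl⟩ := Submodule.mkQ_surjective _ a
    obtain ⟨b, rfl⟩ := Submodule.mkQ_surjective _ b
    obtain ⟨c, rfl⟩ := Submodule.mkQ_surjective _ c
    simp only [quotBr_mk, ← map_add]
    exact (Submodule.Quotient.eq _).2 (S.jacobi _ a.2 _ b.2 _ c.2)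
  anchor_br a b := by
    obtain ⟨a, rfl⟩ := Submodule.mkQ_surjective _ a
    obtain ⟨b, rfl⟩ := Submodule.mkQ_surjective _ b
    exact S.anchor_br _ _
  leibniz a f b := by
    obtain ⟨a, rfl⟩ := Submodule.mkQ_surjective _ a
    obtain ⟨b, rfl⟩ := Submodule.mkQ_surjective _ b
    exact congrArg (S.N.comap S.C.subtype).mkQ
      (Subtype.ext (S.leibniz a.1 f b.1) :
        (⟨S.br a (f • b), S.C_br _ a.2 _ (f • b).2⟩ : S.C) = 𝒞.act (S.anchor a) f • b + f • ⟨S.br a b, S.C_br _ a.2 _ b.2⟩)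

end LieSubquotient

namespace CourantSubquotient
variable {𝒞 : Cartan k R T Ω} {P : Type u} [AddCommGroup P] [Module R P]

/-- The induced Courant algebroid structure on the subquotient. -/
def str (S : CourantSubquotient 𝒞 P) : CourantStr 𝒞 (S.C ⧸ S.N.comap S.C.subtype) where
  br := quotBr S.C S.N S.br S.C_br S.N_br S.br_N
  anchor := (S.N.comap S.C.subtype).liftQ (S.anchor ∘ₗ S.C.subtype)
    (fun n hn => S.N_anchor _ hn)
  pair := quotPair S.C S.N S.pair S.N_pair S.pair_symm
  coanchor := (S.N.comap S.C.subtype).mkQ ∘ₗ S.coanchor.codRestrict S.C S.C_coanchor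
  pair_symm a b := by
    obtain ⟨a, rfl⟩ := Submodule.mkQ_surjective _ a
    obtain ⟨b, rfl⟩ := Submodule.mkQ_surjective _ b
    rw [quotPair_mk, quotPair_mk, S.pair_symm]
  jacobi a b c := by
    obtain ⟨a, rfl⟩ := Submodule.mkQ_surjective _ a
    obtain ⟨b, rfl⟩ := Submodule.mkQ_surjective _ b
    obtain ⟨c, rfl⟩ := Submodule.mkQ_surjective _ c
    simp only [quotBr_mk, ← map_add]
    exact (Submodule.Quotient.eq _).2 (S.jacobi _ a.2 _ b.2 _ c.2)
  anchor_br a b := by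
    obtain ⟨a, rfl⟩ := Submodule.mkQ_surjective _ a
    obtain ⟨b, rfl⟩ := Submodule.mkQ_surjective _ b
    exact S.anchor_br _ _
  anchor_coanchor α := S.anchor_coanchor α
  leibniz a f b := by
    obtain ⟨a, rfl⟩ := Submodule.mkQ_surjective _ a
    obtain ⟨b, rfl⟩ := Submodule.mkQ_surjective _ b
    exact congrArg (S.N.comap S.C.subtype).mkQ
      (Subtype.ext (S.leibniz a.1 a.2 f b.1) :
        (⟨S.br a (f • b), S.C_br _ a.2 _ (f • b).2⟩ : S.C) = f • ⟨S.br a b, S.C_br _ a.2 _ b.2⟩ + 𝒞.act (S.anchor a) f • b)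
  pair_invariant a b c := by
    obtain ⟨a, rfl⟩ := Submodule.mkQ_surjective _ a
    obtain ⟨b, rfl⟩ := Submodule.mkQ_surjective _ b
    obtain ⟨c, rfl⟩ := Submodule.mkQ_surjective _ c
    simp only [quotBr_mk, quotPair_mk]
    exact S.pair_invariant _ a.2 _ b.2 _ c.2
  br_coanchor a α := by
    obtain ⟨a, rfl⟩ := Submodule.mkQ_surjective _ a
    exact congrArg (S.N.comap S.C.subtype).mkQ (Subtype.ext (S.br_coanchor _ _))
  pair_coanchor a α := by
    obtain ⟨a, rfl⟩ := Submodule.mkQ_surjective _ a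
    exact (quotPair_mk _ _ _ _ _ _ _).trans (S.pair_coanchor _ _)
  br_symm a b := by
    obtain ⟨a, rfl⟩ := Submodule.mkQ_surjective _ a
    obtain ⟨b, rfl⟩ := Submodule.mkQ_surjective _ b
    rw [quotPair_mk]
    exact (Submodule.Quotient.eq _).2 (S.br_symm _ a.2 _ b.2)

end CourantSubquotient
end Algebra

section LinComb

variable {k : Type} {R T Ω : Type u} [Field k] [CommRing R] [Algebra k R]
  [AddCommGroup T] [Module R T] [AddCommGroup Ω] [Module R Ω]

/-- A biadditive map from its values. -/
def biadd {M N P : Type u} [AddCommGroup M] [AddCommGroup N] [AddCommGroup P] (f : M → N → P)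
    (hl : ∀ x x' y, f (x + x') y = f x y + f x' y) (hr : ∀ x y y', f x (y + y') = f x y + f x y') :
    M →+ N →+ P :=
  AddMonoidHom.mk' (fun x => AddMonoidHom.mk' (f x) (hr x))
    (fun x x' => AddMonoidHom.ext fun y => hl x x' y)

@[simp] theorem biadd_apply {M N P : Type u} [AddCommGroup M] [AddCommGroup N] [AddCommGroup P]
    (f : M → N → P) (hl hr) (x : M) (y : N) : biadd f hl hr x y = f x y := rfl

/-- `p : Q → A` is a morphism from a Courant algebroid to a Lie algebroid, on stalks. -/
structure IsCourantOver {𝒞 : Cartan k R T Ω} {A Q : Type u} [AddCommGroup A] [Module R A]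
    [AddCommGroup Q] [Module R Q] (SA : LieStr 𝒞 A) (SQ : CourantStr 𝒞 Q) (p : Q →ₗ[R] A) :
    Prop where
  map_br : ∀ q q', p (SQ.br q q') = SA.br (p q) (p q')
  anchor : ∀ q, SA.anchor (p q) = SQ.anchor q
  coanchor : ∀ α, p (SQ.coanchor α) = 0

variable {𝒞 : Cartan k R T Ω} {A : Type u} [AddCommGroup A] [Module R A] (SA : LieStr 𝒞 A)
  {n : ℕ} {Q : Fin n → Type u} [∀ i, AddCommGroup (Q i)] [∀ i, Module R (Q i)]
  (SQ : ∀ i, CourantStr 𝒞 (Q i)) (p : ∀ i, Q i →ₗ[R] A)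

/-- The module `Ω × (Q₁ ×_A ⋯ ×_A Qₙ)`, inside `Ω × A × ∏ Qᵢ`; the component in `A` is the common
image of the components in the `Qᵢ` (it matters only for `n = 0`). -/
def lcC (Ω : Type u) [AddCommGroup Ω] [Module R Ω] : Submodule R (Ω × A × (∀ i, Q i)) where
  carrier := {u | ∀ i, p i (u.2.2 i) = u.2.1}
  zero_mem' := fun i => by simp
  add_mem' := fun {u v} hu hv i => by simp [hu i, hv i]
  smul_mem' := fun f u hu i => by simp [hu i]

/-- The image of `(αᵢ) ↦ (∑ cᵢ αᵢ, -(π†αᵢ))`, the submodule to be divided out in order to form the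
push-out along `(αᵢ) ↦ ∑ cᵢ αᵢ`. -/
def lcN (c : Fin n → k) : Submodule R (Ω × A × (∀ i, Q i)) where
  carrier := {u | ∃ α : Fin n → Ω,
    u = (∑ i, algebraMap k R (c i) • α i, 0, fun i => - (SQ i).coanchor (α i))}
  zero_mem' := ⟨0, by ext <;> simp⟩
  add_mem' := by
    rintro _ _ ⟨α, rfl⟩ ⟨β, rfl⟩
    refine ⟨α + β, ?_⟩
    ext <;> simp [Finset.sum_add_distrib, add_comm]
  smul_mem' := by
    rintro f _ ⟨α, rfl⟩
    refine ⟨f • α, ?_⟩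
    ext <;> simp [Finset.smul_sum, smul_comm f]

/-- The bracket on `Ω × A × ∏ Qᵢ`. -/
def lcBr : (Ω × A × (∀ i, Q i)) →+ (Ω × A × (∀ i, Q i)) →+ (Ω × A × (∀ i, Q i)) :=
  biadd (fun u v =>
    (𝒞.L (SA.anchor u.2.1) v.1 - 𝒞.L (SA.anchor v.2.1) u.1 + 𝒞.d (𝒞.ι (SA.anchor v.2.1) u.1),
      SA.br u.2.1 v.2.1, fun i => (SQ i).br (u.2.2 i) (v.2.2 i)))
    (fun u u' v => by
      ext
      · simp; abel
      · simp
      · simp)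
    (fun u v v' => by
      ext
      · simp; abel
      · simp
      · simp)

/-- The pairing on `Ω × A × ∏ Qᵢ` with weights `cᵢ`. -/
def lcPair (c : Fin n → k) :
    (Ω × A × (∀ i, Q i)) →ₗ[R] (Ω × A × (∀ i, Q i)) →ₗ[R] R :=
  LinearMap.mk₂ R (fun u v => 𝒞.ι (SA.anchor u.2.1) v.1 + 𝒞.ι (SA.anchor v.2.1) u.1
      + ∑ i, algebraMap k R (c i) * (SQ i).pair (u.2.2 i) (v.2.2 i))
    (fun u u' v => by simp [mul_add, Finset.sum_add_distrib]; ring)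
    (fun f u v => by simp [mul_add, Finset.mul_sum, mul_left_comm])
    (fun u v v' => by simp [mul_add, Finset.sum_add_distrib]; ring)
    (fun f u v => by simp [mul_add, Finset.mul_sum, mul_left_comm])

/-- The linear combination `c₁ Q₁ ∔ ⋯ ∔ cₙ Qₙ` of Courant algebroids over `A` (on stalks), as the
subquotient `Ω × (Q₁ ×_A ⋯ ×_A Qₙ) / {(∑ cᵢ αᵢ, -(π†αᵢ))}`. -/
def lcSub (hp : ∀ i, IsCourantOver SA (SQ i) (p i)) (c' : Fin n → k) :
    CourantSubquotient 𝒞 (Ω × A × (∀ i, Q i)) where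
  C := lcC p Ω
  N := lcN SQ c'
  br := lcBr SA SQ
  anchor := SA.anchor ∘ₗ LinearMap.fst R _ _ ∘ₗ LinearMap.snd R _ _
  pair := lcPair SA SQ c'
  coanchor := LinearMap.inl R _ _
  C_br u hu v hv i := by simp [lcBr, (hp i).map_br, hu i, hv i]
  C_coanchor α i := by simp
  N_br := by
    rintro _ ⟨α, rfl⟩ - v hv
    refine ⟨fun i => 𝒞.d (𝒞.ι (SA.anchor v.2.1) (α i)) - 𝒞.L (SA.anchor v.2.1) (α i), ?_⟩
    ext
    · simp only [lcBr, biadd_apply, map_zero, AddMonoidHom.zero_apply, map_sum, zero_sub,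
        𝒞.L_smul, 𝒞.act_const, zero_smul, zero_add, map_smul, smul_eq_mul, 𝒞.d_mul, 𝒞.d_const,
        smul_zero, add_zero, smul_sub, Finset.sum_sub_distrib]
      abel
    · simp [lcBr]
    · rename_i i
      have : SA.anchor v.2.1 = (SQ i).anchor (v.2.2 i) := by rw [← hv i, (hp i).anchor]
      simp [lcBr, CourantStr.coanchor_br, this]
  br_N := by
    rintro _ ⟨α, rfl⟩ - v hv
    refine ⟨fun i => 𝒞.L (SA.anchor v.2.1) (α i), ?_⟩
    ext
    · simp [lcBr, 𝒞.L_smul, 𝒞.act_const]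
    · simp [lcBr]
    · rename_i i
      have : SA.anchor v.2.1 = (SQ i).anchor (v.2.2 i) := by rw [← hv i, (hp i).anchor]
      simp [lcBr, (SQ i).br_coanchor, this]
  N_anchor := by rintro _ ⟨α, rfl⟩; simp
  N_pair := by
    rintro _ ⟨α, rfl⟩ v hv
    have (i : Fin n) : SA.anchor v.2.1 = (SQ i).anchor (v.2.2 i) := by rw [← hv i, (hp i).anchor]
    simp only [lcPair, LinearMap.mk₂_apply, map_zero, LinearMap.zero_apply, map_sum, map_smul,
      smul_eq_mul, zero_add, map_neg, LinearMap.neg_apply, ← Finset.sum_add_distrib]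
    refine Finset.sum_eq_zero fun i _ => ?_
    rw [(SQ i).pair_symm, (SQ i).pair_coanchor, this i]
    ring
  pair_symm u v := by
    simp only [lcPair, LinearMap.mk₂_apply, fun i => (SQ i).pair_symm (u.2.2 i)]
    ring
  jacobi a _ b _ c _ := by
    convert (lcN SQ _).zero_mem using 1
    rw [sub_eq_zero]
    refine Prod.ext ?_ (Prod.ext (SA.jacobi _ _ _) (funext fun i => (SQ i).jacobi _ _ _))
    simp only [lcBr, biadd_apply, map_add, map_sub, SA.anchor_br, 𝒞.L_lie, 𝒞.L_d, 𝒞.ι_L, 𝒞.ι_d,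
      Prod.fst_add]
    abel
  anchor_br a b := by simp [lcBr, SA.anchor_br]
  anchor_coanchor α := by simp
  leibniz a ha f b := by
    ext
    · simp only [lcBr, biadd_apply, map_smul, LinearMap.smul_apply, Prod.smul_fst, Prod.smul_snd,
        Prod.fst_add, 𝒞.L_smul, 𝒞.L_smul_left, smul_eq_mul, 𝒞.d_mul, LinearMap.comp_apply,
        LinearMap.fst_apply, LinearMap.snd_apply]
      module
    · simp [lcBr, SA.leibniz, add_comm]
    · rename_i i
      have : SA.anchor a.2.1 = (SQ i).anchor (a.2.2 i) := by rw [← ha i, (hp i).anchor]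
      simp [lcBr, (SQ i).leibniz, this]
  pair_invariant a ha b hb c hc := by
    have (i : Fin n) : SA.anchor a.2.1 = (SQ i).anchor (a.2.2 i) := by rw [← ha i, (hp i).anchor]
    simp only [lcPair, lcBr, LinearMap.mk₂_apply, biadd_apply, map_add, map_sub, map_sum,
      LinearMap.comp_apply, LinearMap.fst_apply, LinearMap.snd_apply, 𝒞.act_mul, 𝒞.act_const,
      zero_mul, add_zero, SA.anchor_br, 𝒞.ι_L, 𝒞.ι_d]
    have h : ∑ i, algebraMap k R (c' i) *
          𝒞.act (SA.anchor a.2.1) ((SQ i).pair (b.2.2 i) (c.2.2 i)) =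
        ∑ i, algebraMap k R (c' i) * (SQ i).pair ((SQ i).br (a.2.2 i) (b.2.2 i)) (c.2.2 i) +
        ∑ i, algebraMap k R (c' i) * (SQ i).pair (b.2.2 i) ((SQ i).br (a.2.2 i) (c.2.2 i)) := by
      rw [← Finset.sum_add_distrib]
      refine Finset.sum_congr rfl fun i _ => ?_
      rw [this i, ← (SQ i).pair_invariant, mul_add]
    rw [h, 𝒞.lie_skew (SA.anchor c.2.1) (SA.anchor b.2.1)]
    simp only [map_neg, LinearMap.neg_apply]
    ring
  br_coanchor a α := by
    ext <;> simp [lcBr]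
  pair_coanchor a α := by simp [lcPair]
  br_symm a ha b hb := by
    refine ⟨fun i => - 𝒞.d ((SQ i).pair (a.2.2 i) (b.2.2 i)), ?_⟩
    ext
    · simp only [lcBr, lcPair, biadd_apply, LinearMap.mk₂_apply, map_add, map_sum, 𝒞.d_mul,
        𝒞.d_const, smul_zero, add_zero, Prod.fst_add, Prod.fst_sub, LinearMap.inl_apply,
        smul_neg, Finset.sum_neg_distrib, Prod.fst_sum]
      abel
    · simp [lcBr, SA.skew a.2.1]
    · simp [lcBr, (SQ _).br_symm]

end LinComb

section PullBack
set_option linter.unusedSectionVars false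

variable {k : Type} {R T Ω S U Θ : Type u} [Field k] [CommRing R] [Algebra k R]
  [AddCommGroup T] [Module R T] [AddCommGroup Ω] [Module R Ω]
  [CommRing S] [Algebra k S] [AddCommGroup U] [Module S U] [AddCommGroup Θ] [Module S Θ]

/-- The `S`-linear extension to `S ⊗_ℤ Q` of an additive map on `Q`. -/
def sext {Q M : Type u} [AddCommGroup Q] [AddCommGroup M] [Module S M] (f : Q →+ M) :
    S ⊗[ℤ] Q →ₗ[S] M :=
  f.toIntLinearMap.liftBaseChange S

@[simp] theorem sext_tmul {Q M : Type u} [AddCommGroup Q] [AddCommGroup M] [Module S M]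
    (f : Q →+ M) (h : S) (q : Q) : sext f (h ⊗ₜ[ℤ] q) = h • f q := rfl

/-- The `S`-bilinear extension to `S ⊗_ℤ Q` of a biadditive map on `Q`. -/
def sext₂ {Q M : Type u} [AddCommGroup Q] [AddCommGroup M] [Module S M] (f : Q →+ Q →+ M) :
    S ⊗[ℤ] Q →ₗ[S] S ⊗[ℤ] Q →ₗ[S] M :=
  sext (AddMonoidHom.mk' (fun q => sext (f q)) (fun q q' => by
    apply LinearMap.ext; intro t
    induction t using TensorProduct.induction_on with
    | zero => simp
    | tmul h p => simp
    | add x y hx hy => rw [map_add, hx, hy, map_add]))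

@[simp] theorem sext₂_tmul {Q M : Type u} [AddCommGroup Q] [AddCommGroup M] [Module S M]
    (f : Q →+ Q →+ M) (h j : S) (q p : Q) :
    sext₂ f (h ⊗ₜ[ℤ] q) (j ⊗ₜ[ℤ] p) = h • j • f q p := rfl

/-- `h ⊗ q ↦ ξ(h) ⊗ q` -/
def derT (𝒟 : Cartan k S U Θ) (Q : Type u) [AddCommGroup Q] :
    U →+ (S ⊗[ℤ] Q →+ S ⊗[ℤ] Q) :=
  AddMonoidHom.mk' (fun ξ => (TensorProduct.map (𝒟.act ξ).toIntLinearMap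
      (LinearMap.id : Q →ₗ[ℤ] Q)).toAddMonoidHom) (fun ξ η => by
    apply AddMonoidHom.ext; intro t
    induction t using TensorProduct.induction_on with
    | zero => simp
    | tmul h p => simp [TensorProduct.add_tmul]
    | add x y hx hy => rw [map_add, hx, hy, map_add])

@[simp] theorem derT_tmul (𝒟 : Cartan k S U Θ) {Q : Type u} [AddCommGroup Q] (ξ : U) (h : S)
    (q : Q) : derT 𝒟 Q ξ (h ⊗ₜ[ℤ] q) = 𝒟.act ξ h ⊗ₜ[ℤ] q := rfl

/-- `(h ⊗ q, j ⊗ p) ↦ j δ⟨q, p⟩ dh` -/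
def dpair (𝒟 : Cartan k S U Θ) {Q : Type u} [AddCommGroup Q] (pr : Q →+ Q →+ S) :
    S ⊗[ℤ] Q →+ S ⊗[ℤ] Q →+ Θ :=
  TensorProduct.liftAddHom (biadd (fun (h : S) (q : Q) =>
      (sext (biadd (fun (s : S) (θ : Θ) => s • θ) (fun _ _ _ => add_smul _ _ _)
        (fun _ _ _ => smul_add _ _ _) |>.flip (𝒟.d h) |>.comp (pr q))).toAddMonoidHom)
      (fun h h' q => by
        apply AddMonoidHom.ext; intro t
        induction t using TensorProduct.induction_on with
        | zero => simp
        | tmul h p => simp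
        | add x y hx hy => rw [map_add, hx, hy, map_add])
      (fun h q q' => by
        apply AddMonoidHom.ext; intro t
        induction t using TensorProduct.induction_on with
        | zero => simp
        | tmul h p => simp
        | add x y hx hy => rw [map_add, hx, hy, map_add]))
    (fun r h q => by
      apply AddMonoidHom.ext; intro t
      induction t using TensorProduct.induction_on with
      | zero => simp
      | tmul j p =>
        change j • pr q p • 𝒟.d (r • h) = j • pr (r • q) p • 𝒟.d h
        rw [map_zsmul, map_zsmul pr, AddMonoidHom.zsmul_apply]
        module
      | add x y hx hy => rw [map_add, hx, hy, map_add])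

@[simp] theorem dpair_tmul (𝒟 : Cartan k S U Θ) {Q : Type u} [AddCommGroup Q]
    (pr : Q →+ Q →+ S) (h j : S) (q p : Q) :
    dpair 𝒟 pr (h ⊗ₜ[ℤ] q) (j ⊗ₜ[ℤ] p) = j • pr q p • 𝒟.d h := rfl

theorem derT_smul (𝒟 : Cartan k S U Θ) {Q : Type u} [AddCommGroup Q] (ξ : U) (f : S)
    (t : S ⊗[ℤ] Q) : derT 𝒟 Q ξ (f • t) = 𝒟.act ξ f • t + f • derT 𝒟 Q ξ t := by
  induction t using TensorProduct.induction_on with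
  | zero => simp
  | tmul h p =>
    simp only [TensorProduct.smul_tmul', derT_tmul, smul_eq_mul, 𝒟.act_mul, ← TensorProduct.add_tmul]
    rw [add_comm]
  | add x y hx hy => simp only [smul_add, map_add, hx, hy]; abel

theorem smul_derT (𝒟 : Cartan k S U Θ) {Q : Type u} [AddCommGroup Q] (ξ : U) (f : S)
    (t : S ⊗[ℤ] Q) : derT 𝒟 Q (f • ξ) t = f • derT 𝒟 Q ξ t := by
  induction t using TensorProduct.induction_on with
  | zero => simp
  | tmul h p => simp [TensorProduct.smul_tmul', 𝒟.act_smul]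
  | add x y hx hy => simp only [smul_add, map_add, hx, hy]

theorem Cartan.act_one (𝒟 : Cartan k S U Θ) (ξ : U) : 𝒟.act ξ 1 = 0 := by
  simpa using 𝒟.act_const ξ 1

theorem Cartan.d_one (𝒟 : Cartan k S U Θ) : 𝒟.d 1 = 0 := by
  simpa using 𝒟.d_const 1

variable {𝒞 : Cartan k R T Ω} (𝒟 : Cartan k S U Θ) (φ : R →+* S)
  {Q : Type u} [AddCommGroup Q] [Module R Q]

/-- The action of `∑ hᵢ ⊗ qᵢ ∈ S ⊗ Q` on functions: `g ↦ ∑ hᵢ φ(π(qᵢ)(g))`. This is the image of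
`φ^*(π)(∑ hᵢ ⊗ qᵢ)` under the embedding of `φ^* T` in the module of derivations `R → S`. -/
def tact (𝒞 : Cartan k R T Ω) (φ : R →+* S) (π : Q →ₗ[R] T) (g : R) : S ⊗[ℤ] Q →ₗ[S] S :=
  sext (φ.toAddMonoidHom.comp ((𝒞.act.flip g).comp π.toAddMonoidHom))

@[simp] theorem tact_tmul (π : Q →ₗ[R] T) (g : R) (h : S) (q : Q) :
    tact 𝒞 φ π g (h ⊗ₜ[ℤ] q) = h * φ (𝒞.act (π q) g) := rfl

/-- The pairs `(t, ξ)` with `φ^*(π)(t) = dφ(ξ)`; both sides are compared as derivations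
`R → S`. -/
def compat (𝒞 : Cartan k R T Ω) (π : Q →ₗ[R] T) : Submodule S ((S ⊗[ℤ] Q) × U) where
  carrier := {u | ∀ g : R, 𝒟.act u.2 (φ g) = tact 𝒞 φ π g u.1}
  zero_mem' := fun g => by simp
  add_mem' := fun {u v} hu hv g => by simp [hu g, hv g]
  smul_mem' := fun f u hu g => by simp [𝒟.act_smul, hu g]

/-- The `S`-bilinear extension of the bracket of `Q`. -/
def brT (br : Q →+ Q →+ Q) : S ⊗[ℤ] Q →ₗ[S] S ⊗[ℤ] Q →ₗ[S] S ⊗[ℤ] Q :=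
  sext₂ (biadd (fun q p => (1 : S) ⊗ₜ[ℤ] br q p)
    (fun q q' p => by simp [TensorProduct.tmul_add])
    (fun q p p' => by simp [TensorProduct.tmul_add]))

@[simp] theorem brT_tmul (br : Q →+ Q →+ Q) (h j : S) (q p : Q) :
    brT br (h ⊗ₜ[ℤ] q) (j ⊗ₜ[ℤ] p) = (h * j) ⊗ₜ[ℤ] br q p := by
  simp [brT, TensorProduct.smul_tmul']

theorem tact_brT (br : Q →+ Q →+ Q) (π : Q →ₗ[R] T)
    (hπ : ∀ a b, π (br a b) = 𝒞.lie (π a) (π b)) {u v : (S ⊗[ℤ] Q) × U}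
    (hu : u ∈ compat 𝒟 φ 𝒞 π) (hv : v ∈ compat 𝒟 φ 𝒞 π) :
    (brT br u.1 v.1 - derT 𝒟 Q v.2 u.1 + derT 𝒟 Q u.2 v.1, 𝒟.lie u.2 v.2) ∈ compat 𝒟 φ 𝒞 π := by
  have key : ∀ (u : (S ⊗[ℤ] Q) × U), u ∈ compat 𝒟 φ 𝒞 π → ∀ (g : R) (t : S ⊗[ℤ] Q),
      𝒟.act u.2 (tact 𝒞 φ π g t) = tact 𝒞 φ π g (derT 𝒟 Q u.2 t) +
        sext₂ (biadd (fun q p => φ (𝒞.act (π q) (𝒞.act (π p) g))) (by simp) (by simp)) u.1 t := by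
    intro u hu g t
    induction t using TensorProduct.induction_on with
    | zero => simp
    | add x y hx hy => simp only [map_add, hx, hy]; ring
    | tmul j p =>
      have h0 : ∀ s : S ⊗[ℤ] Q, sext₂ (biadd (fun q p => φ (𝒞.act (π q) (𝒞.act (π p) g)))
          (by simp) (by simp)) s (j ⊗ₜ[ℤ] p) = j * tact 𝒞 φ π (𝒞.act (π p) g) s := by
        intro s
        induction s using TensorProduct.induction_on with
        | zero => simp
        | add x y hx hy => simp only [map_add, LinearMap.add_apply, hx, hy, mul_add]
        | tmul h q => simp [mul_left_comm]
      rw [h0, ← hu]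
      simp [𝒟.act_mul, add_comm]
  have h2 : ∀ (g : R) (s t : S ⊗[ℤ] Q), tact 𝒞 φ π g (brT br s t) =
      sext₂ (biadd (fun q p => φ (𝒞.act (π q) (𝒞.act (π p) g))) (by simp) (by simp)) s t -
      sext₂ (biadd (fun q p => φ (𝒞.act (π q) (𝒞.act (π p) g))) (by simp) (by simp)) t s := by
    intro g s t
    induction s using TensorProduct.induction_on with
    | zero => simp
    | add x y hx hy => simp only [map_add, LinearMap.add_apply, hx, hy]; ring
    | tmul h q =>
      induction t using TensorProduct.induction_on with
      | zero => simp
      | add x y hx hy => simp only [map_add, LinearMap.add_apply, hx, hy]; ring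
      | tmul j p => simp [hπ, 𝒞.act_lie]; ring
  intro g
  simp only [map_add, map_sub, 𝒟.act_lie, h2]
  rw [hu g, hv g, key u hu, key v hv]
  ring

section Lie
variable {A : Type u} [AddCommGroup A] [Module R A] (SA : LieStr 𝒞 A)

/-- The relations `φ(g) h ⊗ a = h ⊗ g a`: the quotient of `S ⊗_ℤ A` by them is `S ⊗_R A`. -/
def pullLieN (U : Type u) [AddCommGroup U] [Module S U] (φ : R →+* S)
    (A : Type u) [AddCommGroup A] [Module R A] : Submodule S ((S ⊗[ℤ] A) × U) :=
  Submodule.span S {u | ∃ (g : R) (a : A),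
    u = (φ g ⊗ₜ[ℤ] a - (1 : S) ⊗ₜ[ℤ] (g • a), 0)}

/-- The bracket `[(h ⊗ a, ξ), (j ⊗ b, η)] = (hj ⊗ [a, b] + ξ(j) ⊗ b - η(h) ⊗ a, [ξ, η])`. -/
def pullLieBr (br : A →+ A →+ A) : ((S ⊗[ℤ] A) × U) →+ ((S ⊗[ℤ] A) × U) →+ ((S ⊗[ℤ] A) × U) :=
  biadd (fun u v => (brT br u.1 v.1 - derT 𝒟 A v.2 u.1 + derT 𝒟 A u.2 v.1, 𝒟.lie u.2 v.2))
    (fun u u' v => by ext <;> simp; abel)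
    (fun u v v' => by ext <;> simp; abel)

theorem prod_ind {M : Type u} [AddCommGroup M] {F : (S ⊗[ℤ] Q) × M → Prop}
    (hadd : ∀ u v, F u → F v → F (u + v)) (h : ∀ (h : S) (q : Q) (ξ : M), F (h ⊗ₜ[ℤ] q, ξ))
    (u : (S ⊗[ℤ] Q) × M) : F u := by
  obtain ⟨t, ξ⟩ := u
  induction t using TensorProduct.induction_on generalizing ξ with
  | zero => simpa using h 0 0 ξ
  | tmul j p => exact h j p ξ
  | add x y hx hy => simpa using hadd _ _ (hx ξ) (hy 0)

theorem pullLieBr_smul (br : A →+ A →+ A) (u : (S ⊗[ℤ] A) × U) (f : S) (v : (S ⊗[ℤ] A) × U) :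
    pullLieBr 𝒟 br u (f • v) = 𝒟.act u.2 f • v + f • pullLieBr 𝒟 br u v := by
  refine Prod.ext ?_ ?_
  · simp only [pullLieBr, biadd_apply, Prod.smul_fst, Prod.smul_snd, map_smul, smul_derT,
      derT_smul, Prod.fst_add]
    module
  · simp [pullLieBr, 𝒟.lie_smul]

theorem brT_skew (s t : S ⊗[ℤ] A) : brT SA.br s t = - brT SA.br t s := by
  induction s using TensorProduct.induction_on with
  | zero => simp
  | add x y hx hy => simp only [map_add, LinearMap.add_apply, hx, hy]; abel
  | tmul h q =>
    induction t using TensorProduct.induction_on with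
    | zero => simp
    | add x y hx hy => simp only [map_add, LinearMap.add_apply, hx, hy]; abel
    | tmul j p => rw [brT_tmul, brT_tmul, SA.skew, mul_comm, TensorProduct.tmul_neg]

theorem brT_self (t : S ⊗[ℤ] A) : brT SA.br t t = 0 := by
  induction t using TensorProduct.induction_on with
  | zero => simp
  | add x y hx hy => simp only [map_add, LinearMap.add_apply, hx, hy, brT_skew SA x y]; abel
  | tmul h q => simp [SA.br_self]

theorem pullLieBr_skew (u v : (S ⊗[ℤ] A) × U) :
    pullLieBr 𝒟 SA.br u v = - pullLieBr 𝒟 SA.br v u := by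
  refine Prod.ext ?_ ?_
  · simp only [pullLieBr, biadd_apply, Prod.fst_neg, brT_skew SA u.1 v.1]
    abel
  · simpa [pullLieBr] using 𝒟.lie_skew _ _

theorem pullLieBr_jacobi (a b c : (S ⊗[ℤ] A) × U) :
    pullLieBr 𝒟 SA.br a (pullLieBr 𝒟 SA.br b c) =
      pullLieBr 𝒟 SA.br (pullLieBr 𝒟 SA.br a b) c +
        pullLieBr 𝒟 SA.br b (pullLieBr 𝒟 SA.br a c) := by
  induction a using prod_ind with
  | hadd x y hx hy => simp only [map_add, AddMonoidHom.add_apply, hx, hy]; abel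
  | h h q ξ =>
  induction b using prod_ind with
  | hadd x y hx hy => simp only [map_add, AddMonoidHom.add_apply, hx, hy]; abel
  | h j p η =>
  induction c using prod_ind with
  | hadd x y hx hy => simp only [map_add, hx, hy]; abel
  | h l r ζ =>
  refine Prod.ext ?_ (by simp [pullLieBr, 𝒟.lie_jacobi ξ])
  simp only [pullLieBr, biadd_apply, brT_tmul, derT_tmul, map_add, map_sub, LinearMap.add_apply,
    LinearMap.sub_apply, 𝒟.act_mul, 𝒟.act_lie, Prod.fst_add, SA.jacobi q, SA.skew p q,
    TensorProduct.tmul_add, TensorProduct.add_tmul, TensorProduct.sub_tmul, TensorProduct.tmul_neg]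
  simp only [mul_comm, mul_left_comm]
  abel

/-- The inverse image of a Lie algebroid (on stalks): the pairs `(t, ξ)` in `(S ⊗ A) × U` with
`φ^*(σ)(t) = dφ(ξ)`. The submodule `C` is the stalk of the fibre product. -/
def pullLie (C : Submodule S ((S ⊗[ℤ] A) × U)) (hC : C ≤ compat 𝒟 φ 𝒞 SA.anchor)
    (hbr : ∀ u ∈ C, ∀ v ∈ C, pullLieBr 𝒟 SA.br u v ∈ C) :
    LieSubquotient 𝒟 ((S ⊗[ℤ] A) × U) where
  C := C
  N := pullLieN U φ A
  br := pullLieBr 𝒟 SA.br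
  anchor := LinearMap.snd S _ _
  C_br := hbr
  N_br n hn hn' v hv := by
    clear hn'
    have hv' := hC hv
    rw [pullLieBr_skew]
    refine Submodule.neg_mem _ ?_
    induction hn using Submodule.span_induction with
    | zero => simp
    | add x y _ _ hx hy => rw [map_add]; exact Submodule.add_mem _ hx hy
    | smul f x hx hx' =>
      rw [pullLieBr_smul]
      exact Submodule.add_mem _ (Submodule.smul_mem _ _ hx) (Submodule.smul_mem _ _ hx')
    | mem x hx =>
      obtain ⟨g, a, rfl⟩ := hx
      have key : ∀ t : S ⊗[ℤ] A, ((brT SA.br t (φ g ⊗ₜ[ℤ] a - (1 : S) ⊗ₜ[ℤ] (g • a))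
          + tact 𝒞 φ SA.anchor g t ⊗ₜ[ℤ] a, 0) : (S ⊗[ℤ] A) × U) ∈ pullLieN U φ A := by
        intro t
        induction t using TensorProduct.induction_on with
        | zero => convert (pullLieN U φ A).zero_mem using 1; ext <;> simp
        | add x y hx hy =>
          convert Submodule.add_mem _ hx hy using 1
          ext
          · simp only [map_add, LinearMap.add_apply, TensorProduct.add_tmul, Prod.fst_add]; abel
          · simp
        | tmul h q =>
          have h1 : _ ∈ pullLieN U φ A := Submodule.subset_span ⟨g, SA.br q a, rfl⟩
          have h2 : _ ∈ pullLieN U φ A :=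
            Submodule.subset_span ⟨𝒞.act (SA.anchor q) g, a, rfl⟩
          convert Submodule.add_mem _ (Submodule.smul_mem _ h h1) (Submodule.smul_mem _ h h2)
            using 1
          ext
          · simp only [map_sub, brT_tmul, SA.leibniz, tact_tmul, TensorProduct.tmul_add, smul_sub,
              TensorProduct.smul_tmul', smul_eq_mul, mul_one, Prod.fst_add, Prod.smul_fst]
            abel
          · simp
      have := key v.1
      rw [← hv' g] at this
      convert this using 1
      ext
      · simp [pullLieBr, 𝒟.act_one]
      · simp [pullLieBr]
  N_anchor n hn := by
    induction hn using Submodule.span_induction with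
    | zero => simp
    | add x y _ _ hx hy => rw [map_add, hx, hy, add_zero]
    | smul f x _ hx => rw [map_smul, hx, smul_zero]
    | mem x hx => obtain ⟨g, a, rfl⟩ := hx; simp
  br_self u := by
    refine Prod.ext ?_ (by simp [pullLieBr, 𝒟.lie_self])
    simp [pullLieBr, brT_self]
  jacobi a _ b _ c _ := by
    rw [← pullLieBr_jacobi, sub_self]
    exact Submodule.zero_mem _
  anchor_br a b := by simp [pullLieBr]
  leibniz a f b := pullLieBr_smul 𝒟 SA.br a f b
end Lie
end PullBack

section PullCourant
set_option linter.unusedSectionVars false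

variable {k : Type} {R T Ω S U Θ : Type u} [Field k] [CommRing R] [Algebra k R]
  [AddCommGroup T] [Module R T] [AddCommGroup Ω] [Module R Ω]
  [CommRing S] [Algebra k S] [AddCommGroup U] [Module S U] [AddCommGroup Θ] [Module S Θ]
  {𝒞 : Cartan k R T Ω} (𝒟 : Cartan k S U Θ) (φ : R →+* S)
  {Q : Type u} [AddCommGroup Q] [Module R Q] (SQ : CourantStr 𝒞 Q)

/-- The pairing of `Q` with values in `S`. -/
def CourantStr.pairS : Q →+ Q →+ S :=
  biadd (fun q p => φ (SQ.pair q p)) (by simp) (by simp)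

/-- The relations to be divided out of `Θ ⊕ (S ⊗_ℤ Q) ⊕ U`: `φ(g) h ⊗ q = h ⊗ g q`, which turn
`S ⊗_ℤ Q` into `S ⊗_R Q`, and `h φ^*(α) = h ⊗ π†(α)` for the forms `α = df`, which generate all
one-forms. -/
def pullN (Θ U : Type u) [AddCommGroup U] [Module S U] [AddCommGroup Θ] [Module S Θ]
    (𝒟 : Cartan k S U Θ) (φ : R →+* S) (SQ : CourantStr 𝒞 Q) :
    Submodule S (Θ × (S ⊗[ℤ] Q) × U) :=
  Submodule.span S ({u | ∃ (g : R) (q : Q),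
      u = (0, φ g ⊗ₜ[ℤ] q - (1 : S) ⊗ₜ[ℤ] (g • q), 0)} ∪
    {u | ∃ f : R, u = (𝒟.d (φ f), - ((1 : S) ⊗ₜ[ℤ] SQ.coanchor (𝒞.d f)), 0)})

/-- The bracket `{(α, h ⊗ q, ξ), (β, j ⊗ p, η)} =
(L_ξ β - ι_η dα + j ⟨q, p⟩ dh, hj ⊗ {q, p} - η(h) ⊗ q + ξ(j) ⊗ p, [ξ, η])`. -/
def pullBr : (Θ × (S ⊗[ℤ] Q) × U) →+ (Θ × (S ⊗[ℤ] Q) × U) →+ (Θ × (S ⊗[ℤ] Q) × U) :=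
  biadd (fun u v =>
    (𝒟.L u.2.2 v.1 - (𝒟.L v.2.2 u.1 - 𝒟.d (𝒟.ι v.2.2 u.1)) + dpair 𝒟 (SQ.pairS φ) u.2.1 v.2.1,
      brT SQ.br u.2.1 v.2.1 - derT 𝒟 Q v.2.2 u.2.1 + derT 𝒟 Q u.2.2 v.2.1, 𝒟.lie u.2.2 v.2.2))
    (fun u u' v => by ext <;> simp <;> abel)
    (fun u v v' => by ext <;> simp <;> abel)

/-- The pairing `⟨(α, h ⊗ q, ξ), (β, j ⊗ p, η)⟩ = ι_ξ β + ι_η α + hj ⟨q, p⟩`. -/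
def pullPair : (Θ × (S ⊗[ℤ] Q) × U) →ₗ[S] (Θ × (S ⊗[ℤ] Q) × U) →ₗ[S] S :=
  LinearMap.mk₂ S (fun u v => 𝒟.ι u.2.2 v.1 + 𝒟.ι v.2.2 u.1 + sext₂ (SQ.pairS φ) u.2.1 v.2.1)
    (fun u u' v => by simp; ring) (fun f u v => by simp; ring)
    (fun u v v' => by simp; ring) (fun f u v => by simp; ring)

theorem prod_ind' {M N : Type u} [AddCommGroup M] [AddCommGroup N]
    {F : N × (S ⊗[ℤ] Q) × M → Prop}
    (hadd : ∀ u v, F u → F v → F (u + v))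
    (h : ∀ (α : N) (h : S) (q : Q) (ξ : M), F (α, h ⊗ₜ[ℤ] q, ξ))
    (u : N × (S ⊗[ℤ] Q) × M) : F u := by
  obtain ⟨α, t, ξ⟩ := u
  induction t using TensorProduct.induction_on generalizing ξ α with
  | zero => simpa using h α 0 0 ξ
  | tmul j p => exact h α j p ξ
  | add x y hx hy => simpa using hadd _ _ (hx α ξ) (hy 0 0)

variable {φ}

theorem genQ_mem (g : R) (q : Q) :
    ((0, φ g ⊗ₜ[ℤ] q - (1 : S) ⊗ₜ[ℤ] (g • q), 0) : Θ × (S ⊗[ℤ] Q) × U) ∈ pullN Θ U 𝒟 φ SQ :=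
  Submodule.subset_span (Or.inl ⟨g, q, rfl⟩)

theorem genD_mem (f : R) :
    ((𝒟.d (φ f), - ((1 : S) ⊗ₜ[ℤ] SQ.coanchor (𝒞.d f)), 0) : Θ × (S ⊗[ℤ] Q) × U) ∈
      pullN Θ U 𝒟 φ SQ :=
  Submodule.subset_span (Or.inr ⟨f, rfl⟩)

theorem pullBr_symm (u v : Θ × (S ⊗[ℤ] Q) × U) :
    pullBr 𝒟 φ SQ u v + pullBr 𝒟 φ SQ v u - (𝒟.d (pullPair 𝒟 φ SQ u v), 0, 0) ∈
      pullN Θ U 𝒟 φ SQ := by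
  induction u using prod_ind' with
  | hadd x y hx hy =>
    convert Submodule.add_mem _ hx hy using 1
    ext <;> simp <;> abel
  | h α h q ξ =>
  induction v using prod_ind' with
  | hadd x y hx hy =>
    convert Submodule.add_mem _ hx hy using 1
    ext <;> simp <;> abel
  | h β j p η =>
  convert Submodule.neg_mem _ (Submodule.smul_mem _ (h * j) (genD_mem 𝒟 SQ (SQ.pair q p))) using 1
  refine Prod.ext ?_ (Prod.ext ?_ ?_)
  · simp only [pullBr, pullPair, biadd_apply, dpair_tmul, CourantStr.pairS, LinearMap.mk₂_apply,
      sext₂_tmul, smul_eq_mul, map_add, 𝒟.d_mul, SQ.pair_symm p q, Prod.fst_add, Prod.fst_sub,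
      Prod.smul_fst, Prod.fst_neg]
    module
  · simp only [pullBr, biadd_apply, brT_tmul, derT_tmul, Prod.snd_add, Prod.fst_add, Prod.snd_sub,
      Prod.fst_sub, Prod.smul_snd, Prod.smul_fst, Prod.snd_neg, Prod.fst_neg, smul_neg, neg_neg,
      TensorProduct.smul_tmul', ← SQ.br_symm, TensorProduct.tmul_add, smul_eq_mul, mul_one,
      mul_comm j h, smul_add]
    abel
  · simp [pullBr, 𝒟.lie_skew ξ]

theorem pullBr_smul (u : Θ × (S ⊗[ℤ] Q) × U) (f : S) (v : Θ × (S ⊗[ℤ] Q) × U) :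
    pullBr 𝒟 φ SQ u (f • v) = f • pullBr 𝒟 φ SQ u v + 𝒟.act u.2.2 f • v := by
  have hd : ∀ s t : S ⊗[ℤ] Q, dpair 𝒟 (SQ.pairS φ) s (f • t) =
      f • dpair 𝒟 (SQ.pairS φ) s t - sext₂ (SQ.pairS φ) s t • 𝒟.d f + sext₂ (SQ.pairS φ) s t • 𝒟.d f
      := by
    intro s t
    rw [sub_add_cancel]
    induction s using TensorProduct.induction_on with
    | zero => simp
    | add x y hx hy => simp only [map_add, AddMonoidHom.add_apply, hx, hy, smul_add]
    | tmul h q =>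
      induction t using TensorProduct.induction_on with
      | zero => simp
      | add x y hx hy => simp only [map_add, hx, hy, smul_add]
      | tmul j p => simp [TensorProduct.smul_tmul', mul_smul]
  refine Prod.ext ?_ (Prod.ext ?_ ?_)
  · simp only [pullBr, biadd_apply, Prod.smul_fst, Prod.smul_snd, map_smul, LinearMap.smul_apply,
      Prod.fst_add, 𝒟.L_smul, 𝒟.L_smul_left, smul_eq_mul, 𝒟.d_mul, hd]
    module
  · simp only [pullBr, biadd_apply, Prod.smul_fst, Prod.smul_snd, map_smul, smul_derT,
      derT_smul, Prod.fst_add, Prod.snd_add]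
    module
  · simp [pullBr, 𝒟.lie_smul, add_comm]

variable (φ) in
/-- The difference of the two derivations `R → S` defined by `(t, ξ)`. -/
def dev (u : Θ × (S ⊗[ℤ] Q) × U) : R →+ S :=
  (𝒟.act u.2.2).comp φ.toAddMonoidHom -
    AddMonoidHom.mk' (fun g => tact 𝒞 φ SQ.anchor g u.2.1) (fun g g' => by
      induction u.2.1 using TensorProduct.induction_on with
      | zero => simp
      | tmul h q => simp [mul_add]
      | add x y hx hy => simp only [map_add, hx, hy]; ring)

/-- The pairing of `Q`, followed by an additive map `δ`. -/
def CourantStr.pairδ (δ : R →+ S) : Q →+ Q →+ S :=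
  biadd (fun q p => δ (SQ.pair q p)) (by simp) (by simp)

theorem pullBr_jacobi (a b c : Θ × (S ⊗[ℤ] Q) × U) :
    pullBr 𝒟 φ SQ a (pullBr 𝒟 φ SQ b c) - (pullBr 𝒟 φ SQ (pullBr 𝒟 φ SQ a b) c +
        pullBr 𝒟 φ SQ b (pullBr 𝒟 φ SQ a c))
      - (dpair 𝒟 (SQ.pairδ (dev 𝒟 φ SQ a)) b.2.1 c.2.1
        + dpair 𝒟 (SQ.pairδ (dev 𝒟 φ SQ c)) a.2.1 b.2.1
        - dpair 𝒟 (SQ.pairδ (dev 𝒟 φ SQ b)) a.2.1 c.2.1, 0, 0) ∈ pullN Θ U 𝒟 φ SQ := by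
  have hδ : ∀ (u v : Θ × (S ⊗[ℤ] Q) × U) (s t : S ⊗[ℤ] Q),
      dpair 𝒟 (SQ.pairδ (dev 𝒟 φ SQ (u + v))) s t =
      dpair 𝒟 (SQ.pairδ (dev 𝒟 φ SQ u)) s t + dpair 𝒟 (SQ.pairδ (dev 𝒟 φ SQ v)) s t := by
    intro u v s t
    induction s using TensorProduct.induction_on with
    | zero => simp
    | add x y hx hy => simp only [map_add, AddMonoidHom.add_apply, hx, hy]; abel
    | tmul h q =>
      induction t using TensorProduct.induction_on with
      | zero => simp
      | add x y hx hy => simp only [map_add, hx, hy]; abel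
      | tmul j p => simp [CourantStr.pairδ, dev]; module
  induction a using prod_ind' with
  | hadd x y hx hy =>
    convert Submodule.add_mem _ hx hy using 1
    refine Prod.ext ?_ (Prod.ext ?_ ?_)
    · simp only [map_add, AddMonoidHom.add_apply, Prod.fst_add, Prod.snd_add, Prod.fst_sub, hδ]
      abel
    · simp; abel
    · simp; abel
  | h α h q ξ =>
  induction b using prod_ind' with
  | hadd x y hx hy =>
    convert Submodule.add_mem _ hx hy using 1
    refine Prod.ext ?_ (Prod.ext ?_ ?_)
    · simp only [map_add, AddMonoidHom.add_apply, Prod.fst_add, Prod.snd_add, Prod.fst_sub, hδ]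
      abel
    · simp; abel
    · simp; abel
  | h β j p η =>
  induction c using prod_ind' with
  | hadd x y hx hy =>
    convert Submodule.add_mem _ hx hy using 1
    refine Prod.ext ?_ (Prod.ext ?_ ?_)
    · simp only [map_add, Prod.fst_add, Prod.snd_add, Prod.fst_sub, hδ]
      abel
    · simp; abel
    · simp; abel
  | h γ l r ζ =>
  convert Submodule.neg_mem _
    (Submodule.smul_mem _ (j * 𝒟.act ζ h) (genD_mem 𝒟 SQ (SQ.pair q p))) using 1
  refine Prod.ext ?_ (Prod.ext ?_ ?_)
  · have h1 : φ (𝒞.act (SQ.anchor q) (SQ.pair p r)) =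
        φ (SQ.pair (SQ.br q p) r) + φ (SQ.pair p (SQ.br q r)) := by
      rw [← map_add, SQ.pair_invariant]
    have h2 : φ (𝒞.act (SQ.anchor p) (SQ.pair q r)) =
        φ (SQ.pair (SQ.br p q) r) + φ (SQ.pair q (SQ.br p r)) := by
      rw [← map_add, SQ.pair_invariant]
    have h3 : φ (𝒞.act (SQ.anchor r) (SQ.pair q p)) =
        φ (SQ.pair (SQ.br q p) r) + φ (SQ.pair (SQ.br p q) r) := by
      rw [← map_add, ← LinearMap.add_apply, ← map_add, SQ.br_symm,
        SQ.pair_symm (SQ.coanchor _), SQ.pair_coanchor, 𝒞.ι_d]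
    simp only [pullBr, biadd_apply, dpair_tmul, CourantStr.pairS, CourantStr.pairδ, dev, map_add,
      map_sub, AddMonoidHom.add_apply, AddMonoidHom.sub_apply, brT_tmul, derT_tmul, tact_tmul,
      AddMonoidHom.comp_apply, AddMonoidHom.mk'_apply, 𝒟.d_mul, 𝒟.L_smul, 𝒟.L_d, 𝒟.L_lie, 𝒟.ι_L,
      𝒟.ι_d, 𝒟.act_mul, smul_eq_mul, Prod.fst_add, Prod.fst_sub, Prod.fst_neg, Prod.smul_fst,
      RingHom.toAddMonoidHom_eq_coe, AddMonoidHom.coe_coe, SQ.pair_symm p q, h1, h2, h3,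
      map_smul, LinearMap.sub_apply]
    module
  · simp only [pullBr, biadd_apply, brT_tmul, derT_tmul, map_add, map_sub, LinearMap.add_apply,
      LinearMap.sub_apply, 𝒟.act_mul, 𝒟.act_lie, Prod.fst_add, Prod.snd_add, Prod.fst_sub,
      Prod.snd_sub, Prod.snd_neg, Prod.fst_neg, Prod.smul_snd, Prod.smul_fst, SQ.jacobi q,
      TensorProduct.tmul_add, TensorProduct.add_tmul, TensorProduct.sub_tmul,
      TensorProduct.tmul_neg, TensorProduct.smul_tmul', ← SQ.br_symm, smul_eq_mul, mul_one,
      smul_neg, neg_neg, sub_zero, smul_add]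
    simp only [mul_comm, mul_left_comm]
    abel
  · simp [pullBr, 𝒟.lie_jacobi ξ]

theorem dpair_zero (s t : S ⊗[ℤ] Q) (δ : R →+ S) (hδ : ∀ g, δ g = 0) :
    dpair 𝒟 (SQ.pairδ δ) s t = 0 := by
  induction s using TensorProduct.induction_on with
  | zero => simp
  | add x y hx hy => simp only [map_add, AddMonoidHom.add_apply, hx, hy, add_zero]
  | tmul h q =>
    induction t using TensorProduct.induction_on with
    | zero => simp
    | add x y hx hy => simp only [map_add, hx, hy, add_zero]
    | tmul j p => simp [CourantStr.pairδ, hδ]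

theorem pullPair_symm (u v : Θ × (S ⊗[ℤ] Q) × U) :
    pullPair 𝒟 φ SQ u v = pullPair 𝒟 φ SQ v u := by
  have : ∀ s t : S ⊗[ℤ] Q, sext₂ (SQ.pairS φ) s t = sext₂ (SQ.pairS φ) t s := by
    intro s t
    induction s using TensorProduct.induction_on with
    | zero => simp
    | add x y hx hy => simp only [map_add, LinearMap.add_apply, hx, hy]
    | tmul h q =>
      induction t using TensorProduct.induction_on with
      | zero => simp
      | add x y hx hy => simp only [map_add, LinearMap.add_apply, hx, hy]
      | tmul j p => simp [CourantStr.pairS, SQ.pair_symm q p, mul_left_comm]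
  simp only [pullPair, LinearMap.mk₂_apply, this u.2.1]
  ring

/-- The elements `(α, t, ξ)` with `φ^*(π)(t) = dφ(ξ)`. -/
def compat' (Θ : Type u) [AddCommGroup Θ] [Module S Θ] (𝒟 : Cartan k S U Θ) (φ : R →+* S)
    (SQ : CourantStr 𝒞 Q) : Submodule S (Θ × (S ⊗[ℤ] Q) × U) :=
  (compat 𝒟 φ 𝒞 SQ.anchor).comap (LinearMap.snd S _ _)

theorem mem_compat' {v : Θ × (S ⊗[ℤ] Q) × U} : v ∈ compat' Θ 𝒟 φ SQ ↔
    ∀ g, 𝒟.act v.2.2 (φ g) = tact 𝒞 φ SQ.anchor g v.2.1 := Iff.rfl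

variable {𝒟}

theorem pullPair_pullN {n : Θ × (S ⊗[ℤ] Q) × U} (hn : n ∈ pullN Θ U 𝒟 φ SQ)
    {v : Θ × (S ⊗[ℤ] Q) × U} (hv : v ∈ compat' Θ 𝒟 φ SQ) : pullPair 𝒟 φ SQ n v = 0 := by
  induction hn using Submodule.span_induction with
  | zero => simp
  | add x y _ _ hx hy => rw [map_add, LinearMap.add_apply, hx, hy, add_zero]
  | smul f x _ hx => rw [map_smul, LinearMap.smul_apply, hx, smul_zero]
  | mem x hx =>
    rcases hx with ⟨g, q, rfl⟩ | ⟨f, rfl⟩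
    · have : ∀ t : S ⊗[ℤ] Q,
          sext₂ (SQ.pairS φ) (φ g ⊗ₜ[ℤ] q - (1 : S) ⊗ₜ[ℤ] (g • q)) t = 0 := by
        intro t
        induction t using TensorProduct.induction_on with
        | zero => simp
        | add x y hx hy => rw [map_add, hx, hy, add_zero]
        | tmul j p => simp [CourantStr.pairS]; ring
      simp only [pullPair, LinearMap.mk₂_apply, this, map_zero, LinearMap.zero_apply, add_zero]
    · have : ∀ t : S ⊗[ℤ] Q, sext₂ (SQ.pairS φ) ((1 : S) ⊗ₜ[ℤ] SQ.coanchor (𝒞.d f)) t =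
          tact 𝒞 φ SQ.anchor f t := by
        intro t
        induction t using TensorProduct.induction_on with
        | zero => simp
        | add x y hx hy => rw [map_add, hx, hy, map_add]
        | tmul j p => simp [CourantStr.pairS, SQ.pair_symm _ p, SQ.pair_coanchor, 𝒞.ι_d]
      simp only [pullPair, LinearMap.mk₂_apply, map_neg, LinearMap.neg_apply, this, map_zero,
        LinearMap.zero_apply, zero_add, 𝒟.ι_d]
      rw [← (mem_compat' 𝒟 SQ).1 hv f]
      simp

theorem pullBr_pullN {n : Θ × (S ⊗[ℤ] Q) × U} (hn : n ∈ pullN Θ U 𝒟 φ SQ)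
    {v : Θ × (S ⊗[ℤ] Q) × U} (hv : v ∈ compat' Θ 𝒟 φ SQ) :
    pullBr 𝒟 φ SQ v n ∈ pullN Θ U 𝒟 φ SQ := by
  induction hn using Submodule.span_induction with
  | zero => simp
  | add x y _ _ hx hy => rw [map_add]; exact Submodule.add_mem _ hx hy
  | smul f x hx hx' =>
    rw [pullBr_smul]
    exact Submodule.add_mem _ (Submodule.smul_mem _ _ hx') (Submodule.smul_mem _ _ hx)
  | mem x hx =>
    rcases hx with ⟨g, q, rfl⟩ | ⟨f, rfl⟩
    · have key : ∀ t : S ⊗[ℤ] Q,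
          ((dpair 𝒟 (SQ.pairS φ) t (φ g ⊗ₜ[ℤ] q - (1 : S) ⊗ₜ[ℤ] (g • q)),
            brT SQ.br t (φ g ⊗ₜ[ℤ] q - (1 : S) ⊗ₜ[ℤ] (g • q)) +
              tact 𝒞 φ SQ.anchor g t ⊗ₜ[ℤ] q, 0) : Θ × (S ⊗[ℤ] Q) × U) ∈ pullN Θ U 𝒟 φ SQ := by
        intro t
        induction t using TensorProduct.induction_on with
        | zero => convert (pullN Θ U 𝒟 φ SQ).zero_mem using 1; ext <;> simp
        | add x y hx hy =>
          convert Submodule.add_mem _ hx hy using 1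
          refine Prod.ext ?_ (Prod.ext ?_ ?_)
          · simp only [map_add, AddMonoidHom.add_apply, Prod.fst_add]
          · simp only [map_add, LinearMap.add_apply, TensorProduct.add_tmul, Prod.fst_add,
              Prod.snd_add]
            abel
          · simp
        | tmul h r =>
          convert Submodule.add_mem _
            (Submodule.smul_mem _ h (genQ_mem 𝒟 SQ g (SQ.br r q)))
            (Submodule.smul_mem _ h (genQ_mem 𝒟 SQ (𝒞.act (SQ.anchor r) g) q)) using 1
          refine Prod.ext ?_ (Prod.ext ?_ ?_)
          · simp [CourantStr.pairS, mul_smul]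
          · simp only [map_sub, brT_tmul, SQ.leibniz, tact_tmul, TensorProduct.tmul_add, smul_sub,
              TensorProduct.smul_tmul', smul_eq_mul, mul_one, Prod.fst_add, Prod.snd_add,
              Prod.smul_fst, Prod.smul_snd]
            abel
          · simp
      have := key v.2.1
      rw [← (mem_compat' 𝒟 SQ).1 hv g] at this
      convert this using 1
      refine Prod.ext ?_ (Prod.ext ?_ ?_)
      · simp [pullBr]
      · simp [pullBr, 𝒟.act_one]
      · simp [pullBr]
    · have key : ∀ t : S ⊗[ℤ] Q,
          ((𝒟.d (tact 𝒞 φ SQ.anchor f t) -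
              dpair 𝒟 (SQ.pairS φ) t ((1 : S) ⊗ₜ[ℤ] SQ.coanchor (𝒞.d f)),
            - brT SQ.br t ((1 : S) ⊗ₜ[ℤ] SQ.coanchor (𝒞.d f)), 0) :
            Θ × (S ⊗[ℤ] Q) × U) ∈ pullN Θ U 𝒟 φ SQ := by
        intro t
        induction t using TensorProduct.induction_on with
        | zero => convert (pullN Θ U 𝒟 φ SQ).zero_mem using 1; ext <;> simp
        | add x y hx hy =>
          convert Submodule.add_mem _ hx hy using 1
          refine Prod.ext ?_ (Prod.ext ?_ ?_)
          · simp only [map_add, AddMonoidHom.add_apply, Prod.fst_add]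
            abel
          · simp only [map_add, LinearMap.add_apply, Prod.fst_add, Prod.snd_add]
            abel
          · simp
        | tmul h r =>
          convert Submodule.smul_mem _ h (genD_mem 𝒟 SQ (𝒞.act (SQ.anchor r) f)) using 1
          refine Prod.ext ?_ (Prod.ext ?_ ?_)
          · simp only [tact_tmul, 𝒟.d_mul, dpair_tmul, CourantStr.pairS, biadd_apply,
              SQ.pair_coanchor, 𝒞.ι_d, Prod.smul_fst]
            module
          · simp [SQ.br_coanchor, 𝒞.L_d, TensorProduct.smul_tmul']
          · simp
      have := key v.2.1
      rw [← (mem_compat' 𝒟 SQ).1 hv f] at this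
      convert this using 1
      refine Prod.ext ?_ (Prod.ext ?_ ?_)
      · simp [pullBr, 𝒟.L_d, sub_eq_add_neg]
      · simp [pullBr, 𝒟.act_one]
      · simp [pullBr]

variable (𝒟 φ)

/-- The inverse image of a Courant algebroid on stalks, as the subquotient
`(Θ ⊕ (S ⊗ Q) ×_{S ⊗ T} U) / (S ⊗ Ω)` of `Θ ⊕ (S ⊗ Q) ⊕ U`. The submodule `C` is the stalk of the
fibre product. -/
def pullCourant (C : Submodule S (Θ × (S ⊗[ℤ] Q) × U)) (hC : C ≤ compat' Θ 𝒟 φ SQ)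
    (hbr : ∀ u ∈ C, ∀ v ∈ C, pullBr 𝒟 φ SQ u v ∈ C) (hco : ∀ α : Θ, (α, 0, 0) ∈ C) :
    CourantSubquotient 𝒟 (Θ × (S ⊗[ℤ] Q) × U) where
  C := C
  N := pullN Θ U 𝒟 φ SQ
  br := pullBr 𝒟 φ SQ
  anchor := LinearMap.snd S _ _ ∘ₗ LinearMap.snd S _ _
  pair := pullPair 𝒟 φ SQ
  coanchor := LinearMap.inl S _ _
  C_br := hbr
  C_coanchor := hco
  N_br n hn hn' v hv := by
    have h1 := pullBr_symm 𝒟 (φ := φ) SQ n v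
    rw [pullPair_pullN SQ hn (hC hv), map_zero] at h1
    have h2 := pullBr_pullN SQ hn (hC hv)
    convert Submodule.sub_mem _ h1 h2 using 1
    change _ = _ - 0 - _
    abel
  br_N n hn _ v hv := pullBr_pullN SQ hn (hC hv)
  N_anchor n hn := by
    induction hn using Submodule.span_induction with
    | zero => simp
    | add x y _ _ hx hy => rw [map_add, hx, hy, add_zero]
    | smul f x _ hx => rw [map_smul, hx, smul_zero]
    | mem x hx => rcases hx with ⟨g, q, rfl⟩ | ⟨f, rfl⟩ <;> simp
  N_pair n hn v hv := pullPair_pullN SQ hn (hC hv)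
  pair_symm := pullPair_symm 𝒟 SQ
  jacobi a ha b hb c hc := by
    have h : ∀ u ∈ C, ∀ g, dev 𝒟 φ SQ u g = 0 := fun u hu g => sub_eq_zero.2 (hC hu g)
    have := pullBr_jacobi 𝒟 (φ := φ) SQ a b c
    rw [dpair_zero 𝒟 SQ _ _ _ (h a ha), dpair_zero 𝒟 SQ _ _ _ (h b hb),
      dpair_zero 𝒟 SQ _ _ _ (h c hc)] at this
    convert this using 1
    ext <;> simp
  anchor_br a b := by simp [pullBr]
  anchor_coanchor α := by simp
  leibniz a _ f b := pullBr_smul 𝒟 SQ a f b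
  pair_invariant a ha b hb c hc := by
    have h1 : ∀ (ξ : U) (s t : S ⊗[ℤ] Q), 𝒟.ι ξ (dpair 𝒟 (SQ.pairS φ) s t) =
        sext₂ (SQ.pairS φ) (derT 𝒟 Q ξ s) t := by
      intro ξ s t
      induction s using TensorProduct.induction_on with
      | zero => simp
      | add x y hx hy => simp only [map_add, AddMonoidHom.add_apply, LinearMap.add_apply, hx, hy]
      | tmul h q =>
        induction t using TensorProduct.induction_on with
        | zero => simp
        | add x y hx hy => simp only [map_add, hx, hy]
        | tmul j p => simp [𝒟.ι_d]; ring
    have h1' : ∀ (ξ : U) (s t : S ⊗[ℤ] Q), 𝒟.ι ξ (dpair 𝒟 (SQ.pairS φ) s t) =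
        sext₂ (SQ.pairS φ) t (derT 𝒟 Q ξ s) := by
      intro ξ s t
      have := pullPair_symm 𝒟 (φ := φ) SQ (0, derT 𝒟 Q ξ s, 0) (0, t, 0)
      rw [h1]
      simpa [pullPair] using this
    have h2 : ∀ s t : S ⊗[ℤ] Q, 𝒟.act a.2.2 (sext₂ (SQ.pairS φ) s t) =
        sext₂ (SQ.pairS φ) (brT SQ.br a.2.1 s) t + sext₂ (SQ.pairS φ) s (brT SQ.br a.2.1 t) +
        sext₂ (SQ.pairS φ) (derT 𝒟 Q a.2.2 s) t + sext₂ (SQ.pairS φ) s (derT 𝒟 Q a.2.2 t) := by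
      intro s t
      induction s using TensorProduct.induction_on with
      | zero => simp
      | add x y hx hy => simp only [map_add, LinearMap.add_apply, hx, hy]; abel
      | tmul j p =>
        induction t using TensorProduct.induction_on with
        | zero => simp
        | add x y hx hy => simp only [map_add, hx, hy]; abel
        | tmul l r =>
          have h3 : ∀ t : S ⊗[ℤ] Q, sext₂ (SQ.pairS φ) (brT SQ.br t (j ⊗ₜ p)) (l ⊗ₜ r) +
              sext₂ (SQ.pairS φ) (j ⊗ₜ p) (brT SQ.br t (l ⊗ₜ r)) =
              j * l * tact 𝒞 φ SQ.anchor (SQ.pair p r) t := by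
            intro t
            induction t using TensorProduct.induction_on with
            | zero => simp
            | add x y hx hy =>
              simp only [map_add, LinearMap.add_apply, mul_add, ← hx, ← hy]; abel
            | tmul h q =>
              simp [CourantStr.pairS, ← SQ.pair_invariant]
              ring
          rw [h3, ← (mem_compat' 𝒟 SQ).1 (hC ha) (SQ.pair p r)]
          simp [CourantStr.pairS, 𝒟.act_mul]
          ring
    simp only [pullPair, LinearMap.mk₂_apply, pullBr, biadd_apply, map_add, map_sub,
      LinearMap.add_apply, LinearMap.sub_apply, 𝒟.ι_L, 𝒟.ι_d, h2, LinearMap.comp_apply,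
      LinearMap.snd_apply]
    rw [h1' c.2.2, h1 b.2.2, 𝒟.lie_skew b.2.2 c.2.2, map_neg, LinearMap.neg_apply]
    ring
  br_coanchor a α := by
    refine Prod.ext ?_ (Prod.ext ?_ ?_) <;> simp [pullBr]
  pair_coanchor a α := by simp [pullPair]
  br_symm a _ b _ := pullBr_symm 𝒟 SQ a b

end PullCourant

section Sheaves

/-- The étalé space description of a sheaf on a space `P`: `F x` is the stalk at `x`, and
`Sec s x` says that the family of germs `s` is, in a neighbourhood of `x`, (the family of germs of)
a section. -/
structure IsEtale {P : Type u} [TopologicalSpace P] {F : P → Type u}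
    (Sec : (∀ x, F x) → P → Prop) : Prop where
  near : ∀ {s x}, Sec s x → ∀ᶠ x' in 𝓝 x, Sec s x'
  congr : ∀ {s t x}, Sec s x → (∀ᶠ x' in 𝓝 x, s x' = t x') → Sec t x
  exists_sec : ∀ x (e : F x), ∃ s, Sec s x ∧ s x = e
  eq_near : ∀ {s t x}, Sec s x → Sec t x → s x = t x → ∀ᶠ x' in 𝓝 x, s x' = t x'

/-- A space with a sheaf of commutative `k`-algebras. -/
structure RSpace (k : Type) [Field k] where
  pt : Type u
  [top : TopologicalSpace pt]
  O : pt → Type u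
  [ring : ∀ x, CommRing (O x)]
  [alg : ∀ x, Algebra k (O x)]
  Sec : (∀ x, O x) → pt → Prop
  etale : IsEtale Sec
  add : ∀ {f g x}, Sec f x → Sec g x → Sec (fun y => f y + g y) x
  mul : ∀ {f g x}, Sec f x → Sec g x → Sec (fun y => f y * g y) x
  const : ∀ (c : k) x, Sec (fun y => algebraMap k (O y) c) x

attribute [instance] RSpace.top RSpace.ring RSpace.alg

variable {k : Type} [Field k]

/-- A sheaf of modules over the structure sheaf of `X`. -/
structure MSheaf (X : RSpace.{u} k) where
  E : X.pt → Type u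
  [acg : ∀ x, AddCommGroup (E x)]
  [mod : ∀ x, Module (X.O x) (E x)]
  Sec : (∀ x, E x) → X.pt → Prop
  etale : IsEtale Sec
  add : ∀ {s t x}, Sec s x → Sec t x → Sec (fun y => s y + t y) x
  smul : ∀ {f s x}, X.Sec f x → Sec s x → Sec (fun y => f y • s y) x

attribute [instance] MSheaf.acg MSheaf.mod

/-- Data for the sheaf of germs of families satisfying a local condition `Good`. -/
structure GermData (X : RSpace.{u} k) where
  F : X.pt → Type u
  [acg : ∀ x, AddCommGroup (F x)]
  [mod : ∀ x, Module (X.O x) (F x)]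
  Good : (∀ x, F x) → X.pt → Prop
  near : ∀ {s x}, Good s x → ∀ᶠ x' in 𝓝 x, Good s x'
  congr : ∀ {s t x}, Good s x → (∀ᶠ x' in 𝓝 x, s x' = t x') → Good t x
  zero : ∀ x, Good (fun _ => 0) x
  add : ∀ {s t x}, Good s x → Good t x → Good (fun y => s y + t y) x
  smul : ∀ {f s x}, X.Sec f x → Good s x → Good (fun y => f y • s y) x

attribute [instance] GermData.acg GermData.mod

variable {X : RSpace.{u} k}

theorem RSpace.one (X : RSpace.{u} k) (x : X.pt) : X.Sec (fun _ => 1) x := by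
  simpa using X.const 1 x

theorem RSpace.zero (X : RSpace.{u} k) (x : X.pt) : X.Sec (fun _ => 0) x := by
  simpa using X.const 0 x

theorem RSpace.neg {X : RSpace.{u} k} {f : ∀ x, X.O x} {x : X.pt} (hf : X.Sec f x) :
    X.Sec (fun y => - f y) x := by
  simpa using X.mul (X.const (-1) x) hf

namespace GermData
variable (G : GermData X)

theorem neg {s : ∀ x, G.F x} {x : X.pt} (hs : G.Good s x) : G.Good (fun y => - s y) x := by
  simpa using G.smul (X.const (-1) x) hs

/-- The families which are good near `x`. -/
def sub (x : X.pt) : AddSubgroup (∀ y, G.F y) where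
  carrier := {s | G.Good s x}
  zero_mem' := G.zero x
  add_mem' := G.add
  neg_mem' := G.neg

/-- The families which vanish near `x`. -/
def null (x : X.pt) : AddSubgroup (G.sub x) where
  carrier := {s | ∀ᶠ y in 𝓝 x, s.1 y = 0}
  zero_mem' := Eventually.of_forall fun _ => rfl
  add_mem' := fun {s t} hs ht => by
    filter_upwards [hs, ht] with y h h'
    change s.1 y + t.1 y = 0
    rw [h, h', add_zero]
  neg_mem' := fun {s} hs => by
    filter_upwards [hs] with y h
    change - s.1 y = 0
    rw [h, neg_zero]

/-- Germs at `x` of good families. -/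
def Stalk (x : X.pt) : Type u := G.sub x ⧸ G.null x

instance (x : X.pt) : AddCommGroup (G.Stalk x) :=
  inferInstanceAs (AddCommGroup (G.sub x ⧸ G.null x))

open Classical in
/-- The germ at `x` of a family (zero, if the family is not good near `x`). -/
noncomputable def germ (x : X.pt) (s : ∀ y, G.F y) : G.Stalk x :=
  if h : G.Good s x then QuotientAddGroup.mk' (G.null x) ⟨s, h⟩ else 0

variable {G}

theorem germ_of {x : X.pt} {s : ∀ y, G.F y} (h : G.Good s x) :
    G.germ x s = QuotientAddGroup.mk' (G.null x) ⟨s, h⟩ := dif_pos h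

theorem exists_germ {x : X.pt} (e : G.Stalk x) : ∃ s, G.Good s x ∧ G.germ x s = e := by
  obtain ⟨⟨s, hs⟩, rfl⟩ := QuotientAddGroup.mk'_surjective (G.null x) e
  exact ⟨s, hs, germ_of hs⟩

theorem germ_eq_iff {x : X.pt} {s t : ∀ y, G.F y} (hs : G.Good s x) (ht : G.Good t x) :
    G.germ x s = G.germ x t ↔ ∀ᶠ y in 𝓝 x, s y = t y := by
  rw [germ_of hs, germ_of ht]
  refine QuotientAddGroup.eq.trans ?_
  change (∀ᶠ y in 𝓝 x, - s y + t y = 0) ↔ _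
  refine eventually_congr (Eventually.of_forall fun y => ?_)
  rw [neg_add_eq_zero]

theorem germ_congr {x : X.pt} {s t : ∀ y, G.F y} (hs : G.Good s x)
    (h : ∀ᶠ y in 𝓝 x, s y = t y) : G.germ x s = G.germ x t :=
  (germ_eq_iff hs (G.congr hs h)).2 h

theorem germ_add {x : X.pt} {s t : ∀ y, G.F y} (hs : G.Good s x) (ht : G.Good t x) :
    G.germ x (fun y => s y + t y) = G.germ x s + G.germ x t := by
  rw [germ_of hs, germ_of ht, germ_of (G.add hs ht)]; rfl

/-- The biadditive operation on germs defined by a biadditive operation on families. -/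
noncomputable def op₂ {A : X.pt → Type u} [∀ x, AddCommGroup (A x)]
    {Sec : (∀ x, A x) → X.pt → Prop} (hA : IsEtale Sec)
    (hadd : ∀ {s t x}, Sec s x → Sec t x → Sec (fun y => s y + t y) x) {G' G : GermData X}
    (op : ∀ y, A y →+ G'.F y →+ G.F y)
    (hop : ∀ {a s x}, Sec a x → G'.Good s x → G.Good (fun y => op y (a y) (s y)) x) (x : X.pt) :
    A x →+ G'.Stalk x →+ G.Stalk x :=
  have key : ∀ {a a' s s'}, Sec a x → Sec a' x → G'.Good s x → G'.Good s' x → a x = a' x →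
      G'.germ x s = G'.germ x s' → G.germ x (fun y => op y (a y) (s y)) =
        G.germ x (fun y => op y (a' y) (s' y)) := fun ha ha' hs hs' h h' =>
    germ_congr (hop ha hs) (by
      filter_upwards [hA.eq_near ha ha' h, (germ_eq_iff hs hs').1 h'] with y h1 h2
      rw [h1, h2])
  biadd (fun a e => G.germ x (fun y => op y ((hA.exists_sec x a).choose y)
      ((exists_germ e).choose y)))
    (fun a a' e => by
      have h := (hA.exists_sec x a).choose_spec
      have h' := (hA.exists_sec x a').choose_spec
      have h'' := (hA.exists_sec x (a + a')).choose_spec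
      have he := (exists_germ e).choose_spec
      rw [← germ_add (hop h.1 he.1) (hop h'.1 he.1), key h''.1 (hadd h.1 h'.1) he.1 he.1 (by
        rw [h''.2, h.2, h'.2]) rfl]
      simp)
    (fun a e e' => by
      have ha := (hA.exists_sec x a).choose_spec
      have he := (exists_germ e).choose_spec
      have he' := (exists_germ e').choose_spec
      have he'' := (exists_germ (e + e')).choose_spec
      rw [← germ_add (hop ha.1 he.1) (hop ha.1 he'.1), key ha.1 ha.1 he''.1 (G'.add he.1 he'.1)
        rfl (by rw [germ_add he.1 he'.1, he''.2, he.2, he'.2])]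
      simp)

theorem op₂_germ {A : X.pt → Type u} [∀ x, AddCommGroup (A x)]
    {Sec : (∀ x, A x) → X.pt → Prop} (hA : IsEtale Sec) (hadd) {G' G : GermData X}
    (op : ∀ y, A y →+ G'.F y →+ G.F y)
    (hop : ∀ {a s x}, Sec a x → G'.Good s x → G.Good (fun y => op y (a y) (s y)) x) {x : X.pt}
    {a s} (ha : Sec a x) (hs : G'.Good s x) :
    op₂ hA hadd op hop x (a x) (G'.germ x s) = G.germ x (fun y => op y (a y) (s y)) := by
  have h := (hA.exists_sec x (a x)).choose_spec
  have he := (exists_germ (G'.germ x s)).choose_spec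
  refine germ_congr (hop h.1 he.1) ?_
  filter_upwards [hA.eq_near h.1 ha h.2, (germ_eq_iff he.1 hs).1 he.2] with y h1 h2
  rw [h1, h2]

/-- The additive map to germs defined by an additive map to families. -/
noncomputable def op₁ {A : X.pt → Type u} [∀ x, AddCommGroup (A x)]
    {Sec : (∀ x, A x) → X.pt → Prop} (hA : IsEtale Sec)
    (hadd : ∀ {s t x}, Sec s x → Sec t x → Sec (fun y => s y + t y) x) {G : GermData X}
    (op : ∀ y, A y →+ G.F y) (hop : ∀ {a x}, Sec a x → G.Good (fun y => op y (a y)) x)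
    (x : X.pt) : A x →+ G.Stalk x :=
  AddMonoidHom.mk' (fun a => G.germ x (fun y => op y ((hA.exists_sec x a).choose y)))
    (fun a a' => by
      have h := (hA.exists_sec x a).choose_spec
      have h' := (hA.exists_sec x a').choose_spec
      have h'' := (hA.exists_sec x (a + a')).choose_spec
      rw [← germ_add (hop h.1) (hop h'.1)]
      refine germ_congr (hop h''.1) ?_
      filter_upwards [hA.eq_near h''.1 (hadd h.1 h'.1) (by rw [h''.2, h.2, h'.2])] with y h1
      rw [h1, map_add])

theorem op₁_apply {A : X.pt → Type u} [∀ x, AddCommGroup (A x)]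
    {Sec : (∀ x, A x) → X.pt → Prop} (hA : IsEtale Sec) (hadd) {G : GermData X}
    (op : ∀ y, A y →+ G.F y) (hop : ∀ {a x}, Sec a x → G.Good (fun y => op y (a y)) x)
    {x : X.pt} {a} (ha : Sec a x) :
    op₁ hA hadd op hop x (a x) = G.germ x (fun y => op y (a y)) := by
  have h := (hA.exists_sec x (a x)).choose_spec
  refine germ_congr (hop h.1) ?_
  filter_upwards [hA.eq_near h.1 ha h.2] with y h1
  rw [h1]

/-- Multiplication of a germ by a function. -/
noncomputable def smulHom (G : GermData X) (x : X.pt) : X.O x →+ G.Stalk x →+ G.Stalk x :=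
  op₂ (G' := G) (G := G) X.etale X.add
    (fun _ => biadd (fun f s => f • s) (fun _ _ _ => add_smul _ _ _) (fun _ _ _ => smul_add _ _ _))
    G.smul x

theorem smulHom_germ {x : X.pt} {f : ∀ x, X.O x} {s : ∀ x, G.F x} (hf : X.Sec f x)
    (hs : G.Good s x) :
    G.smulHom x (f x) (G.germ x s) = G.germ x (fun y => f y • s y) :=
  op₂_germ _ _ _ _ hf hs

noncomputable instance (x : X.pt) : Module (X.O x) (G.Stalk x) where
  smul f e := G.smulHom x f e
  one_smul e := by
    obtain ⟨s, hs, rfl⟩ := exists_germ e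
    exact (smulHom_germ (X.one x) hs).trans (by simp)
  mul_smul f g e := by
    obtain ⟨s, hs, rfl⟩ := exists_germ e
    obtain ⟨f, hf, rfl⟩ := X.etale.exists_sec x f
    obtain ⟨g, hg, rfl⟩ := X.etale.exists_sec x g
    change G.smulHom x _ _ = G.smulHom x _ (G.smulHom x _ _)
    rw [smulHom_germ hg hs, smulHom_germ hf (G.smul hg hs)]
    exact (smulHom_germ (X.mul hf hg) hs).trans (by simp [mul_smul])
  smul_zero f := map_zero _
  smul_add f := map_add _
  add_smul f g e := by
    change G.smulHom x _ _ = G.smulHom x _ _ + G.smulHom x _ _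
    rw [map_add, AddMonoidHom.add_apply]
  zero_smul e := by
    change G.smulHom x _ _ = 0
    rw [map_zero, AddMonoidHom.zero_apply]

theorem smul_germ {x : X.pt} {f : ∀ x, X.O x} {s : ∀ x, G.F x} (hf : X.Sec f x)
    (hs : G.Good s x) : f x • G.germ x s = G.germ x (fun y => f y • s y) :=
  smulHom_germ hf hs

/-- The value at `x` of a germ. -/
noncomputable def ev (G : GermData X) (x : X.pt) : G.Stalk x →ₗ[X.O x] G.F x :=
  have key : ∀ (s), G.Good s x → ∀ (e : G.Stalk x), e = G.germ x s →
      (exists_germ e).choose x = s x := fun s hs e he =>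
    ((germ_eq_iff (exists_germ e).choose_spec.1 hs).1
      ((exists_germ e).choose_spec.2.trans he)).self_of_nhds
  { toFun := fun e => (exists_germ e).choose x
    map_add' := fun e e' => by
      obtain ⟨s, hs, rfl⟩ := exists_germ e
      obtain ⟨s', hs', rfl⟩ := exists_germ e'
      rw [key _ (G.add hs hs') _ (germ_add hs hs').symm, key _ hs _ rfl, key _ hs' _ rfl]
    map_smul' := fun f e => by
      obtain ⟨s, hs, rfl⟩ := exists_germ e
      obtain ⟨f, hf, rfl⟩ := X.etale.exists_sec x f
      rw [key _ (G.smul hf hs) _ (smul_germ hf hs), key _ hs _ rfl]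
      rfl }

theorem ev_germ {x : X.pt} {s : ∀ x, G.F x} (hs : G.Good s x) : G.ev x (G.germ x s) = s x :=
  ((germ_eq_iff (exists_germ (G.germ x s)).choose_spec.1 hs).1
    (exists_germ (G.germ x s)).choose_spec.2).self_of_nhds

/-- The sheaf of germs of good families. -/
noncomputable abbrev sheaf (G : GermData X) : MSheaf X where
  E := G.Stalk
  Sec σ x := ∃ s, G.Good s x ∧ ∀ᶠ y in 𝓝 x, σ y = G.germ y s
  etale :=
    { near := fun ⟨s, hs, h⟩ => by
        filter_upwards [G.near hs, eventually_eventually_nhds.2 h] with y h1 h2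
        exact ⟨s, h1, h2⟩
      congr := fun ⟨s, hs, h⟩ h' => ⟨s, hs, by
        filter_upwards [h, h'] with y h1 h2
        rw [← h2, h1]⟩
      exists_sec := fun x e => by
        obtain ⟨s, hs, rfl⟩ := exists_germ e
        exact ⟨fun y => G.germ y s, ⟨s, hs, Eventually.of_forall fun _ => rfl⟩, rfl⟩
      eq_near := fun ⟨s, hs, h⟩ ⟨t, ht, h'⟩ he => by
        rw [h.self_of_nhds, h'.self_of_nhds, germ_eq_iff hs ht] at he
        filter_upwards [h, h', G.near hs, eventually_eventually_nhds.2 he] with y h1 h2 h3 h4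
        rw [h1, h2, germ_congr h3 h4] }
  add := fun ⟨s, hs, h⟩ ⟨t, ht, h'⟩ => ⟨_, G.add hs ht, by
    filter_upwards [h, h', G.near hs, G.near ht] with y h1 h2 h3 h4
    rw [h1, h2, germ_add h3 h4]⟩
  smul := fun hf ⟨s, hs, h⟩ => ⟨_, G.smul hf hs, by
    filter_upwards [h, X.etale.near hf, G.near hs] with y h1 h2 h3
    rw [h1, smul_germ h2 h3]⟩

theorem germ_sec {x : X.pt} {s : ∀ x, G.F x} (hs : G.Good s x) :
    G.sheaf.Sec (fun y => G.germ y s) x := ⟨s, hs, Eventually.of_forall fun _ => rfl⟩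

theorem op₂_sec {A : X.pt → Type u} [∀ x, AddCommGroup (A x)]
    {Sec : (∀ x, A x) → X.pt → Prop} (hA : IsEtale Sec) (hadd) {G' G : GermData X}
    (op : ∀ y, A y →+ G'.F y →+ G.F y)
    (hop : ∀ {a s x}, Sec a x → G'.Good s x → G.Good (fun y => op y (a y) (s y)) x) {x : X.pt}
    {a σ} (ha : Sec a x) (hs : G'.sheaf.Sec σ x) :
    G.sheaf.Sec (fun y => op₂ hA hadd op hop y (a y) (σ y)) x := by
  obtain ⟨s, hs, h⟩ := hs
  refine ⟨_, hop ha hs, ?_⟩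
  filter_upwards [h, G'.near hs, hA.near ha] with y h1 h2 h3
  rw [h1, op₂_germ hA hadd op hop h3 h2]

theorem op₁_sec {A : X.pt → Type u} [∀ x, AddCommGroup (A x)]
    {Sec : (∀ x, A x) → X.pt → Prop} (hA : IsEtale Sec) (hadd) {G : GermData X}
    (op : ∀ y, A y →+ G.F y) (hop : ∀ {a x}, Sec a x → G.Good (fun y => op y (a y)) x)
    {x : X.pt} {a} (ha : Sec a x) :
    G.sheaf.Sec (fun y => op₁ hA hadd op hop y (a y)) x := by
  refine ⟨_, hop ha, ?_⟩
  filter_upwards [hA.near ha] with y h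
  rw [op₁_apply hA hadd op hop h]

end GermData
end Sheaves

section CartanSheaf

variable {k : Type} [Field k]

/-- Families of derivations of the stalks which carry sections to sections, that is, derivations
of the structure sheaf. -/
abbrev RSpace.derData (X : RSpace.{u} k) : GermData X where
  F x := Derivation k (X.O x) (X.O x)
  Good D x := ∀ᶠ x' in 𝓝 x, ∀ s, X.Sec s x' → X.Sec (fun y => D y (s y)) x'
  near h := eventually_eventually_nhds.2 h
  congr h h' := by
    filter_upwards [h, eventually_eventually_nhds.2 h'] with x' h1 h2 s hs
    refine X.etale.congr (h1 s hs) ?_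
    filter_upwards [h2] with y h3
    rw [h3]
  zero x := Eventually.of_forall fun x' s _ => by simpa using X.zero x'
  add h h' := by
    filter_upwards [h, h'] with x' h1 h2 s hs
    exact X.add (h1 s hs) (h2 s hs)
  smul hf h := by
    filter_upwards [h, X.etale.near hf] with x' h1 h2 s hs
    exact X.mul h2 (h1 s hs)

/-- The tangent sheaf: the sheaf of `k`-linear derivations of the structure sheaf. -/
noncomputable abbrev RSpace.T (X : RSpace.{u} k) : MSheaf X := X.derData.sheaf

namespace RSpace
variable (X : RSpace.{u} k)

/-- The action of vector fields on functions. -/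
noncomputable def act (x : X.pt) : X.T.E x →+ X.O x →+ X.O x :=
  AddMonoidHom.mk' (fun D => (X.derData.ev x D).toLinearMap.toAddMonoidHom) (fun D D' => by
    ext; simp)

variable {X}

theorem act_germ {x : X.pt} {D : ∀ y, Derivation k (X.O y) (X.O y)} (hD : X.derData.Good D x)
    (f : X.O x) : X.act x (X.derData.germ x D) f = D x f := by
  change X.derData.ev x _ f = _
  rw [GermData.ev_germ hD]

theorem act_sec {x : X.pt} {δ : ∀ y, X.T.E y} {f : ∀ y, X.O y} (hδ : X.T.Sec δ x)
    (hf : X.Sec f x) : X.Sec (fun y => X.act y (δ y) (f y)) x := by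
  obtain ⟨D, hD, h⟩ := hδ
  refine X.etale.congr (hD.self_of_nhds f hf) ?_
  filter_upwards [h, X.derData.near hD] with y h1 h2
  rw [h1, act_germ h2]

variable (X)

/-- The commutator of (a germ of) a vector field with a family of derivations. -/
noncomputable def lieOp (y : X.pt) : X.T.E y →+ X.derData.F y →+ X.derData.F y :=
  biadd (fun δ D => ⁅(X.derData.ev y δ : Derivation k (X.O y) (X.O y)), D⁆)
    (fun _ _ _ => by rw [map_add]; exact add_lie _ _ _) (fun _ _ _ => lie_add _ _ _)

theorem lieOp_good {δ : ∀ y, X.T.E y} {D : ∀ y, X.derData.F y} {x : X.pt} (hδ : X.T.Sec δ x)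
    (hD : X.derData.Good D x) : X.derData.Good (fun y => X.lieOp y (δ y) (D y)) x := by
  filter_upwards [hD, X.T.etale.near hδ] with x' h1 h2 s hs
  have h := X.add (act_sec h2 (h1 s hs)) (X.neg (h1 _ (act_sec h2 hs)))
  refine X.etale.congr h (Eventually.of_forall fun y => ?_)
  change _ = ⁅(X.derData.ev y (δ y) : Derivation k (X.O y) (X.O y)), D y⁆ (s y)
  rw [Derivation.commutator_apply, sub_eq_add_neg]
  rfl

/-- The Lie bracket of vector fields. -/
noncomputable def lie (x : X.pt) : X.T.E x →+ X.T.E x →+ X.T.E x :=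
  GermData.op₂ (G' := X.derData) (G := X.derData) X.T.etale X.T.add X.lieOp X.lieOp_good x

variable {X}

theorem lie_germ {x : X.pt} {D D' : ∀ y, Derivation k (X.O y) (X.O y)}
    (hD : X.derData.Good D x) (hD' : X.derData.Good D' x) :
    X.lie x (X.derData.germ x D) (X.derData.germ x D') =
      X.derData.germ x (fun y => ⁅D y, D' y⁆) := by
  refine (GermData.op₂_germ X.T.etale X.T.add X.lieOp X.lieOp_good
    (GermData.germ_sec hD) hD').trans ?_
  refine GermData.germ_congr (X.lieOp_good (GermData.germ_sec hD) hD') ?_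
  filter_upwards [X.derData.near hD] with y h
  change ⁅X.derData.ev y _, D' y⁆ = _
  rw [GermData.ev_germ h]

theorem lie_good {x : X.pt} {D D' : ∀ y, Derivation k (X.O y) (X.O y)}
    (hD : X.derData.Good D x) (hD' : X.derData.Good D' x) :
    X.derData.Good (fun y => ⁅D y, D' y⁆) x := by
  refine X.derData.congr (X.lieOp_good (GermData.germ_sec hD) hD') ?_
  filter_upwards [X.derData.near hD] with y h
  change ⁅X.derData.ev y _, D' y⁆ = _
  rw [GermData.ev_germ h]

theorem lie_sec {x : X.pt} {δ δ' : ∀ y, X.T.E y} (hδ : X.T.Sec δ x) (hδ' : X.T.Sec δ' x) :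
    X.T.Sec (fun y => X.lie y (δ y) (δ' y)) x :=
  GermData.op₂_sec _ _ _ _ hδ hδ'

theorem act_lie (x : X.pt) (D D' : X.T.E x) (f : X.O x) :
    X.act x (X.lie x D D') f = X.act x D (X.act x D' f) - X.act x D' (X.act x D f) := by
  obtain ⟨D, hD, rfl⟩ := GermData.exists_germ D
  obtain ⟨D', hD', rfl⟩ := GermData.exists_germ D'
  rw [lie_germ hD hD', act_germ (lie_good hD hD'), act_germ hD, act_germ hD', act_germ hD,
    act_germ hD', Derivation.commutator_apply]

theorem act_mul (x : X.pt) (D : X.T.E x) (f g : X.O x) :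
    X.act x D (f * g) = f * X.act x D g + X.act x D f * g := by
  refine ((X.derData.ev x D).leibniz f g).trans ?_
  rw [smul_eq_mul, smul_eq_mul, mul_comm g]
  rfl

theorem act_smul (x : X.pt) (f : X.O x) (D : X.T.E x) (g : X.O x) :
    X.act x (f • D) g = f * X.act x D g := by
  change X.derData.ev x (f • D) g = _
  rw [map_smul]
  rfl

theorem lie_self (x : X.pt) (D : X.T.E x) : X.lie x D D = 0 := by
  obtain ⟨D, hD, rfl⟩ := GermData.exists_germ D
  rw [lie_germ hD hD]
  refine (GermData.germ_congr (lie_good hD hD) (t := fun _ => 0)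
    (Eventually.of_forall fun y => _root_.lie_self _)).trans ?_
  rw [GermData.germ_of (X.derData.zero x)]
  exact map_zero _

theorem lie_jacobi (x : X.pt) (D D' D'' : X.T.E x) : X.lie x D (X.lie x D' D'') =
    X.lie x (X.lie x D D') D'' + X.lie x D' (X.lie x D D'') := by
  obtain ⟨D, hD, rfl⟩ := GermData.exists_germ D
  obtain ⟨D', hD', rfl⟩ := GermData.exists_germ D'
  obtain ⟨D'', hD'', rfl⟩ := GermData.exists_germ D''
  rw [lie_germ hD' hD'', lie_germ hD (lie_good hD' hD''), lie_germ hD hD',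
    lie_germ (lie_good hD hD') hD'', lie_germ hD hD'', lie_germ hD' (lie_good hD hD''),
    ← GermData.germ_add (lie_good (lie_good hD hD') hD'') (lie_good hD' (lie_good hD hD''))]
  congr 1
  funext y
  exact leibniz_lie _ _ _

theorem lie_skew (x : X.pt) (D D' : X.T.E x) : X.lie x D D' = - X.lie x D' D := by
  have h := lie_self x (D + D')
  rw [map_add, map_add, AddMonoidHom.add_apply, AddMonoidHom.add_apply] at h
  have h1 := lie_self x D
  have h2 := lie_self x D'
  rw [h1, h2, zero_add, add_zero] at h
  exact eq_neg_of_add_eq_zero_right h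

theorem lie_smul (x : X.pt) (D : X.T.E x) (f : X.O x) (D' : X.T.E x) :
    X.lie x D (f • D') = X.act x D f • D' + f • X.lie x D D' := by
  obtain ⟨D, hD, rfl⟩ := GermData.exists_germ D
  obtain ⟨D', hD', rfl⟩ := GermData.exists_germ D'
  obtain ⟨f, hf, rfl⟩ := X.etale.exists_sec x f
  have h : X.Sec (fun y => D y (f y)) x := hD.self_of_nhds f hf
  rw [act_germ hD]
  erw [GermData.smul_germ hf hD', GermData.smul_germ h hD']
  rw [lie_germ hD (X.derData.smul hf hD'), lie_germ hD hD',
    GermData.smul_germ hf (lie_good hD hD')]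
  rw [← GermData.germ_add (X.derData.smul h hD') (X.derData.smul hf (lie_good hD hD'))]
  congr 1
  funext y
  ext g
  simp [Derivation.commutator_apply]
  ring

variable (X)

/-- Families of linear functionals on the stalks of the tangent sheaf which carry sections to
sections. -/
noncomputable abbrev formData : GermData X where
  F x := X.T.E x →ₗ[X.O x] X.O x
  Good θ x := ∀ᶠ x' in 𝓝 x, ∀ δ, X.T.Sec δ x' → X.Sec (fun y => θ y (δ y)) x'
  near h := eventually_eventually_nhds.2 h
  congr h h' := by
    filter_upwards [h, eventually_eventually_nhds.2 h'] with x' h1 h2 s hs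
    refine X.etale.congr (h1 s hs) ?_
    filter_upwards [h2] with y h3
    rw [h3]
  zero x := Eventually.of_forall fun x' s _ => by simpa using X.zero x'
  add h h' := by
    filter_upwards [h, h'] with x' h1 h2 s hs
    exact X.add (h1 s hs) (h2 s hs)
  smul hf h := by
    filter_upwards [h, X.etale.near hf] with x' h1 h2 s hs
    exact X.mul h2 (h1 s hs)

/-- The sheaf of one-forms, the dual of the tangent sheaf. -/
noncomputable abbrev Ω : MSheaf X := X.formData.sheaf

/-- The differential of a function, as a functional on vector fields. -/
noncomputable def dOp (y : X.pt) : X.O y →+ X.formData.F y :=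
  AddMonoidHom.mk' (fun f =>
    ({ toFun := fun D => X.act y D f
       map_add' := fun D D' => by rw [map_add]; rfl
       map_smul' := fun g D => act_smul y g D f } : X.T.E y →ₗ[X.O y] X.O y))
    (fun f g => LinearMap.ext fun D => map_add (X.act y D) f g)

theorem dOp_good {f : ∀ y, X.O y} {x : X.pt} (hf : X.Sec f x) :
    X.formData.Good (fun y => X.dOp y (f y)) x := by
  filter_upwards [X.etale.near hf] with x' h δ hδ
  exact act_sec hδ h

/-- The de Rham differential of functions. -/
noncomputable def d (x : X.pt) : X.O x →+ X.Ω.E x :=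
  GermData.op₁ (G := X.formData) X.etale X.add X.dOp X.dOp_good x

/-- Contraction. -/
noncomputable def ι (x : X.pt) : X.T.E x →ₗ[X.O x] X.Ω.E x →ₗ[X.O x] X.O x :=
  LinearMap.flip (X.formData.ev x :
    X.formData.Stalk x →ₗ[X.O x] (X.T.E x →ₗ[X.O x] X.O x))

/-- The Lie derivative of a functional on vector fields. -/
noncomputable def LOp (y : X.pt) : X.T.E y →+ X.formData.F y →+ X.formData.F y :=
  biadd (fun D (θ : X.T.E y →ₗ[X.O y] X.O y) =>
    ({ toFun := fun D' => X.act y D (θ D') - θ (X.lie y D D')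
       map_add' := fun D' D'' => by simp only [map_add]; ring
       map_smul' := fun g D' => by
         have h := congrArg θ (lie_smul y D g D')
         rw [map_add θ, map_smul θ, map_smul θ] at h
         rw [h, map_smul θ]
         refine (congrArg (· - _) (act_mul y D g (θ D'))).trans ?_
         simp only [smul_eq_mul, RingHom.id_apply]
         ring } : X.T.E y →ₗ[X.O y] X.O y))
    (fun D D' θ => LinearMap.ext fun D'' => by
      change X.act y (D + D') (θ D'') - θ (X.lie y (D + D') D'') =
        X.act y D (θ D'') - θ (X.lie y D D'') + (X.act y D' (θ D'') - θ (X.lie y D' D''))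
      simp only [map_add, AddMonoidHom.add_apply]
      ring)
    (fun D θ θ' => LinearMap.ext fun D'' => by
      change X.act y D (θ D'' + θ' D'') - (θ (X.lie y D D'') + θ' (X.lie y D D'')) =
        X.act y D (θ D'') - θ (X.lie y D D'') + (X.act y D (θ' D'') - θ' (X.lie y D D''))
      rw [map_add]; ring)

theorem LOp_good {δ : ∀ y, X.T.E y} {θ : ∀ y, X.formData.F y} {x : X.pt} (hδ : X.T.Sec δ x)
    (hθ : X.formData.Good θ x) : X.formData.Good (fun y => X.LOp y (δ y) (θ y)) x := by
  filter_upwards [hθ, X.T.etale.near hδ] with x' h1 h2 δ' hδ'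
  have h := X.add (act_sec h2 (h1 δ' hδ')) (X.neg (h1 _ (lie_sec h2 hδ')))
  refine X.etale.congr h (Eventually.of_forall fun y => ?_)
  exact (sub_eq_add_neg _ _).symm

/-- The Lie derivative of one-forms. -/
noncomputable def L (x : X.pt) : X.T.E x →+ X.Ω.E x →+ X.Ω.E x :=
  GermData.op₂ (G' := X.formData) (G := X.formData) X.T.etale X.T.add X.LOp X.LOp_good x

variable {X}

theorem d_apply {x : X.pt} {f : ∀ y, X.O y} (hf : X.Sec f x) :
    X.d x (f x) = X.formData.germ x (fun y => X.dOp y (f y)) :=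
  GermData.op₁_apply _ _ _ _ hf

theorem d_sec {x : X.pt} {f : ∀ y, X.O y} (hf : X.Sec f x) :
    X.Ω.Sec (fun y => X.d y (f y)) x := GermData.op₁_sec _ _ _ _ hf

theorem L_germ {x : X.pt} {δ : ∀ y, X.T.E y} {θ : ∀ y, X.formData.F y} (hδ : X.T.Sec δ x)
    (hθ : X.formData.Good θ x) : X.L x (δ x) (X.formData.germ x θ) =
      X.formData.germ x (fun y => X.LOp y (δ y) (θ y)) :=
  GermData.op₂_germ _ _ _ _ hδ hθ

theorem L_sec {x : X.pt} {δ : ∀ y, X.T.E y} {α : ∀ y, X.Ω.E y} (hδ : X.T.Sec δ x)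
    (hα : X.Ω.Sec α x) : X.Ω.Sec (fun y => X.L y (δ y) (α y)) x :=
  GermData.op₂_sec _ _ _ _ hδ hα

theorem ι_germ {x : X.pt} {θ : ∀ y, X.formData.F y} (D : X.T.E x)
    (hθ : X.formData.Good θ x) : X.ι x D (X.formData.germ x θ) =
      (θ x : X.T.E x →ₗ[X.O x] X.O x) D := by
  change (X.formData.ev x _ : X.T.E x →ₗ[X.O x] X.O x) D = _
  rw [GermData.ev_germ hθ]

theorem ι_sec {x : X.pt} {δ : ∀ y, X.T.E y} {α : ∀ y, X.Ω.E y} (hδ : X.T.Sec δ x)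
    (hα : X.Ω.Sec α x) : X.Sec (fun y => X.ι y (δ y) (α y)) x := by
  obtain ⟨θ, hθ, h⟩ := hα
  refine X.etale.congr (hθ.self_of_nhds δ hδ) ?_
  filter_upwards [h, X.formData.near hθ] with y h1 h2
  rw [h1, ι_germ _ h2]

variable (X)

/-- The Cartan calculus of the space `X` on the stalks at `x`. -/
noncomputable def cartan (x : X.pt) : Cartan k (X.O x) (X.T.E x) (X.Ω.E x) where
  act := X.act x
  lie := X.lie x
  d := X.d x
  ι := X.ι x
  L := X.L x
  act_smul := act_smul x
  act_mul := act_mul x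
  act_const D c := (X.derData.ev x D).map_algebraMap c
  act_lie := act_lie x
  lie_self := lie_self x
  lie_jacobi := lie_jacobi x
  lie_smul := lie_smul x
  d_mul f g := by
    obtain ⟨f, hf, rfl⟩ := X.etale.exists_sec x f
    obtain ⟨g, hg, rfl⟩ := X.etale.exists_sec x g
    refine (d_apply (X.mul hf hg)).trans ?_
    rw [d_apply hf, d_apply hg]
    erw [GermData.smul_germ hf (X.dOp_good hg), GermData.smul_germ hg (X.dOp_good hf)]
    refine Eq.trans ?_ (GermData.germ_add (X.formData.smul hf (X.dOp_good hg))
      (X.formData.smul hg (X.dOp_good hf)))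
    congr 1
    funext y
    refine LinearMap.ext fun D => (act_mul y D _ _).trans ?_
    rw [mul_comm (X.act y D (f y))]
    rfl
  d_const c := by
    refine (d_apply (X.const c x)).trans ?_
    refine Eq.trans (GermData.germ_congr (X.dOp_good (X.const c x)) (t := fun _ => 0)
      (Eventually.of_forall fun y => LinearMap.ext fun D =>
        (X.derData.ev y D).map_algebraMap c)) ?_
    rw [GermData.germ_of (X.formData.zero x)]
    exact map_zero _
  ι_d D f := by
    obtain ⟨f, hf, rfl⟩ := X.etale.exists_sec x f
    rw [d_apply hf]
    exact ι_germ D (X.dOp_good hf)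
  L_smul D f α := by
    obtain ⟨δ, hδ, rfl⟩ := X.T.etale.exists_sec x D
    obtain ⟨f, hf, rfl⟩ := X.etale.exists_sec x f
    obtain ⟨θ, hθ, rfl⟩ := GermData.exists_germ α
    erw [GermData.smul_germ hf hθ, L_germ hδ (X.formData.smul hf hθ),
      GermData.smul_germ (act_sec hδ hf) hθ, L_germ hδ hθ,
      GermData.smul_germ hf (X.LOp_good hδ hθ)]
    refine Eq.trans ?_ (GermData.germ_add (X.formData.smul (act_sec hδ hf) hθ)
      (X.formData.smul hf (X.LOp_good hδ hθ)))
    congr 1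
    funext y
    refine LinearMap.ext fun D => ?_
    obtain ⟨θ', hθ'⟩ : ∃ θ' : X.T.E y →ₗ[X.O y] X.O y, θ' = θ y := ⟨_, rfl⟩
    change X.act y (δ y) (f y * θ y D) - f y * θ y (X.lie y (δ y) D) =
      X.act y (δ y) (f y) * θ y D + f y * (X.act y (δ y) (θ y D) - θ y (X.lie y (δ y) D))
    rw [act_mul]
    ring
  L_smul_left f D α := by
    obtain ⟨δ, hδ, rfl⟩ := X.T.etale.exists_sec x D
    obtain ⟨f, hf, rfl⟩ := X.etale.exists_sec x f
    obtain ⟨θ, hθ, rfl⟩ := GermData.exists_germ α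
    rw [ι_germ _ hθ, d_apply hf, L_germ hδ hθ]
    have h : X.Sec (fun y => (θ y : X.T.E y →ₗ[X.O y] X.O y) (δ y)) x := hθ.self_of_nhds δ hδ
    refine (L_germ (X.T.smul hf hδ) hθ).trans ?_
    erw [GermData.smul_germ hf (X.LOp_good hδ hθ), GermData.smul_germ h (X.dOp_good hf)]
    refine Eq.trans ?_ (GermData.germ_add (X.formData.smul hf (X.LOp_good hδ hθ))
      (X.formData.smul h (X.dOp_good hf)))
    congr 1
    funext y
    refine LinearMap.ext fun D => ?_
    have hl : X.lie y (f y • δ y) D = f y • X.lie y (δ y) D - X.act y D (f y) • δ y := by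
      rw [lie_skew, lie_smul, lie_skew y D, smul_neg]
      abel
    change X.act y (f y • δ y) (θ y D) - θ y (X.lie y (f y • δ y) D) =
      f y * (X.act y (δ y) (θ y D) - θ y (X.lie y (δ y) D)) + θ y (δ y) * X.act y D (f y)
    rw [hl, act_smul]
    erw [map_sub, map_smul, map_smul]
    simp only [smul_eq_mul]
    ring
  L_d D f := by
    obtain ⟨δ, hδ, rfl⟩ := X.T.etale.exists_sec x D
    obtain ⟨f, hf, rfl⟩ := X.etale.exists_sec x f
    rw [d_apply hf, L_germ hδ (X.dOp_good hf)]
    refine Eq.trans ?_ (d_apply (act_sec hδ hf)).symm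
    congr 1
    funext y
    refine LinearMap.ext fun D => ?_
    change X.act y (δ y) (X.act y D (f y)) - X.act y (X.lie y (δ y) D) (f y) =
      X.act y D (X.act y (δ y) (f y))
    rw [act_lie]
    ring
  L_lie D D' α := by
    obtain ⟨δ, hδ, rfl⟩ := X.T.etale.exists_sec x D
    obtain ⟨δ', hδ', rfl⟩ := X.T.etale.exists_sec x D'
    obtain ⟨θ, hθ, rfl⟩ := GermData.exists_germ α
    rw [L_germ hδ hθ, L_germ hδ' hθ, L_germ hδ (X.LOp_good hδ' hθ), L_germ hδ' (X.LOp_good hδ hθ),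
      sub_eq_add_neg]
    have h := X.formData.smul (X.const (-1) x) (X.LOp_good hδ' (X.LOp_good hδ hθ))
    have h' := X.const (-1) x
    have h1 : - X.formData.germ x (fun y => X.LOp y (δ' y) (X.LOp y (δ y) (θ y))) =
      X.formData.germ x (fun y => algebraMap k (X.O y) (-1) •
        (X.LOp y (δ' y) (X.LOp y (δ y) (θ y)))) := by
      rw [← GermData.smul_germ h' (X.LOp_good hδ' (X.LOp_good hδ hθ))]
      simp
    rw [h1, ← GermData.germ_add (X.LOp_good hδ (X.LOp_good hδ' hθ)) h]
    refine (L_germ (lie_sec hδ hδ') hθ).trans ?_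
    congr 1
    funext y
    refine LinearMap.ext fun D => ?_
    have hj : X.lie y (X.lie y (δ y) (δ' y)) D =
        X.lie y (δ y) (X.lie y (δ' y) D) - X.lie y (δ' y) (X.lie y (δ y) D) :=
      eq_sub_of_add_eq (lie_jacobi y _ _ _).symm
    change X.act y (X.lie y (δ y) (δ' y)) (θ y D) - θ y (X.lie y (X.lie y (δ y) (δ' y)) D) =
      (X.act y (δ y) (X.act y (δ' y) (θ y D) - θ y (X.lie y (δ' y) D)) -
        (X.act y (δ' y) (θ y (X.lie y (δ y) D)) - θ y (X.lie y (δ' y) (X.lie y (δ y) D)))) +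
      algebraMap k (X.O y) (-1) *
        (X.act y (δ' y) (X.act y (δ y) (θ y D) - θ y (X.lie y (δ y) D)) -
        (X.act y (δ y) (θ y (X.lie y (δ' y) D)) - θ y (X.lie y (δ y) (X.lie y (δ' y) D))))
    rw [hj, act_lie, map_sub (θ y), map_sub, map_sub, map_neg, map_one]
    ring
  ι_L D D' α := by
    obtain ⟨δ, hδ, rfl⟩ := X.T.etale.exists_sec x D
    obtain ⟨θ, hθ, rfl⟩ := GermData.exists_germ α
    rw [L_germ hδ hθ, ι_germ _ (X.LOp_good hδ hθ), ι_germ _ hθ, ι_germ _ hθ]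
    rfl

end RSpace
end CartanSheaf

section SheafOps

variable {k : Type} [Field k] {X Y : RSpace.{u} k}

namespace RSpace

theorem cartan_act {x : X.pt} {δ : ∀ y, X.T.E y} {f : ∀ y, X.O y} (hδ : X.T.Sec δ x)
    (hf : X.Sec f x) : X.Sec (fun y => (X.cartan y).act (δ y) (f y)) x := act_sec hδ hf

theorem cartan_lie {x : X.pt} {δ δ' : ∀ y, X.T.E y} (hδ : X.T.Sec δ x) (hδ' : X.T.Sec δ' x) :
    X.T.Sec (fun y => (X.cartan y).lie (δ y) (δ' y)) x := lie_sec hδ hδ'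

theorem cartan_d {x : X.pt} {f : ∀ y, X.O y} (hf : X.Sec f x) :
    X.Ω.Sec (fun y => (X.cartan y).d (f y)) x := d_sec hf

theorem cartan_ι {x : X.pt} {δ : ∀ y, X.T.E y} {α : ∀ y, X.Ω.E y} (hδ : X.T.Sec δ x)
    (hα : X.Ω.Sec α x) : X.Sec (fun y => (X.cartan y).ι (δ y) (α y)) x := ι_sec hδ hα

theorem cartan_L {x : X.pt} {δ : ∀ y, X.T.E y} {α : ∀ y, X.Ω.E y} (hδ : X.T.Sec δ x)
    (hα : X.Ω.Sec α x) : X.Ω.Sec (fun y => (X.cartan y).L (δ y) (α y)) x := L_sec hδ hα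

theorem sum {ι : Type} (I : Finset ι) (f : ι → ∀ x, X.O x) {x : X.pt}
    (hf : ∀ i, X.Sec (f i) x) : X.Sec (fun y => ∑ i ∈ I, f i y) x := by
  classical
  induction I using Finset.induction_on with
  | empty => simpa using X.zero x
  | insert i I hi ih => simpa [Finset.sum_insert hi] using X.add (hf i) ih

end RSpace

namespace MSheaf
variable (M N : MSheaf X)

theorem zero (x : X.pt) : M.Sec (fun _ => 0) x := by
  obtain ⟨s, hs, -⟩ := M.etale.exists_sec x 0
  simpa using M.smul (X.zero x) hs

variable {M} in
theorem neg {s : ∀ x, M.E x} {x : X.pt} (hs : M.Sec s x) : M.Sec (fun y => - s y) x := by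
  simpa using M.smul (X.const (-1) x) hs

variable {M} in
theorem sub {s t : ∀ x, M.E x} {x : X.pt} (hs : M.Sec s x) (ht : M.Sec t x) :
    M.Sec (fun y => s y - t y) x := by
  simpa [sub_eq_add_neg] using M.add hs (neg ht)

theorem sum {ι : Type} (I : Finset ι) (s : ι → ∀ x, M.E x) {x : X.pt}
    (hs : ∀ i, M.Sec (s i) x) : M.Sec (fun y => ∑ i ∈ I, s i y) x := by
  classical
  induction I using Finset.induction_on with
  | empty => simpa using M.zero x
  | insert i I hi ih => simpa [Finset.sum_insert hi] using M.add (hs i) ih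

/-- The direct sum of two sheaves of modules. -/
abbrev prod : MSheaf X where
  E x := M.E x × N.E x
  Sec s x := M.Sec (fun y => (s y).1) x ∧ N.Sec (fun y => (s y).2) x
  etale :=
    { near := fun h => (M.etale.near h.1).and (N.etale.near h.2)
      congr := fun h h' => ⟨M.etale.congr h.1 (h'.mono fun y hy => congrArg Prod.fst hy),
        N.etale.congr h.2 (h'.mono fun y hy => congrArg Prod.snd hy)⟩
      exists_sec := fun x e => by
        obtain ⟨s, hs, h⟩ := M.etale.exists_sec x e.1
        obtain ⟨t, ht, h'⟩ := N.etale.exists_sec x e.2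
        exact ⟨fun y => (s y, t y), ⟨hs, ht⟩, Prod.ext h h'⟩
      eq_near := fun h h' he => by
        filter_upwards [M.etale.eq_near h.1 h'.1 (congrArg Prod.fst he),
          N.etale.eq_near h.2 h'.2 (congrArg Prod.snd he)] with y h1 h2
        exact Prod.ext h1 h2 }
  add h h' := ⟨M.add h.1 h'.1, N.add h.2 h'.2⟩
  smul hf h := ⟨M.smul hf h.1, N.smul hf h.2⟩

/-- The direct sum of finitely many sheaves of modules. -/
abbrev pi {n : ℕ} (M : Fin n → MSheaf X) : MSheaf X where
  E x := ∀ i, (M i).E x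
  Sec s x := ∀ i, (M i).Sec (fun y => s y i) x
  etale :=
    { near := fun h => eventually_all.2 fun i => (M i).etale.near (h i)
      congr := fun h h' i => (M i).etale.congr (h i) (h'.mono fun y hy => congrFun hy i)
      exists_sec := fun x e => by
        choose s hs h using fun i => (M i).etale.exists_sec x (e i)
        exact ⟨fun y i => s i y, hs, funext h⟩
      eq_near := fun h h' he => by
        filter_upwards [eventually_all.2 fun i =>
          (M i).etale.eq_near (h i) (h' i) (congrFun he i)] with y h1
        exact funext h1 }
  add h h' i := (M i).add (h i) (h' i)
  smul hf h i := (M i).smul hf (h i)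

/-- A family of submodules of the stalks is (the family of stalks of) a subsheaf if it is open. -/
def IsSub (C : ∀ x, Submodule (X.O x) (M.E x)) : Prop :=
  ∀ s x, M.Sec s x → s x ∈ C x → ∀ᶠ x' in 𝓝 x, s x' ∈ C x'

variable {M} in
/-- The subquotient sheaf `C / (C ∩ N)`. -/
abbrev subquot (C N : ∀ x, Submodule (X.O x) (M.E x)) (hC : M.IsSub C) (hN : M.IsSub N) :
    MSheaf X where
  E x := C x ⧸ (N x).comap (C x).subtype
  Sec σ x := ∃ s, M.Sec s x ∧ ∀ᶠ y in 𝓝 x, ∃ h : s y ∈ C y,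
    σ y = ((N y).comap (C y).subtype).mkQ ⟨s y, h⟩
  etale :=
    { near := fun ⟨s, hs, h⟩ => by
        filter_upwards [M.etale.near hs, eventually_eventually_nhds.2 h] with y h1 h2
        exact ⟨s, h1, h2⟩
      congr := fun ⟨s, hs, h⟩ h' => ⟨s, hs, by
        filter_upwards [h, h'] with y h1 h2
        rw [← h2]
        exact h1⟩
      exists_sec := fun x e => by
        classical
        obtain ⟨⟨e, he⟩, rfl⟩ := Submodule.mkQ_surjective _ e
        obtain ⟨s, hs, rfl⟩ := M.etale.exists_sec x e
        refine ⟨fun y => if h : s y ∈ C y then ((N y).comap (C y).subtype).mkQ ⟨s y, h⟩ else 0,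
          ⟨s, hs, ?_⟩, dif_pos he⟩
        filter_upwards [hC s x hs he] with y h
        exact ⟨h, dif_pos h⟩
      eq_near := fun {_ _ x} ⟨s, hs, h⟩ ⟨t, ht, h'⟩ he => by
        obtain ⟨h1, h2⟩ := h.self_of_nhds
        obtain ⟨h3, h4⟩ := h'.self_of_nhds
        rw [h2, h4] at he
        have he' : s x - t x ∈ N x :=
          (Submodule.Quotient.eq ((N x).comap (C x).subtype)).1 he
        filter_upwards [h, h', hN _ _ (sub hs ht) he'] with y h5 h6 h7
        rw [h5.2, h6.2]
        exact (Submodule.Quotient.eq _).2 h7 }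
  add := fun ⟨s, hs, h⟩ ⟨t, ht, h'⟩ => ⟨_, M.add hs ht, by
    filter_upwards [h, h'] with y h1 h2
    refine ⟨Submodule.add_mem _ h1.1 h2.1, ?_⟩
    rw [h1.2, h2.2, ← map_add]
    rfl⟩
  smul := fun {f _ _} hf ⟨s, hs, h⟩ => ⟨_, M.smul hf hs, by
    filter_upwards [h] with y h1
    refine ⟨Submodule.smul_mem _ (f y) h1.1, ?_⟩
    rw [h1.2, ← map_smul]
    rfl⟩

variable {M} in
theorem subquot_sec {C N : ∀ x, Submodule (X.O x) (M.E x)} {hC : M.IsSub C} {hN : M.IsSub N}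
    {s : ∀ x, M.E x} {x : X.pt} (hs : M.Sec s x) (h : ∀ y, s y ∈ C y) :
    (subquot C N hC hN).Sec (fun y => ((N y).comap (C y).subtype).mkQ ⟨s y, h y⟩) x :=
  ⟨s, hs, Eventually.of_forall fun y => ⟨h y, rfl⟩⟩

theorem isSub_span (S : ∀ x, Set (M.E x))
    (h : ∀ x, ∀ e ∈ S x, ∃ s, M.Sec s x ∧ s x = e ∧ ∀ᶠ x' in 𝓝 x, s x' ∈ S x') :
    M.IsSub (fun x => Submodule.span (X.O x) (S x)) := by
  have key : ∀ x, ∀ e ∈ Submodule.span (X.O x) (S x), ∃ s, M.Sec s x ∧ s x = e ∧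
      ∀ᶠ x' in 𝓝 x, s x' ∈ Submodule.span (X.O x') (S x') := by
    intro x e he
    induction he using Submodule.span_induction with
    | mem e he =>
      obtain ⟨s, h1, h2, h3⟩ := h x e he
      exact ⟨s, h1, h2, h3.mono fun y hy => Submodule.subset_span hy⟩
    | zero => exact ⟨_, M.zero x, rfl, Eventually.of_forall fun y => Submodule.zero_mem _⟩
    | add a b _ _ ha hb =>
      obtain ⟨s, h1, h2, h3⟩ := ha
      obtain ⟨s', h1', h2', h3'⟩ := hb
      exact ⟨_, M.add h1 h1', by rw [h2, h2'], (h3.and h3').mono fun y hy =>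
        Submodule.add_mem _ hy.1 hy.2⟩
    | smul f a _ ha =>
      obtain ⟨s, h1, h2, h3⟩ := ha
      obtain ⟨f, hf, rfl⟩ := X.etale.exists_sec x f
      exact ⟨_, M.smul hf h1, by rw [h2], h3.mono fun y hy => Submodule.smul_mem _ _ hy⟩
  intro s x hs hx
  obtain ⟨t, h1, h2, h3⟩ := key x _ hx
  filter_upwards [M.etale.eq_near h1 hs h2, h3] with y h4 h5
  rw [← h4]
  exact h5

variable {M} in
/-- The largest subsheaf contained in a family of submodules of the stalks. -/
def interior (K : ∀ x, Submodule (X.O x) (M.E x)) (x : X.pt) : Submodule (X.O x) (M.E x) where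
  carrier := {e | ∃ s, M.Sec s x ∧ s x = e ∧ ∀ᶠ x' in 𝓝 x, s x' ∈ K x'}
  zero_mem' := ⟨_, M.zero x, rfl, Eventually.of_forall fun y => Submodule.zero_mem _⟩
  add_mem' := fun ⟨s, h1, h2, h3⟩ ⟨s', h1', h2', h3'⟩ =>
    ⟨_, M.add h1 h1', by rw [h2, h2'], (h3.and h3').mono fun y hy =>
        Submodule.add_mem _ hy.1 hy.2⟩
  smul_mem' := fun f _ ⟨s, h1, h2, h3⟩ => by
    obtain ⟨f, hf, rfl⟩ := X.etale.exists_sec x f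
    exact ⟨_, M.smul hf h1, by rw [h2], h3.mono fun y hy => Submodule.smul_mem _ _ hy⟩

variable {M}

theorem interior_le {K : ∀ x, Submodule (X.O x) (M.E x)} (x : X.pt) : interior K x ≤ K x := by
  rintro _ ⟨s, -, rfl, h⟩
  exact h.self_of_nhds

theorem mem_interior_iff {K : ∀ x, Submodule (X.O x) (M.E x)} {x : X.pt} {s : ∀ x, M.E x}
    (hs : M.Sec s x) : s x ∈ interior K x ↔ ∀ᶠ x' in 𝓝 x, s x' ∈ K x' := by
  refine ⟨fun ⟨t, h1, h2, h3⟩ => ?_, fun h => ⟨s, hs, rfl, h⟩⟩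
  filter_upwards [M.etale.eq_near h1 hs h2, h3] with y h4 h5
  rw [← h4]
  exact h5

theorem interior_isSub (K : ∀ x, Submodule (X.O x) (M.E x)) : M.IsSub (interior K) := by
  intro s x hs h
  filter_upwards [M.etale.near hs, eventually_eventually_nhds.2 ((mem_interior_iff hs).1 h)]
    with y h1 h2
  exact (mem_interior_iff h1).2 h2

end MSheaf

/-- A morphism of spaces with sheaves of algebras. -/
structure SpMap (Y X : RSpace.{u} k) where
  f : Y.pt → X.pt
  cont : Continuous f
  φ : ∀ y, X.O (f y) →+* Y.O y
  const : ∀ y (c : k), φ y (algebraMap k _ c) = algebraMap k _ c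
  sec : ∀ {g : ∀ x, X.O x} {y : Y.pt}, X.Sec g (f y) → Y.Sec (fun y' => φ y' (g (f y'))) y

namespace SpMap
variable (F : SpMap Y X) (M : MSheaf X)

/-- Families which vanish near `y`. -/
def nullT (y : Y.pt) : AddSubgroup (∀ y', Y.O y' ⊗[ℤ] M.E (F.f y')) where
  carrier := {s | ∀ᶠ y' in 𝓝 y, s y' = 0}
  zero_mem' := Eventually.of_forall fun _ => rfl
  add_mem' := fun {s t} hs ht => by
    filter_upwards [hs, ht] with y h h'
    change s y + t y = 0
    rw [h, h', add_zero]
  neg_mem' := fun {s} hs => by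
    filter_upwards [hs] with y h
    change - s y = 0
    rw [h, neg_zero]

/-- Germs at `y` of arbitrary families. -/
def GermT (y : Y.pt) : Type u := (∀ y', Y.O y' ⊗[ℤ] M.E (F.f y')) ⧸ F.nullT M y

instance (y : Y.pt) : AddCommGroup (F.GermT M y) :=
  inferInstanceAs (AddCommGroup ((∀ y', Y.O y' ⊗[ℤ] M.E (F.f y')) ⧸ F.nullT M y))

/-- The germ of a family. -/
def mkT (y : Y.pt) : (∀ y', Y.O y' ⊗[ℤ] M.E (F.f y')) →+ F.GermT M y :=
  QuotientAddGroup.mk' (F.nullT M y)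

variable {F M} in
theorem mkT_eq {y : Y.pt} {s t : ∀ y', Y.O y' ⊗[ℤ] M.E (F.f y')} :
    F.mkT M y s = F.mkT M y t ↔ ∀ᶠ y' in 𝓝 y, s y' = t y' := by
  refine QuotientAddGroup.eq.trans ?_
  change (∀ᶠ y' in 𝓝 y, - s y' + t y' = 0) ↔ _
  refine eventually_congr (Eventually.of_forall fun y => ?_)
  rw [neg_add_eq_zero]

theorem exists_spread (y : Y.pt) : ∃ r : Y.O y ⊗[ℤ] M.E (F.f y) →+
    F.GermT M y,
    ∀ h q, Y.Sec h y → M.Sec q (F.f y) → r (h y ⊗ₜ q (F.f y)) =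
      F.mkT M y (fun y' => h y' ⊗ₜ q (F.f y')) := by
  choose h hs hh using Y.etale.exists_sec y
  choose q qs hq using M.etale.exists_sec (F.f y)
  have kq : ∀ {q q' : ∀ x, M.E x}, M.Sec q (F.f y) → M.Sec q' (F.f y) → q (F.f y) = q' (F.f y) →
      ∀ᶠ y' in 𝓝 y, q (F.f y') = q' (F.f y') := fun h1 h2 h3 =>
    F.cont.continuousAt.eventually (M.etale.eq_near h1 h2 h3)
  refine ⟨TensorProduct.liftAddHom (biadd (fun a e => F.mkT M y
      (fun y' => h a y' ⊗ₜ q e (F.f y'))) ?_ ?_) ?_, ?_⟩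
  · intro a a' e
    rw [← map_add]
    refine mkT_eq.2 ?_
    filter_upwards [Y.etale.eq_near (hs (a + a')) (Y.add (hs a) (hs a')) (by simp [hh])] with y' h1
    rw [h1, TensorProduct.add_tmul]
    rfl
  · intro a e e'
    rw [← map_add]
    refine mkT_eq.2 ?_
    filter_upwards [kq (qs (e + e')) (M.add (qs e) (qs e')) (by simp [hq])] with y' h1
    rw [h1, TensorProduct.tmul_add]
    rfl
  · intro r a e
    refine mkT_eq.2 ?_
    have s1 : Y.Sec (fun y' => r • h a y') y := by
      simpa [zsmul_eq_mul] using Y.mul (Y.const (r : k) y) (hs a)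
    have s2 : M.Sec (fun x => r • q e x) (F.f y) := by
      have := M.smul (X.const (r : k) (F.f y)) (qs e)
      simpa [Int.cast_smul_eq_zsmul] using this
    filter_upwards [Y.etale.eq_near (hs (r • a)) s1 (by simp [hh]),
      kq (qs (r • e)) s2 (by simp [hq])] with y' h1 h2
    rw [h1, h2, TensorProduct.smul_tmul]
  · intro h' q' s1 s2
    change F.mkT M y _ = _
    refine mkT_eq.2 ?_
    filter_upwards [Y.etale.eq_near (hs (h' y)) s1 (hh _), kq (qs (q' (F.f y))) s2 (hq _)]
      with y' h1 h2
    rw [h1, h2]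

/-- `s` is near `y` a finite sum `∑ hᵢ ⊗ f⁻¹(qᵢ)`. -/
def TSec (s : ∀ y, Y.O y ⊗[ℤ] M.E (F.f y)) (y : Y.pt) : Prop :=
  ∃ (n : ℕ) (h : Fin n → ∀ y, Y.O y) (q : Fin n → ∀ x, M.E x), (∀ i, Y.Sec (h i) y) ∧
    (∀ i, M.Sec (q i) (F.f y)) ∧ ∀ᶠ y' in 𝓝 y, s y' = ∑ i, h i y' ⊗ₜ q i (F.f y')

variable {F M}

theorem TSec.tmul {h : ∀ y, Y.O y} {q : ∀ x, M.E x} {y : Y.pt} (hh : Y.Sec h y)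
    (hq : M.Sec q (F.f y)) : F.TSec M (fun y' => h y' ⊗ₜ q (F.f y')) y :=
  ⟨1, fun _ => h, fun _ => q, fun _ => hh, fun _ => hq, Eventually.of_forall fun y => by simp⟩

theorem TSec.congr {s t : ∀ y, Y.O y ⊗[ℤ] M.E (F.f y)} {y : Y.pt} (hs : F.TSec M s y)
    (h : ∀ᶠ y' in 𝓝 y, s y' = t y') : F.TSec M t y := by
  obtain ⟨n, f, q, h1, h2, h3⟩ := hs
  refine ⟨n, f, q, h1, h2, ?_⟩
  filter_upwards [h, h3] with y' h4 h5
  rw [← h4, h5]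

theorem TSec.add {s t : ∀ y, Y.O y ⊗[ℤ] M.E (F.f y)} {y : Y.pt} (hs : F.TSec M s y)
    (ht : F.TSec M t y) : F.TSec M (fun y => s y + t y) y := by
  obtain ⟨n, f, q, h1, h2, h3⟩ := hs
  obtain ⟨n', f', q', h1', h2', h3'⟩ := ht
  refine ⟨n + n', Fin.append f f', Fin.append q q', ?_, ?_, ?_⟩
  · intro i; refine Fin.addCases (fun i => ?_) (fun i => ?_) i <;> simp [h1, h1']
  · intro i; refine Fin.addCases (fun i => ?_) (fun i => ?_) i <;> simp [h2, h2']
  · filter_upwards [h3, h3'] with y' h4 h5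
    rw [Fin.sum_univ_add, h4, h5]
    simp

theorem TSec.zero (y : Y.pt) : F.TSec M (fun _ => 0) y :=
  ⟨0, Fin.elim0, Fin.elim0, fun i => i.elim0, fun i => i.elim0,
    Eventually.of_forall fun y => by simp⟩

theorem TSec.induction {P : (∀ y, Y.O y ⊗[ℤ] M.E (F.f y)) → Prop} {y : Y.pt}
    (hc : ∀ s t, P s → (∀ᶠ y' in 𝓝 y, s y' = t y') → P t)
    (h0 : P (fun _ => 0)) (ha : ∀ s t, P s → P t → P (fun y => s y + t y))
    (ht : ∀ h q, Y.Sec h y → M.Sec q (F.f y) → P (fun y' => h y' ⊗ₜ q (F.f y')))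
    {s : ∀ y, Y.O y ⊗[ℤ] M.E (F.f y)} (hs : F.TSec M s y) : P s := by
  obtain ⟨n, f, q, h1, h2, h3⟩ := hs
  refine hc (fun y' => ∑ i, f i y' ⊗ₜ q i (F.f y')) _ ?_ (h3.mono fun _ h => h.symm)
  clear h3
  induction n with
  | zero => simpa using h0
  | succ n ih =>
    simp only [Fin.sum_univ_succ]
    exact ha _ _ (ht _ _ (h1 0) (h2 0)) (ih _ _ (fun i => h1 _) (fun i => h2 _))

theorem TSec.spread {s : ∀ y, Y.O y ⊗[ℤ] M.E (F.f y)} {y : Y.pt} (hs : F.TSec M s y) :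
    (F.exists_spread M y).choose (s y) = F.mkT M y s := by
  refine TSec.induction (P := fun s => (F.exists_spread M y).choose (s y) = F.mkT M y s)
    (fun s t hs h => ?_) ?_ (fun s t hs ht => ?_) (fun h q hh hq => ?_) hs
  · rw [← h.self_of_nhds, hs, mkT_eq]
    exact h
  · exact (map_zero _).trans (map_zero (F.mkT M y)).symm
  · rw [map_add, hs, ht, ← map_add]
    rfl
  · exact (F.exists_spread M y).choose_spec h q hh hq

variable (F M)

/-- The sheaf `O_Y ⊗_ℤ f⁻¹ M`. -/
abbrev tens : MSheaf Y where
  E y := Y.O y ⊗[ℤ] M.E (F.f y)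
  Sec := F.TSec M
  etale :=
    { near := fun ⟨n, h, q, h1, h2, h3⟩ => by
        filter_upwards [eventually_all.2 fun i => Y.etale.near (h1 i),
          F.cont.continuousAt.eventually (eventually_all.2 fun i => M.etale.near (h2 i)),
          eventually_eventually_nhds.2 h3] with y h4 h5 h6
        exact ⟨n, h, q, h4, h5, h6⟩
      congr := TSec.congr
      exists_sec := fun y e => by
        induction e using TensorProduct.induction_on with
        | zero => exact ⟨_, TSec.zero y, rfl⟩
        | tmul h q =>
          obtain ⟨h, hh, rfl⟩ := Y.etale.exists_sec y h
          obtain ⟨q, hq, rfl⟩ := M.etale.exists_sec (F.f y) q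
          exact ⟨_, TSec.tmul hh hq, rfl⟩
        | add a b ha hb =>
          obtain ⟨s, hs, rfl⟩ := ha
          obtain ⟨t, ht, rfl⟩ := hb
          exact ⟨_, hs.add ht, rfl⟩
      eq_near := fun {s t y} hs ht he => by
        have h1 := hs.spread
        rw [he, ht.spread] at h1
        exact mkT_eq.1 h1.symm }
  add := TSec.add
  smul := fun {f s y} hf hs => by
    refine TSec.induction (P := fun s => F.TSec M (fun y => f y • s y) y)
      (fun s t hs h => ?_) ?_ (fun s t hs ht => ?_) (fun h q hh hq => ?_) hs
    · refine hs.congr (h.mono fun y h => ?_)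
      rw [h]
    · simpa using TSec.zero y
    · simpa using hs.add ht
    · simpa [TensorProduct.smul_tmul'] using TSec.tmul (Y.mul hf hh) hq

end SpMap
end SheafOps

section SubqMap
variable {R : Type u} [CommRing R] {P P' P'' : Type u} [AddCommGroup P] [Module R P]
  [AddCommGroup P'] [Module R P'] [AddCommGroup P''] [Module R P'']

/-- The map of subquotients induced by a linear map. -/
def subqMap (C N : Submodule R P) (C' N' : Submodule R P') (g : P →ₗ[R] P')
    (hC : ∀ p ∈ C, g p ∈ C') (hN : ∀ p ∈ N, p ∈ C → g p ∈ N') :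
    (C ⧸ N.comap C.subtype) →ₗ[R] (C' ⧸ N'.comap C'.subtype) :=
  Submodule.mapQ _ _ (g.restrict hC) (fun p hp => hN p hp p.2)

theorem subqMap_mk (C N : Submodule R P) (C' N' : Submodule R P') (g : P →ₗ[R] P')
    (hC : ∀ p ∈ C, g p ∈ C') (hN : ∀ p ∈ N, p ∈ C → g p ∈ N') (p : C) :
    subqMap C N C' N' g hC hN ((N.comap C.subtype).mkQ p) =
      (N'.comap C'.subtype).mkQ ⟨g p, hC p p.2⟩ := rfl

/-- The map from a subquotient to a module induced by a linear map. -/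
def subqLift (C N : Submodule R P) (g : P →ₗ[R] P') (hN : ∀ p ∈ N, p ∈ C → g p = 0) :
    (C ⧸ N.comap C.subtype) →ₗ[R] P' :=
  (N.comap C.subtype).liftQ (g ∘ₗ C.subtype) (fun p hp => hN p hp p.2)

theorem subqLift_mk (C N : Submodule R P) (g : P →ₗ[R] P') (hN : ∀ p ∈ N, p ∈ C → g p = 0)
    (p : C) : subqLift C N g hN ((N.comap C.subtype).mkQ p) = g p := rfl

end SubqMap

section Algebroids

variable {k : Type} [Field k] {X Y : RSpace.{u} k}

/-- A Lie algebroid on `X`. -/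
structure LieAlgd (X : RSpace.{u} k) where
  A : MSheaf X
  str : ∀ x, LieStr (X.cartan x) (A.E x)
  br_sec : ∀ {a b x}, A.Sec a x → A.Sec b x → A.Sec (fun y => (str y).br (a y) (b y)) x
  anchor_sec : ∀ {a x}, A.Sec a x → X.T.Sec (fun y => (str y).anchor (a y)) x

/-- A Courant algebroid on `X`. -/
structure CourantAlgd (X : RSpace.{u} k) where
  Q : MSheaf X
  str : ∀ x, CourantStr (X.cartan x) (Q.E x)
  br_sec : ∀ {a b x}, Q.Sec a x → Q.Sec b x → Q.Sec (fun y => (str y).br (a y) (b y)) x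
  anchor_sec : ∀ {a x}, Q.Sec a x → X.T.Sec (fun y => (str y).anchor (a y)) x
  pair_sec : ∀ {a b x}, Q.Sec a x → Q.Sec b x → X.Sec (fun y => (str y).pair (a y) (b y)) x
  coanchor_sec : ∀ {α x}, X.Ω.Sec α x → Q.Sec (fun y => (str y).coanchor (α y)) x

/-- A Courant algebroid together with a morphism to the Lie algebroid `A`. -/
structure CourantOver (A : LieAlgd X) extends CourantAlgd X where
  proj : ∀ x, Q.E x →ₗ[X.O x] A.A.E x
  proj_sec : ∀ {q x}, Q.Sec q x → A.A.Sec (fun y => proj y (q y)) x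
  isOver : ∀ x, IsCourantOver (A.str x) (str x) (proj x)

/-- `Q` is an extension of `A` by the one-forms: `0 → Ω → Q → A → 0` is exact. -/
structure CourantOver.IsExtension {A : LieAlgd X} (Q : CourantOver A) : Prop where
  injective : ∀ x, Function.Injective (Q.str x).coanchor
  exact : ∀ x q, Q.proj x q = 0 → ∃ α, (Q.str x).coanchor α = q
  surjective : ∀ x, Function.Surjective (Q.proj x)

/-- Morphisms of Courant algebroids over `A`. -/
@[ext] structure CourantOver.Hom {A : LieAlgd X} (P Q : CourantOver A) where
  φ : ∀ x, P.Q.E x →ₗ[X.O x] Q.Q.E x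
  sec : ∀ {q x}, P.Q.Sec q x → Q.Q.Sec (fun y => φ y (q y)) x
  br : ∀ x q q', φ x ((P.str x).br q q') = (Q.str x).br (φ x q) (φ x q')
  anchor : ∀ x q, (Q.str x).anchor (φ x q) = (P.str x).anchor q
  pair : ∀ x q q', (Q.str x).pair (φ x q) (φ x q') = (P.str x).pair q q'
  coanchor : ∀ x α, φ x ((P.str x).coanchor α) = (Q.str x).coanchor α
  proj : ∀ x q, Q.proj x (φ x q) = P.proj x q

open CategoryTheory

instance (A : LieAlgd X) : Category (CourantOver A) where
  Hom := CourantOver.Hom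
  id P :=
    { φ := fun x => LinearMap.id
      sec := fun h => h
      br := fun _ _ _ => rfl
      anchor := fun _ _ => rfl
      pair := fun _ _ _ => rfl
      coanchor := fun _ _ => rfl
      proj := fun _ _ => rfl }
  comp f g :=
    { φ := fun x => g.φ x ∘ₗ f.φ x
      sec := fun h => g.sec (f.sec h)
      br := fun x q q' => by simp [f.br, g.br]
      anchor := fun x q => by simp [f.anchor, g.anchor]
      pair := fun x q q' => by simp [f.pair, g.pair]
      coanchor := fun x α => by simp [f.coanchor, g.coanchor]
      proj := fun x q => by simp [f.proj, g.proj] }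

theorem CourantOver.hom_ext {A : LieAlgd X} {P Q : CourantOver A} {f g : P ⟶ Q}
    (h : ∀ x q, f.φ x q = g.φ x q) : f = g :=
  CourantOver.Hom.ext (funext fun x => LinearMap.ext (h x))

@[simp] theorem CourantOver.id_φ {A : LieAlgd X} (P : CourantOver A) (x : X.pt) (q : P.Q.E x) :
    CourantOver.Hom.φ (𝟙 P) x q = q := rfl

@[simp] theorem CourantOver.comp_φ {A : LieAlgd X} {P Q R : CourantOver A} (f : P ⟶ Q)
    (g : Q ⟶ R) (x : X.pt) (q : P.Q.E x) :
    CourantOver.Hom.φ (f ≫ g) x q = g.φ x (f.φ x q) := rfl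

/-- The category of Courant extensions of `A`. -/
abbrev CExt (A : LieAlgd X) :=
  ObjectProperty.FullSubcategory (fun Q : CourantOver A => Q.IsExtension)

namespace SpMap
variable (F : SpMap Y X) {M N : MSheaf X}

theorem sec_sext {Z : MSheaf Y} (f : ∀ y, M.E (F.f y) →+ Z.E y) {y : Y.pt}
    (hf : ∀ q, M.Sec q (F.f y) → Z.Sec (fun y' => f y' (q (F.f y'))) y)
    {s : ∀ y, Y.O y ⊗[ℤ] M.E (F.f y)} (hs : F.TSec M s y) :
    Z.Sec (fun y' => sext (f y') (s y')) y := by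
  refine TSec.induction (P := fun s => Z.Sec (fun y' => sext (f y') (s y')) y)
      (fun s t hs h => ?_) ?_ (fun s t hs ht => ?_) (fun h q hh hq => ?_) hs
  · refine Z.etale.congr hs (h.mono fun y h => ?_)
    rw [h]
  · simpa using Z.zero y
  · simpa using Z.add hs ht
  · simpa using Z.smul hh (hf q hq)

theorem sec_sext₂ {Z : MSheaf Y} (f : ∀ y, M.E (F.f y) →+ M.E (F.f y) →+ Z.E y) {y : Y.pt}
    (hf : ∀ q p, M.Sec q (F.f y) → M.Sec p (F.f y) →
      Z.Sec (fun y' => f y' (q (F.f y')) (p (F.f y'))) y)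
    {s t : ∀ y, Y.O y ⊗[ℤ] M.E (F.f y)} (hs : F.TSec M s y) (ht : F.TSec M t y) :
    Z.Sec (fun y' => sext₂ (f y') (s y') (t y')) y := by
  refine TSec.induction (P := fun s => Z.Sec (fun y' => sext₂ (f y') (s y') (t y')) y)
      (fun s s' hs h => ?_) ?_ (fun s s' hs hs' => ?_) (fun h q hh hq => ?_) hs
  · refine Z.etale.congr hs (h.mono fun y h => ?_)
    rw [h]
  · simpa using Z.zero y
  · simpa using Z.add hs hs'
  · refine TSec.induction (P := fun t => Z.Sec (fun y' => sext₂ (f y') (h y' ⊗ₜ q (F.f y')) (t y'))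
      y) (fun s s' hs h => ?_) ?_ (fun s s' hs hs' => ?_) (fun j p hj hp => ?_) ht
    · refine Z.etale.congr hs (h.mono fun y h => ?_)
      rw [h]
    · simpa using Z.zero y
    · simpa using Z.add hs hs'
    · simpa using Z.smul hh (Z.smul hj (hf q p hq hp))

/-- The structure sheaf as a sheaf of modules. -/
abbrev _root_.RSpace.OM (Y : RSpace.{u} k) : MSheaf Y where
  E := Y.O
  Sec := Y.Sec
  etale := Y.etale
  add := Y.add
  smul := Y.mul

theorem sec_brT (br : ∀ x, M.E x →+ M.E x →+ M.E x) {y : Y.pt}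
    (hbr : ∀ q p, M.Sec q (F.f y) → M.Sec p (F.f y) →
      M.Sec (fun x => br x (q x) (p x)) (F.f y))
    {s t : ∀ y, Y.O y ⊗[ℤ] M.E (F.f y)} (hs : F.TSec M s y) (ht : F.TSec M t y) :
    F.TSec M (fun y' => brT (br (F.f y')) (s y') (t y')) y :=
  F.sec_sext₂ (Z := F.tens M) _ (fun q p hq hp => TSec.tmul (Y.one y) (hbr q p hq hp)) hs ht

theorem sec_derT {ξ : ∀ y, Y.T.E y} {y : Y.pt} (hξ : Y.T.Sec ξ y)
    {s : ∀ y, Y.O y ⊗[ℤ] M.E (F.f y)} (hs : F.TSec M s y) :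
    F.TSec M (fun y' => derT (Y.cartan y') (M.E (F.f y')) (ξ y') (s y')) y := by
  refine TSec.induction
      (P := fun s => F.TSec M (fun y' => derT (Y.cartan y') (M.E (F.f y')) (ξ y') (s y')) y)
      (fun s t hs h => ?_) ?_ (fun s t hs ht => ?_) (fun h q hh hq => ?_) hs
  · refine hs.congr (h.mono fun y h => ?_)
    rw [h]
  · simpa using TSec.zero y
  · simpa using hs.add ht
  · exact TSec.tmul (RSpace.cartan_act hξ hh) hq

/-- `h ⊗ q ↦ h ⊗ f(q)` -/
def _root_.tmap (S : Type u) [CommRing S] {Q A : Type u} [AddCommGroup Q] [AddCommGroup A]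
    (f : Q →+ A) : S ⊗[ℤ] Q →ₗ[S] S ⊗[ℤ] A :=
  sext (AddMonoidHom.mk' (fun q => (1 : S) ⊗ₜ[ℤ] f q) (fun q q' => by simp [TensorProduct.tmul_add]))

@[simp] theorem _root_.tmap_tmul (S : Type u) [CommRing S] {Q A : Type u} [AddCommGroup Q]
    [AddCommGroup A] (f : Q →+ A) (h : S) (q : Q) :
    tmap S f (h ⊗ₜ[ℤ] q) = h ⊗ₜ[ℤ] f q := by
  simp [tmap, TensorProduct.smul_tmul']

theorem sec_tmap (f : ∀ x, M.E x →+ N.E x) {y : Y.pt}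
    (hf : ∀ q, M.Sec q (F.f y) → N.Sec (fun x => f x (q x)) (F.f y))
    {s : ∀ y, Y.O y ⊗[ℤ] M.E (F.f y)} (hs : F.TSec M s y) :
    F.TSec N (fun y' => tmap (Y.O y') (f (F.f y')) (s y')) y :=
  F.sec_sext (Z := F.tens N) _ (fun q hq => TSec.tmul (Y.one y) (hf q hq)) hs

end SpMap

section PullLie
variable (F : SpMap Y X) (A : LieAlgd X)

/-- The sheaf `(O_Y ⊗_ℤ f⁻¹A) ⊕ T_Y`. -/
noncomputable abbrev LieAlgd.pullP : MSheaf Y := (F.tens A.A).prod Y.T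

/-- The stalks of the fibre product over `f^* T_X`. -/
noncomputable def LieAlgd.pullK (y : Y.pt) : Submodule (Y.O y) ((A.pullP F).E y) :=
  compat (Y.cartan y) (F.φ y) (X.cartan (F.f y)) (A.str (F.f y)).anchor

theorem LieAlgd.pullBr_sec {y : Y.pt} {s t : ∀ y, (A.pullP F).E y} (hs : (A.pullP F).Sec s y)
    (ht : (A.pullP F).Sec t y) :
    (A.pullP F).Sec (fun y' => pullLieBr (Y.cartan y') (A.str (F.f y')).br (s y') (t y')) y :=
  ⟨(F.tens A.A).add (MSheaf.sub (M := F.tens A.A)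
    (F.sec_brT (fun x => (A.str x).br) (fun _ _ h h' => A.br_sec h h') hs.1 ht.1)
    (F.sec_derT ht.2 hs.1)) (F.sec_derT hs.2 ht.1), RSpace.cartan_lie hs.2 ht.2⟩

theorem LieAlgd.pullN_isSub : (A.pullP F).IsSub
    (fun y => pullLieN (Y.T.E y) (F.φ y) (A.A.E (F.f y))) := by
  refine MSheaf.isSub_span _ _ fun y e he => ?_
  obtain ⟨g, a, rfl⟩ := he
  obtain ⟨g, hg, rfl⟩ := X.etale.exists_sec (F.f y) g
  obtain ⟨a, ha, rfl⟩ := A.A.etale.exists_sec (F.f y) a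
  exact ⟨fun y' => (F.φ y' (g (F.f y')) ⊗ₜ[ℤ] a (F.f y') -
    (1 : Y.O y') ⊗ₜ[ℤ] (g (F.f y') • a (F.f y')), 0),
    ⟨MSheaf.sub (M := F.tens A.A) (SpMap.TSec.tmul (F.sec hg) ha)
      (SpMap.TSec.tmul (q := fun x => g x • a x) (Y.one y) (A.A.smul hg ha)), Y.T.zero y⟩, rfl,
    Eventually.of_forall fun y' => ⟨_, _, rfl⟩⟩

/-- The stalk at `y` of the inverse image, as a subquotient. -/
noncomputable def LieAlgd.pullSub (y : Y.pt) :
    LieSubquotient (Y.cartan y) ((A.pullP F).E y) :=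
  pullLie (Y.cartan y) (F.φ y) (A.str (F.f y)) (MSheaf.interior (A.pullK F) y)
    (MSheaf.interior_le y) (by
      rintro _ ⟨s, hs, rfl, h⟩ _ ⟨t, ht, rfl, h'⟩
      refine ⟨_, A.pullBr_sec F hs ht, rfl, ?_⟩
      filter_upwards [h, h'] with y' h1 h2
      exact tact_brT (Y.cartan y') (F.φ y') _ _ (A.str (F.f y')).anchor_br h1 h2)

/-- The inverse image `f⁺A = f^*A ×_{f^*T_X} T_Y` of a Lie algebroid. -/
noncomputable def LieAlgd.pull : LieAlgd Y where
  A := MSheaf.subquot (M := A.pullP F) (MSheaf.interior (A.pullK F))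
    (fun y => pullLieN (Y.T.E y) (F.φ y) (A.A.E (F.f y)))
    (MSheaf.interior_isSub _) (A.pullN_isSub F)
  str y := (A.pullSub F y).str
  br_sec := fun ⟨s, hs, h⟩ ⟨t, ht, h'⟩ => ⟨_, A.pullBr_sec F hs ht, by
    filter_upwards [h, h'] with y h1 h2
    obtain ⟨h1, h1'⟩ := h1
    obtain ⟨h2, h2'⟩ := h2
    refine ⟨(A.pullSub F y).C_br _ h1 _ h2, ?_⟩
    rw [h1', h2']
    rfl⟩
  anchor_sec := fun ⟨s, hs, h⟩ => by
    refine Y.T.etale.congr hs.2 ?_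
    filter_upwards [h] with y h1
    obtain ⟨h1, h1'⟩ := h1
    rw [h1']
    rfl

end PullLie
end Algebroids

section TMap
set_option linter.unusedSectionVars false
variable {k : Type} {R T Ω S U Θ : Type u} [Field k] [CommRing R] [Algebra k R]
  [AddCommGroup T] [Module R T] [AddCommGroup Ω] [Module R Ω]
  [CommRing S] [Algebra k S] [AddCommGroup U] [Module S U] [AddCommGroup Θ] [Module S Θ]
  {Q A : Type u} [AddCommGroup Q] [AddCommGroup A]

theorem tmap_brT (f : Q →+ A) (b : Q →+ Q →+ Q) (b' : A →+ A →+ A)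
    (h : ∀ q p, f (b q p) = b' (f q) (f p)) (s t : S ⊗[ℤ] Q) :
    tmap S f (brT b s t) = brT b' (tmap S f s) (tmap S f t) := by
  induction s using TensorProduct.induction_on with
  | zero => simp
  | add x y hx hy => simp only [map_add, LinearMap.add_apply, hx, hy]
  | tmul j q =>
    induction t using TensorProduct.induction_on with
    | zero => simp
    | add x y hx hy => simp only [map_add, hx, hy]
    | tmul l p => simp [h]

theorem tmap_derT (𝒟 : Cartan k S U Θ) (f : Q →+ A) (ξ : U) (t : S ⊗[ℤ] Q) :
    tmap S f (derT 𝒟 Q ξ t) = derT 𝒟 A ξ (tmap S f t) := by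
  induction t using TensorProduct.induction_on with
  | zero => simp
  | add x y hx hy => simp only [map_add, hx, hy]
  | tmul l p => simp

theorem tmap_sext₂ {M : Type u} [AddCommGroup M] [Module S M] (f : Q →+ A) (b : Q →+ Q →+ M)
    (b' : A →+ A →+ M) (h : ∀ q p, b' (f q) (f p) = b q p) (s t : S ⊗[ℤ] Q) :
    sext₂ b' (tmap S f s) (tmap S f t) = sext₂ b s t := by
  induction s using TensorProduct.induction_on with
  | zero => simp
  | add x y hx hy => simp only [map_add, LinearMap.add_apply, hx, hy]
  | tmul j q =>
    induction t using TensorProduct.induction_on with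
    | zero => simp
    | add x y hx hy => simp only [map_add, hx, hy]
    | tmul l p => simp [h]

theorem tmap_dpair (𝒟 : Cartan k S U Θ) (f : Q →+ A) (b : Q →+ Q →+ S)
    (b' : A →+ A →+ S) (h : ∀ q p, b' (f q) (f p) = b q p) (s t : S ⊗[ℤ] Q) :
    dpair 𝒟 b' (tmap S f s) (tmap S f t) = dpair 𝒟 b s t := by
  induction s using TensorProduct.induction_on with
  | zero => simp
  | add x y hx hy => simp only [map_add, AddMonoidHom.add_apply, hx, hy]
  | tmul j q =>
    induction t using TensorProduct.induction_on with
    | zero => simp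
    | add x y hx hy => simp only [map_add, hx, hy]
    | tmul l p => simp [h]

theorem tact_tmap {𝒞 : Cartan k R T Ω} (φ : R →+* S) [Module R Q] [Module R A] (f : Q →ₗ[R] A)
    (π : Q →ₗ[R] T) (σ : A →ₗ[R] T) (h : ∀ q, σ (f q) = π q) (g : R) (t : S ⊗[ℤ] Q) :
    tact 𝒞 φ σ g (tmap S f.toAddMonoidHom t) = tact 𝒞 φ π g t := by
  induction t using TensorProduct.induction_on with
  | zero => simp
  | add x y hx hy => simp only [map_add, hx, hy]
  | tmul l p => simp [h]

theorem tmap_id (t : S ⊗[ℤ] Q) : tmap S (AddMonoidHom.id Q) t = t := by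
  induction t using TensorProduct.induction_on with
  | zero => simp
  | add x y hx hy => simp only [map_add, hx, hy]
  | tmul l p => simp

theorem tmap_comp {B : Type u} [AddCommGroup B] (f : Q →+ A) (g : A →+ B) (t : S ⊗[ℤ] Q) :
    tmap S g (tmap S f t) = tmap S (g.comp f) t := by
  induction t using TensorProduct.induction_on with
  | zero => simp
  | add x y hx hy => simp only [map_add, hx, hy]
  | tmul l p => simp

end TMap

section PullCourantSheaf
variable {k : Type} [Field k] {X Y : RSpace.{u} k} (F : SpMap Y X)

namespace CourantAlgd
variable (Q : CourantAlgd X)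

/-- The sheaf `Ω_Y ⊕ (O_Y ⊗_ℤ f⁻¹Q) ⊕ T_Y`. -/
noncomputable abbrev pullP : MSheaf Y := Y.Ω.prod ((F.tens Q.Q).prod Y.T)

/-- The elements `(α, t, ξ)` for which `t` and `ξ` have the same image in `f^* T_X`. -/
noncomputable def pullK (y : Y.pt) : Submodule (Y.O y) ((Q.pullP F).E y) :=
  compat' (Y.Ω.E y) (Y.cartan y) (F.φ y) (Q.str (F.f y))

theorem sec_dpair {y : Y.pt} {s t : ∀ y, Y.O y ⊗[ℤ] Q.Q.E (F.f y)} (hs : F.TSec Q.Q s y)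
    (ht : F.TSec Q.Q t y) : Y.Ω.Sec (fun y' => dpair (Y.cartan y')
      ((Q.str (F.f y')).pairS (F.φ y')) (s y') (t y')) y := by
  refine SpMap.TSec.induction (P := fun s => Y.Ω.Sec (fun y' => dpair (Y.cartan y')
      ((Q.str (F.f y')).pairS (F.φ y')) (s y') (t y')) y)
      (fun s s' hs h => ?_) ?_ (fun s s' hs hs' => ?_) (fun h q hh hq => ?_) hs
  · refine Y.Ω.etale.congr hs (h.mono fun y h => ?_)
    rw [h]
  · simpa using Y.Ω.zero y
  · simpa using Y.Ω.add hs hs'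
  · refine SpMap.TSec.induction (P := fun t => Y.Ω.Sec (fun y' => dpair (Y.cartan y')
      ((Q.str (F.f y')).pairS (F.φ y')) (h y' ⊗ₜ q (F.f y')) (t y')) y)
      (fun s s' hs h => ?_) ?_ (fun s s' hs hs' => ?_) (fun j p hj hp => ?_) ht
    · refine Y.Ω.etale.congr hs (h.mono fun y h => ?_)
      rw [h]
    · simpa using Y.Ω.zero y
    · simpa using Y.Ω.add hs hs'
    · exact Y.Ω.smul hj (Y.Ω.smul (F.sec (Q.pair_sec hq hp)) (RSpace.cartan_d hh))

theorem pullBr_sec {y : Y.pt} {s t : ∀ y, (Q.pullP F).E y} (hs : (Q.pullP F).Sec s y)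
    (ht : (Q.pullP F).Sec t y) : (Q.pullP F).Sec (fun y' => pullBr (Y.cartan y') (F.φ y')
      (Q.str (F.f y')) (s y') (t y')) y :=
  ⟨Y.Ω.add (MSheaf.sub (RSpace.cartan_L hs.2.2 ht.1) (MSheaf.sub (RSpace.cartan_L ht.2.2 hs.1)
      (RSpace.cartan_d (RSpace.cartan_ι ht.2.2 hs.1)))) (Q.sec_dpair F hs.2.1 ht.2.1),
    (F.tens Q.Q).add (MSheaf.sub (M := F.tens Q.Q)
    (F.sec_brT (fun x => (Q.str x).br) (fun _ _ h h' => Q.br_sec h h') hs.2.1 ht.2.1)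
    (F.sec_derT ht.2.2 hs.2.1)) (F.sec_derT hs.2.2 ht.2.1), RSpace.cartan_lie hs.2.2 ht.2.2⟩

theorem pullPair_sec {y : Y.pt} {s t : ∀ y, (Q.pullP F).E y} (hs : (Q.pullP F).Sec s y)
    (ht : (Q.pullP F).Sec t y) : Y.Sec (fun y' => pullPair (Y.cartan y') (F.φ y')
      (Q.str (F.f y')) (s y') (t y')) y :=
  Y.add (Y.add (RSpace.cartan_ι hs.2.2 ht.1) (RSpace.cartan_ι ht.2.2 hs.1))
    (F.sec_sext₂ (Z := Y.OM) (fun y' => (Q.str (F.f y')).pairS (F.φ y'))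
      (fun _ _ h h' => F.sec (Q.pair_sec h h')) hs.2.1 ht.2.1)

theorem pullN_isSub : (Q.pullP F).IsSub
    (fun y => pullN (Y.Ω.E y) (Y.T.E y) (Y.cartan y) (F.φ y) (Q.str (F.f y))) := by
  refine MSheaf.isSub_span _ _ fun y e he => ?_
  rcases he with ⟨g, a, rfl⟩ | ⟨g, rfl⟩
  · obtain ⟨g, hg, rfl⟩ := X.etale.exists_sec (F.f y) g
    obtain ⟨a, ha, rfl⟩ := Q.Q.etale.exists_sec (F.f y) a
    exact ⟨fun y' => (0, F.φ y' (g (F.f y')) ⊗ₜ[ℤ] a (F.f y') -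
      (1 : Y.O y') ⊗ₜ[ℤ] (g (F.f y') • a (F.f y')), 0),
      ⟨Y.Ω.zero y, MSheaf.sub (M := F.tens Q.Q) (SpMap.TSec.tmul (F.sec hg) ha)
      (SpMap.TSec.tmul (q := fun x => g x • a x) (Y.one y) (Q.Q.smul hg ha)), Y.T.zero y⟩, rfl,
      Eventually.of_forall fun y' => Or.inl ⟨_, _, rfl⟩⟩
  · obtain ⟨g, hg, rfl⟩ := X.etale.exists_sec (F.f y) g
    exact ⟨fun y' => ((Y.cartan y').d (F.φ y' (g (F.f y'))), - ((1 : Y.O y') ⊗ₜ[ℤ]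
      (Q.str (F.f y')).coanchor ((X.cartan (F.f y')).d (g (F.f y')))), 0),
      ⟨RSpace.cartan_d (F.sec hg), MSheaf.neg (M := F.tens Q.Q)
        (SpMap.TSec.tmul (q := fun x => (Q.str x).coanchor ((X.cartan x).d (g x)))
          (Y.one y) (Q.coanchor_sec (RSpace.cartan_d hg))), Y.T.zero y⟩, rfl,
      Eventually.of_forall fun y' => Or.inr ⟨_, rfl⟩⟩

/-- The stalk at `y` of the inverse image, as a subquotient. -/
noncomputable def pullSub (y : Y.pt) : CourantSubquotient (Y.cartan y) ((Q.pullP F).E y) :=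
  pullCourant (Y.cartan y) (F.φ y) (Q.str (F.f y)) (MSheaf.interior (Q.pullK F) y)
    (MSheaf.interior_le y) (by
      rintro _ ⟨s, hs, rfl, h⟩ _ ⟨t, ht, rfl, h'⟩
      refine ⟨_, Q.pullBr_sec F hs ht, rfl, ?_⟩
      filter_upwards [h, h'] with y' h1 h2
      exact tact_brT (Y.cartan y') (F.φ y') _ _ (Q.str (F.f y')).anchor_br h1 h2)
    (by
      intro α
      obtain ⟨α, hα, rfl⟩ := Y.Ω.etale.exists_sec y α
      exact ⟨fun y' => (α y', 0, 0), ⟨hα, SpMap.TSec.zero y, Y.T.zero y⟩, rfl,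
        Eventually.of_forall fun y' => Submodule.zero_mem
          (compat (Y.cartan y') (F.φ y') (X.cartan (F.f y')) (Q.str (F.f y')).anchor)⟩)

/-- The inverse image `f⁺⁺Q = (Ω_Y ⊕ f^*Q ×_{f^*T_X} T_Y) / f^*Ω_X` of a Courant algebroid. -/
noncomputable def pull : CourantAlgd Y where
  Q := MSheaf.subquot (M := Q.pullP F) (MSheaf.interior (Q.pullK F))
    (fun y => pullN (Y.Ω.E y) (Y.T.E y) (Y.cartan y) (F.φ y) (Q.str (F.f y)))
    (MSheaf.interior_isSub _) (Q.pullN_isSub F)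
  str y := (Q.pullSub F y).str
  br_sec := fun ⟨s, hs, h⟩ ⟨t, ht, h'⟩ => ⟨_, Q.pullBr_sec F hs ht, by
    filter_upwards [h, h'] with y h1 h2
    obtain ⟨h1, h1'⟩ := h1
    obtain ⟨h2, h2'⟩ := h2
    refine ⟨(Q.pullSub F y).C_br _ h1 _ h2, ?_⟩
    rw [h1', h2']
    rfl⟩
  anchor_sec := fun ⟨s, hs, h⟩ => by
    refine Y.T.etale.congr hs.2.2 ?_
    filter_upwards [h] with y h1
    obtain ⟨h1, h1'⟩ := h1
    rw [h1']
    rfl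
  pair_sec := fun ⟨s, hs, h⟩ ⟨t, ht, h'⟩ => by
    refine Y.etale.congr (Q.pullPair_sec F hs ht) ?_
    filter_upwards [h, h'] with y h1 h2
    obtain ⟨h1, h1'⟩ := h1
    obtain ⟨h2, h2'⟩ := h2
    rw [h1', h2']
    exact (quotPair_mk _ _ _ (Q.pullSub F y).N_pair (Q.pullSub F y).pair_symm
      (⟨s y, h1⟩ : (Q.pullSub F y).C) ⟨t y, h2⟩).symm
  coanchor_sec := fun {α y} hα => ⟨fun y' => (α y', 0, 0),
    ⟨hα, SpMap.TSec.zero y, Y.T.zero y⟩,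
    Eventually.of_forall fun y' => ⟨(Q.pullSub F y').C_coanchor _, rfl⟩⟩

end CourantAlgd

namespace CourantOver
variable {A : LieAlgd X} (Q : CourantOver A)

/-- `(α, t, ξ) ↦ ((id ⊗ p)(t), ξ)` -/
noncomputable def pullProj₀ (y : Y.pt) :
    (Q.pullP F).E y →ₗ[Y.O y] (A.pullP F).E y :=
  ((tmap (Y.O y) (Q.proj (F.f y)).toAddMonoidHom).prodMap LinearMap.id) ∘ₗ
    LinearMap.snd (Y.O y) (Y.Ω.E y) ((F.tens Q.Q).E y × Y.T.E y)

theorem pullProj₀_sec {y : Y.pt} {s : ∀ y, (Q.pullP F).E y} (hs : (Q.pullP F).Sec s y) :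
    (A.pullP F).Sec (fun y' => Q.pullProj₀ F y' (s y')) y :=
  ⟨F.sec_tmap (fun x => (Q.proj x).toAddMonoidHom) (fun _ h => Q.proj_sec h) hs.2.1, hs.2.2⟩

theorem pullProj₀_C (y : Y.pt) :
    ∀ p ∈ MSheaf.interior (Q.pullK F) y, Q.pullProj₀ F y p ∈ MSheaf.interior (A.pullK F) y := by
  rintro _ ⟨s, hs, rfl, h⟩
  refine ⟨_, Q.pullProj₀_sec F hs, rfl, ?_⟩
  filter_upwards [h] with y' h1 g
  exact (h1 g).trans (tact_tmap (F.φ y') (Q.proj (F.f y')) _ _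
    (Q.isOver (F.f y')).anchor g (s y').2.1).symm

theorem pullProj₀_N (y : Y.pt) : ∀ p ∈ pullN (Y.Ω.E y) (Y.T.E y) (Y.cartan y) (F.φ y)
    (Q.str (F.f y)), Q.pullProj₀ F y p ∈ pullLieN (Y.T.E y) (F.φ y) (A.A.E (F.f y)) := by
  intro p hp
  induction hp using Submodule.span_induction with
  | zero => rw [map_zero]; exact Submodule.zero_mem _
  | add a b _ _ ha hb => rw [map_add]; exact Submodule.add_mem _ ha hb
  | smul f a _ ha => rw [map_smul]; exact Submodule.smul_mem _ _ ha
  | mem a ha =>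
    rcases ha with ⟨g, q, rfl⟩ | ⟨g, rfl⟩
    · refine Submodule.subset_span ⟨g, Q.proj (F.f y) q, ?_⟩
      refine Prod.ext ?_ rfl
      simp [pullProj₀]
    · convert Submodule.zero_mem _ using 1
      refine Prod.ext ?_ rfl
      simp [pullProj₀, (Q.isOver (F.f y)).coanchor]

/-- The inverse image of a Courant algebroid over `A`, as a Courant algebroid over `f⁺A`. -/
noncomputable def pull : CourantOver (A.pull F) where
  toCourantAlgd := Q.toCourantAlgd.pull F
  proj y := subqMap _ _ _ _ (Q.pullProj₀ F y) (Q.pullProj₀_C F y)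
    (fun p hp _ => Q.pullProj₀_N F y p hp)
  proj_sec := fun ⟨s, hs, h⟩ => ⟨_, Q.pullProj₀_sec F hs, by
    filter_upwards [h] with y h1
    obtain ⟨h1, h1'⟩ := h1
    refine ⟨Q.pullProj₀_C F y _ h1, ?_⟩
    rw [h1']
    rfl⟩
  isOver y :=
    { map_br := fun q q' => by
        obtain ⟨q, rfl⟩ := Submodule.mkQ_surjective _ q
        obtain ⟨q', rfl⟩ := Submodule.mkQ_surjective _ q'
        refine congrArg (Submodule.mkQ _) (Subtype.ext (Prod.ext ?_ rfl))
        change tmap (Y.O y) (Q.proj (F.f y)).toAddMonoidHom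
          (brT (Q.str (F.f y)).br q.1.2.1 q'.1.2.1 - derT (Y.cartan y) _ q'.1.2.2 q.1.2.1
            + derT (Y.cartan y) _ q.1.2.2 q'.1.2.1) =
          brT (A.str (F.f y)).br (tmap (Y.O y) (Q.proj (F.f y)).toAddMonoidHom q.1.2.1)
            (tmap (Y.O y) (Q.proj (F.f y)).toAddMonoidHom q'.1.2.1)
            - derT (Y.cartan y) _ q'.1.2.2 (tmap (Y.O y) (Q.proj (F.f y)).toAddMonoidHom q.1.2.1)
            + derT (Y.cartan y) _ q.1.2.2 (tmap (Y.O y) (Q.proj (F.f y)).toAddMonoidHom q'.1.2.1)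
        rw [map_add, map_sub, tmap_brT _ _ _ (Q.isOver (F.f y)).map_br, tmap_derT, tmap_derT]
      anchor := fun q => by
        obtain ⟨q, rfl⟩ := Submodule.mkQ_surjective _ q
        rfl
      coanchor := fun α => by
        refine (Submodule.Quotient.mk_eq_zero _).2 ?_
        have h : Q.pullProj₀ F y (α, 0, 0) = 0 := Prod.ext (map_zero _) rfl
        change Q.pullProj₀ F y (α, 0, 0) ∈ pullLieN (Y.T.E y) (F.φ y) (A.A.E (F.f y))
        rw [h]
        exact Submodule.zero_mem _ }

variable {Q} {P : CourantOver A} (ψ : P.Hom Q)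

/-- `(α, t, ξ) ↦ (α, (id ⊗ ψ)(t), ξ)` -/
noncomputable def pullMap₀ (y : Y.pt) : (P.pullP F).E y →ₗ[Y.O y] (Q.pullP F).E y :=
  LinearMap.id.prodMap ((tmap (Y.O y) (ψ.φ (F.f y)).toAddMonoidHom).prodMap LinearMap.id)

theorem pullMap₀_sec {y : Y.pt} {s : ∀ y, (P.pullP F).E y} (hs : (P.pullP F).Sec s y) :
    (Q.pullP F).Sec (fun y' => pullMap₀ F ψ y' (s y')) y :=
  ⟨hs.1, F.sec_tmap (fun x => (ψ.φ x).toAddMonoidHom) (fun _ h => ψ.sec h) hs.2.1, hs.2.2⟩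

theorem pullMap₀_C (y : Y.pt) :
    ∀ p ∈ MSheaf.interior (P.pullK F) y, pullMap₀ F ψ y p ∈ MSheaf.interior (Q.pullK F) y := by
  rintro _ ⟨s, hs, rfl, h⟩
  refine ⟨_, pullMap₀_sec F ψ hs, rfl, ?_⟩
  filter_upwards [h] with y' h1 g
  exact (h1 g).trans (tact_tmap (F.φ y') (ψ.φ (F.f y')) _ _
    (ψ.anchor (F.f y')) g (s y').2.1).symm

theorem pullMap₀_N (y : Y.pt) : ∀ p ∈ pullN (Y.Ω.E y) (Y.T.E y) (Y.cartan y) (F.φ y)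
    (P.str (F.f y)), pullMap₀ F ψ y p ∈
      pullN (Y.Ω.E y) (Y.T.E y) (Y.cartan y) (F.φ y) (Q.str (F.f y)) := by
  intro p hp
  induction hp using Submodule.span_induction with
  | zero => rw [map_zero]; exact Submodule.zero_mem _
  | add a b _ _ ha hb => rw [map_add]; exact Submodule.add_mem _ ha hb
  | smul f a _ ha => rw [map_smul]; exact Submodule.smul_mem _ _ ha
  | mem a ha =>
    rcases ha with ⟨g, q, rfl⟩ | ⟨g, rfl⟩
    · refine Submodule.subset_span (Or.inl ⟨g, ψ.φ (F.f y) q, ?_⟩)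
      refine Prod.ext rfl (Prod.ext ?_ rfl)
      simp [pullMap₀]
    · refine Submodule.subset_span (Or.inr ⟨g, ?_⟩)
      refine Prod.ext rfl (Prod.ext ?_ rfl)
      simp [pullMap₀, ψ.coanchor (F.f y)]

/-- The inverse image of a morphism. -/
noncomputable def pullMap : (P.pull F).Hom (Q.pull F) where
  φ y := subqMap _ _ _ _ (pullMap₀ F ψ y) (pullMap₀_C F ψ y)
    (fun p hp _ => pullMap₀_N F ψ y p hp)
  sec := fun ⟨s, hs, h⟩ => ⟨_, pullMap₀_sec F ψ hs, by
    filter_upwards [h] with y h1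
    obtain ⟨h1, h1'⟩ := h1
    refine ⟨pullMap₀_C F ψ y _ h1, ?_⟩
    rw [h1']
    rfl⟩
  br y q q' := by
    obtain ⟨q, rfl⟩ := Submodule.mkQ_surjective _ q
    obtain ⟨q', rfl⟩ := Submodule.mkQ_surjective _ q'
    have h : ∀ a b, ((Q.str (F.f y)).pairS (F.φ y)) (ψ.φ (F.f y) a) (ψ.φ (F.f y) b) =
        ((P.str (F.f y)).pairS (F.φ y)) a b := fun a b => congrArg (F.φ y) (ψ.pair _ _ _)
    refine congrArg (Submodule.mkQ _) (Subtype.ext (Prod.ext ?_ (Prod.ext ?_ rfl)))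
    · exact congrArg (_ + ·) (tmap_dpair (Y.cartan y) (ψ.φ (F.f y)).toAddMonoidHom _ _
        h q.1.2.1 q'.1.2.1).symm
    · change tmap (Y.O y) (ψ.φ (F.f y)).toAddMonoidHom
          (brT (P.str (F.f y)).br q.1.2.1 q'.1.2.1 - derT (Y.cartan y) _ q'.1.2.2 q.1.2.1
            + derT (Y.cartan y) _ q.1.2.2 q'.1.2.1) =
          brT (Q.str (F.f y)).br (tmap (Y.O y) (ψ.φ (F.f y)).toAddMonoidHom q.1.2.1)
            (tmap (Y.O y) (ψ.φ (F.f y)).toAddMonoidHom q'.1.2.1)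
            - derT (Y.cartan y) _ q'.1.2.2 (tmap (Y.O y) (ψ.φ (F.f y)).toAddMonoidHom q.1.2.1)
            + derT (Y.cartan y) _ q.1.2.2 (tmap (Y.O y) (ψ.φ (F.f y)).toAddMonoidHom q'.1.2.1)
      rw [map_add, map_sub, tmap_brT _ _ _ (ψ.br (F.f y)), tmap_derT, tmap_derT]
  anchor y q := by
    obtain ⟨q, rfl⟩ := Submodule.mkQ_surjective _ q
    rfl
  pair y q q' := by
    obtain ⟨q, rfl⟩ := Submodule.mkQ_surjective _ q
    obtain ⟨q', rfl⟩ := Submodule.mkQ_surjective _ q'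
    have h : ∀ a b, ((Q.str (F.f y)).pairS (F.φ y)) (ψ.φ (F.f y) a) (ψ.φ (F.f y) b) =
        ((P.str (F.f y)).pairS (F.φ y)) a b := fun a b => congrArg (F.φ y) (ψ.pair _ _ _)
    refine (quotPair_mk _ _ _ (Q.pullSub F y).N_pair (Q.pullSub F y).pair_symm _ _).trans ?_
    refine Eq.trans ?_
      (quotPair_mk _ _ _ (P.pullSub F y).N_pair (P.pullSub F y).pair_symm _ _).symm
    exact congrArg (_ + ·) (tmap_sext₂ (ψ.φ (F.f y)).toAddMonoidHom _ _ h q.1.2.1 q'.1.2.1)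
  coanchor y α := by
    refine congrArg (Submodule.mkQ _) (Subtype.ext (Prod.ext rfl (Prod.ext ?_ rfl)))
    exact map_zero _
  proj y q := by
    obtain ⟨q, rfl⟩ := Submodule.mkQ_surjective _ q
    refine congrArg (Submodule.mkQ _) (Subtype.ext (Prod.ext ?_ rfl))
    refine (tmap_comp _ _ _).trans ?_
    exact congrArg (fun g => tmap (Y.O y) g q.1.2.1)
      (AddMonoidHom.ext fun a => ψ.proj (F.f y) a)

open CategoryTheory in
/-- The inverse image functor `f⁺⁺` on Courant algebroids over `A`. -/
noncomputable def pullFunctor (A : LieAlgd X) : CourantOver A ⥤ CourantOver (A.pull F) where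
  obj Q := Q.pull F
  map ψ := pullMap F ψ
  map_id P := hom_ext fun y q => by
    obtain ⟨q, rfl⟩ := Submodule.mkQ_surjective _ q
    refine congrArg (Submodule.mkQ _) (Subtype.ext (Prod.ext rfl (Prod.ext ?_ rfl)))
    exact tmap_id (S := Y.O y) q.1.2.1
  map_comp f g := hom_ext fun y q => by
    obtain ⟨q, rfl⟩ := Submodule.mkQ_surjective _ q
    refine congrArg (Submodule.mkQ _) (Subtype.ext (Prod.ext rfl (Prod.ext ?_ rfl)))
    exact (tmap_comp (S := Y.O y) (f.φ (F.f y)).toAddMonoidHom (g.φ (F.f y)).toAddMonoidHom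
      q.1.2.1).symm

end CourantOver
end PullCourantSheaf

section LinCombSheaf
open CategoryTheory
variable {k : Type} [Field k] {X : RSpace.{u} k} {A : LieAlgd X}

namespace CourantOver
variable {n : ℕ} (c : Fin n → k) (Q : Fin n → CourantOver A)

/-- The sheaf `Ω ⊕ A ⊕ Q₁ ⊕ ⋯ ⊕ Qₙ`. -/
noncomputable abbrev lcP : MSheaf X := X.Ω.prod (A.A.prod (MSheaf.pi fun i => (Q i).Q))

theorem lcC_isSub : (lcP Q).IsSub (fun x => lcC (fun i => (Q i).proj x) (X.Ω.E x)) :=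
  fun _ _ hs h => eventually_all.2 fun i =>
    A.A.etale.eq_near ((Q i).proj_sec (hs.2.2 i)) hs.2.1 (h i)

theorem lcN_isSub : (lcP Q).IsSub (fun x => lcN (fun i => (Q i).str x) c) := by
  intro s x hs h
  obtain ⟨α, hα⟩ := h
  choose α' h1 h2 using fun i => X.Ω.etale.exists_sec x (α i)
  have h3 : (lcP Q).Sec (fun y => (∑ i, algebraMap k (X.O y) (c i) • α' i y, 0,
      fun i => - ((Q i).str y).coanchor (α' i y))) x :=
    ⟨X.Ω.sum Finset.univ (fun i y => algebraMap k (X.O y) (c i) • α' i y)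
      fun i => X.Ω.smul (X.const (c i) x) (h1 i), A.A.zero x,
      fun i => MSheaf.neg ((Q i).coanchor_sec (h1 i))⟩
  refine ((lcP Q).etale.eq_near hs h3 (by rw [hα]; simp only [h2])).mono fun y hy => ?_
  exact ⟨fun i => α' i y, hy⟩

/-- The stalk of a linear combination, as a subquotient. -/
noncomputable def lcS (x : X.pt) : CourantSubquotient (X.cartan x) ((lcP Q).E x) :=
  lcSub (A.str x) (fun i => (Q i).str x) (fun i => (Q i).proj x) (fun i => (Q i).isOver x) c

theorem lcBr_sec {x : X.pt} {s t : ∀ y, (lcP Q).E y} (hs : (lcP Q).Sec s x)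
    (ht : (lcP Q).Sec t x) : (lcP Q).Sec
      (fun y => lcBr (A.str y) (fun i => (Q i).str y) (s y) (t y)) x :=
  ⟨X.Ω.add (MSheaf.sub (RSpace.cartan_L (A.anchor_sec hs.2.1) ht.1)
      (RSpace.cartan_L (A.anchor_sec ht.2.1) hs.1))
      (RSpace.cartan_d (RSpace.cartan_ι (A.anchor_sec ht.2.1) hs.1)),
    A.br_sec hs.2.1 ht.2.1, fun i => (Q i).br_sec (hs.2.2 i) (ht.2.2 i)⟩

theorem lcPair_sec {x : X.pt} {s t : ∀ y, (lcP Q).E y} (hs : (lcP Q).Sec s x)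
    (ht : (lcP Q).Sec t x) : X.Sec
      (fun y => lcPair (A.str y) (fun i => (Q i).str y) c (s y) (t y)) x :=
  X.add (X.add (RSpace.cartan_ι (A.anchor_sec hs.2.1) ht.1)
    (RSpace.cartan_ι (A.anchor_sec ht.2.1) hs.1))
    (RSpace.sum _ (fun i y => algebraMap k (X.O y) (c i) * ((Q i).str y).pair ((s y).2.2 i)
      ((t y).2.2 i)) fun i => X.mul (X.const _ x) ((Q i).pair_sec (hs.2.2 i) (ht.2.2 i)))

/-- The linear combination `c₁ Q₁ ∔ ⋯ ∔ cₙ Qₙ`: the push-out of the extension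
`Q₁ ×_A ⋯ ×_A Qₙ` of `A` by `Ω × ⋯ × Ω` along `(α₁, …, αₙ) ↦ ∑ cᵢ αᵢ`. -/
noncomputable def lc : CourantOver A where
  Q := MSheaf.subquot (M := lcP Q) (fun x => lcC (fun i => (Q i).proj x) (X.Ω.E x))
    (fun x => lcN (fun i => (Q i).str x) c) (lcC_isSub Q) (lcN_isSub c Q)
  str x := (lcS c Q x).str
  br_sec := fun ⟨s, hs, h⟩ ⟨t, ht, h'⟩ => ⟨_, lcBr_sec Q hs ht, by
    filter_upwards [h, h'] with y h1 h2
    obtain ⟨h1, h1'⟩ := h1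
    obtain ⟨h2, h2'⟩ := h2
    refine ⟨(lcS c Q y).C_br _ h1 _ h2, ?_⟩
    rw [h1', h2']
    rfl⟩
  anchor_sec := fun ⟨s, hs, h⟩ => by
    refine X.T.etale.congr (A.anchor_sec hs.2.1) ?_
    filter_upwards [h] with y h1
    obtain ⟨h1, h1'⟩ := h1
    rw [h1']
    rfl
  pair_sec := fun ⟨s, hs, h⟩ ⟨t, ht, h'⟩ => by
    refine X.etale.congr (lcPair_sec c Q hs ht) ?_
    filter_upwards [h, h'] with y h1 h2
    obtain ⟨h1, h1'⟩ := h1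
    obtain ⟨h2, h2'⟩ := h2
    rw [h1', h2']
    exact (quotPair_mk _ _ _ (lcS c Q y).N_pair (lcS c Q y).pair_symm
      (⟨s y, h1⟩ : (lcS c Q y).C) ⟨t y, h2⟩).symm
  coanchor_sec := fun {α x} hα => ⟨fun y => (α y, 0, 0),
    ⟨hα, A.A.zero x, fun i => (Q i).Q.zero x⟩,
    Eventually.of_forall fun y => ⟨(lcS c Q y).C_coanchor _, rfl⟩⟩
  proj x := subqLift _ _ (LinearMap.fst (X.O x) _ _ ∘ₗ LinearMap.snd (X.O x) _ _)
    (by rintro _ ⟨α, rfl⟩ -; rfl)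
  proj_sec := fun ⟨s, hs, h⟩ => by
    refine A.A.etale.congr hs.2.1 ?_
    filter_upwards [h] with y h1
    obtain ⟨h1, h1'⟩ := h1
    rw [h1']
    rfl
  isOver x :=
    { map_br := fun q q' => by
        obtain ⟨q, rfl⟩ := Submodule.mkQ_surjective _ q
        obtain ⟨q', rfl⟩ := Submodule.mkQ_surjective _ q'
        rfl
      anchor := fun q => by
        obtain ⟨q, rfl⟩ := Submodule.mkQ_surjective _ q
        rfl
      coanchor := fun α => rfl }

variable {Q}

/-- The class of `(β, a, (qᵢ))`. -/
noncomputable def lcMk (x : X.pt) (β : X.Ω.E x) (a : A.A.E x) (q : ∀ i, (Q i).Q.E x)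
    (h : ∀ i, (Q i).proj x (q i) = a) : (lc c Q).Q.E x :=
  ((lcN (fun i => (Q i).str x) c).comap
    (lcC (fun i => (Q i).proj x) (X.Ω.E x)).subtype).mkQ ⟨(β, a, q), h⟩

variable {c}

theorem exists_lcMk {x : X.pt} (e : (lc c Q).Q.E x) : ∃ β a q h, e = lcMk c x β a q h := by
  obtain ⟨⟨⟨β, a, q⟩, h⟩, rfl⟩ := Submodule.mkQ_surjective _ e
  exact ⟨β, a, q, h, rfl⟩

theorem lcMk_eq {x : X.pt} {β β' : X.Ω.E x} {a a' : A.A.E x} {q q' : ∀ i, (Q i).Q.E x} {h h'} :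
    lcMk c x β a q h = lcMk c x β' a' q' h' ↔ ∃ α : Fin n → X.Ω.E x,
      β - β' = ∑ i, algebraMap k (X.O x) (c i) • α i ∧ a = a' ∧
        ∀ i, q i - q' i = - ((Q i).str x).coanchor (α i) := by
  refine (Submodule.Quotient.eq _).trans ?_
  change (∃ α, _ = _) ↔ _
  refine exists_congr fun α => ?_
  refine (Prod.ext_iff.trans (and_congr Iff.rfl Prod.ext_iff)).trans ?_
  refine and_congr Iff.rfl (and_congr sub_eq_zero funext_iff)

theorem lcMk_br {x : X.pt} (β β' : X.Ω.E x) (a a' : A.A.E x) (q q' : ∀ i, (Q i).Q.E x) (h h') :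
    ((lc c Q).str x).br (lcMk c x β a q h) (lcMk c x β' a' q' h') =
      lcMk c x ((X.cartan x).L ((A.str x).anchor a) β' - (X.cartan x).L ((A.str x).anchor a') β +
        (X.cartan x).d ((X.cartan x).ι ((A.str x).anchor a') β)) ((A.str x).br a a')
        (fun i => ((Q i).str x).br (q i) (q' i))
        (fun i => by rw [((Q i).isOver x).map_br, h, h']) := rfl

theorem lcMk_pair {x : X.pt} (β β' : X.Ω.E x) (a a' : A.A.E x) (q q' : ∀ i, (Q i).Q.E x) (h h') :
    ((lc c Q).str x).pair (lcMk c x β a q h) (lcMk c x β' a' q' h') =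
      (X.cartan x).ι ((A.str x).anchor a) β' + (X.cartan x).ι ((A.str x).anchor a') β +
        ∑ i, algebraMap k (X.O x) (c i) * ((Q i).str x).pair (q i) (q' i) :=
  quotPair_mk _ _ _ (lcS c Q x).N_pair (lcS c Q x).pair_symm
    (⟨(β, a, q), h⟩ : (lcS c Q x).C) ⟨(β', a', q'), h'⟩

theorem lcMk_anchor {x : X.pt} (β : X.Ω.E x) (a : A.A.E x) (q : ∀ i, (Q i).Q.E x) (h) :
    ((lc c Q).str x).anchor (lcMk c x β a q h) = (A.str x).anchor a := rfl

theorem lcMk_proj {x : X.pt} (β : X.Ω.E x) (a : A.A.E x) (q : ∀ i, (Q i).Q.E x) (h) :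
    (lc c Q).proj x (lcMk c x β a q h) = a := rfl

theorem lcMk_coanchor {x : X.pt} (β : X.Ω.E x) :
    ((lc c Q).str x).coanchor β = lcMk c x β 0 (fun _ => 0) (fun _ => map_zero _) := rfl

theorem lcMk_add {x : X.pt} (β β' : X.Ω.E x) (a a' : A.A.E x) (q q' : ∀ i, (Q i).Q.E x) (h h') :
    lcMk c x β a q h + lcMk c x β' a' q' h' = lcMk c x (β + β') (a + a') (fun i => q i + q' i)
      (fun i => by rw [map_add, h, h']) := rfl

theorem lcMk_smul {x : X.pt} (f : X.O x) (β : X.Ω.E x) (a : A.A.E x) (q : ∀ i, (Q i).Q.E x) (h) :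
    f • lcMk c x β a q h = lcMk c x (f • β) (f • a) (fun i => f • q i)
      (fun i => by rw [map_smul, h]) := rfl

/-- A function on `lc c Q` from its values on representatives. -/
noncomputable def lcLift {x : X.pt} {Z : Type u} [AddCommGroup Z] [Module (X.O x) Z]
    (g : ∀ (β : X.Ω.E x) (a : A.A.E x) (q : ∀ i, (Q i).Q.E x), (∀ i, (Q i).proj x (q i) = a) → Z)
    (hadd : ∀ β β' a a' q q' h h', g (β + β') (a + a') (fun i => q i + q' i)
      (fun i => by rw [map_add, h, h']) = g β a q h + g β' a' q' h')
    (hsmul : ∀ (f : X.O x) β a q h, g (f • β) (f • a) (fun i => f • q i)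
      (fun i => by rw [map_smul, h]) = f • g β a q h)
    (hN : ∀ α : Fin n → X.Ω.E x, g (∑ i, algebraMap k (X.O x) (c i) • α i) 0
      (fun i => - ((Q i).str x).coanchor (α i))
      (fun i => by rw [map_neg, ((Q i).isOver x).coanchor, neg_zero]) = 0) :
    (lc c Q).Q.E x →ₗ[X.O x] Z :=
  ((lcN (fun i => (Q i).str x) c).comap
    (lcC (fun i => (Q i).proj x) (X.Ω.E x)).subtype).liftQ
    { toFun := fun u => g u.1.1 u.1.2.1 u.1.2.2 u.2
      map_add' := fun u v => hadd _ _ _ _ _ _ u.2 v.2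
      map_smul' := fun f u => hsmul f _ _ _ u.2 }
    (by
      rintro ⟨_, h⟩ ⟨α, rfl⟩
      exact hN α)

theorem lcLift_mk {x : X.pt} {Z : Type u} [AddCommGroup Z] [Module (X.O x) Z]
    (g : ∀ (β : X.Ω.E x) (a : A.A.E x) (q : ∀ i, (Q i).Q.E x), (∀ i, (Q i).proj x (q i) = a) → Z)
    (hadd hsmul hN) (β a q h) :
    lcLift (c := c) g hadd hsmul hN (lcMk c x β a q h) = g β a q h := rfl

theorem lcMk_congr {x : X.pt} {β β' : X.Ω.E x} {a a' : A.A.E x} {q q' : ∀ i, (Q i).Q.E x} {h h'}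
    (h1 : β = β') (h2 : a = a') (h3 : ∀ i, q i = q' i) :
    lcMk c x β a q h = lcMk c x β' a' q' h' := by
  obtain rfl := h1
  obtain rfl := h2
  obtain rfl := funext h3
  rfl

theorem lc_sec {σ : ∀ x, (lc c Q).Q.E x} {x : X.pt} : (lc c Q).Q.Sec σ x ↔
    ∃ (β : ∀ x, X.Ω.E x) (a : ∀ x, A.A.E x) (q : ∀ i x, (Q i).Q.E x), X.Ω.Sec β x ∧ A.A.Sec a x ∧
      (∀ i, (Q i).Q.Sec (q i) x) ∧ ∀ᶠ y in 𝓝 x, ∃ h, σ y = lcMk c y (β y) (a y) (fun i => q i y) h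
    :=
  ⟨fun ⟨s, hs, h⟩ => ⟨fun y => (s y).1, fun y => (s y).2.1, fun i y => (s y).2.2 i,
    hs.1, hs.2.1, hs.2.2, h⟩, fun ⟨β, a, q, h1, h2, h3, h4⟩ =>
    ⟨fun y => (β y, a y, fun i => q i y), ⟨h1, h2, h3⟩, h4⟩⟩

theorem lc_isExtension (hQ : ∀ i, (Q i).IsExtension) : (lc c Q).IsExtension where
  injective x := by
    rw [injective_iff_map_eq_zero]
    intro β hβ
    have hβ' := hβ.trans (map_zero ((lc c Q).str x).coanchor).symm
    rw [lcMk_coanchor, lcMk_coanchor] at hβ'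
    obtain ⟨α, h1, -, h2⟩ := lcMk_eq.1 hβ'
    have : ∀ i, α i = 0 := fun i => (hQ i).injective x (by
      have := h2 i
      rw [sub_zero, zero_eq_neg] at this
      rw [this, map_zero])
    simpa [this] using h1
  exact x e he := by
    obtain ⟨β, a, q, h, rfl⟩ := exists_lcMk e
    obtain rfl : a = 0 := he
    choose α hα using fun i => (hQ i).exact x (q i) (h i)
    refine ⟨β + ∑ i, algebraMap k (X.O x) (c i) • α i, ?_⟩
    rw [lcMk_coanchor, lcMk_eq]
    exact ⟨α, by abel, rfl, fun i => by rw [hα]; abel⟩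
  surjective x a := by
    choose q hq using fun i => (hQ i).surjective x a
    exact ⟨lcMk c x 0 a q hq, rfl⟩

section Groupoid

variable {P R : CourantOver A} (ψ : P.Hom R)

theorem Hom.bijective (hP : P.IsExtension) (hR : R.IsExtension) (x : X.pt) :
    Function.Bijective (ψ.φ x) := by
  constructor
  · rw [injective_iff_map_eq_zero]
    intro q hq
    obtain ⟨α, rfl⟩ := hP.exact x q (by rw [← ψ.proj, hq, map_zero])
    rw [ψ.coanchor] at hq
    rw [hR.injective x (hq.trans (map_zero _).symm), map_zero]
  · intro r
    obtain ⟨q, hq⟩ := hP.surjective x (R.proj x r)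
    obtain ⟨α, hα⟩ := hR.exact x (r - ψ.φ x q) (by rw [map_sub, ψ.proj, hq, sub_self])
    exact ⟨q + (P.str x).coanchor α, by rw [map_add, ψ.coanchor, hα]; abel⟩

/-- The inverse of a morphism of Courant extensions. -/
noncomputable def Hom.inv (hP : P.IsExtension) (hR : R.IsExtension) : R.Hom P :=
  let e := fun x => LinearEquiv.ofBijective (ψ.φ x) (ψ.bijective hP hR x)
  have he : ∀ x q, ψ.φ x ((e x).symm q) = q := fun x q => (e x).apply_symm_apply q
  have hi : ∀ x {a b}, ψ.φ x a = ψ.φ x b → a = b := fun x _ _ h => (ψ.bijective hP hR x).1 h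
  { φ := fun x => (e x).symm
    sec := fun {t x} ht => by
      obtain ⟨s, hs, h⟩ := P.Q.etale.exists_sec x ((e x).symm (t x))
      refine P.Q.etale.congr hs ?_
      filter_upwards [R.Q.etale.eq_near (ψ.sec hs) ht (by rw [h, he])] with y hy
      exact hi y (by rw [hy]; exact (he y _).symm)
    br := fun x q q' => hi x (by simp only [LinearEquiv.coe_coe, ψ.br, he])
    anchor := fun x q => by simp only [LinearEquiv.coe_coe, ← ψ.anchor, he]
    pair := fun x q q' => by simp only [LinearEquiv.coe_coe, ← ψ.pair, he]
    coanchor := fun x α => hi x (by simp only [LinearEquiv.coe_coe, ψ.coanchor, he])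
    proj := fun x q => by simp only [LinearEquiv.coe_coe, ← ψ.proj, he] }

theorem Hom.φ_inv (hP : P.IsExtension) (hR : R.IsExtension) (x : X.pt) (q : R.Q.E x) :
    ψ.φ x ((ψ.inv hP hR).φ x q) = q :=
  (LinearEquiv.ofBijective (ψ.φ x) (ψ.bijective hP hR x)).apply_symm_apply q

end Groupoid

section Maps

variable (c) in
/-- `[β, a, (qᵢ)] ↦ [β, a, (fᵢ(qᵢ))]` -/
noncomputable def lcMap₀ {Q' : Fin n → CourantOver A} (f : ∀ i, (Q i).Hom (Q' i)) (x : X.pt) :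
    (lc c Q).Q.E x →ₗ[X.O x] (lc c Q').Q.E x :=
  lcLift (fun β a q h => lcMk c x β a (fun i => (f i).φ x (q i))
        (fun i => by rw [(f i).proj, h]))
      (fun β β' a a' q q' h h' => by
        rw [lcMk_add]
        exact lcMk_congr rfl rfl fun i => map_add _ _ _)
      (fun r β a q h => by
        rw [lcMk_smul]
        exact lcMk_congr rfl rfl fun i => map_smul _ _ _)
      (fun α => by
        refine Eq.trans ?_ (map_zero ((lc c Q').str x).coanchor)
        rw [lcMk_coanchor, lcMk_eq]
        exact ⟨α, by simp, rfl, fun i => by rw [map_neg, (f i).coanchor, sub_zero]⟩)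

theorem lcMap₀_mk {Q' : Fin n → CourantOver A} (f : ∀ i, (Q i).Hom (Q' i)) (x β a q h) :
    lcMap₀ c f x (lcMk c x β a q h) = lcMk c x β a (fun i => (f i).φ x (q i))
        (fun i => by rw [(f i).proj, h]) := rfl

variable (c) in
/-- Functoriality of linear combinations. -/
noncomputable def lcMap {Q' : Fin n → CourantOver A} (f : ∀ i, (Q i).Hom (Q' i)) :
    (lc c Q).Hom (lc c Q') where
  φ := lcMap₀ c f
  sec := fun hq => by
    obtain ⟨β, a, q, h1, h2, h3, h4⟩ := lc_sec.1 hq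
    refine lc_sec.2 ⟨β, a, fun i y => (f i).φ y (q i y), h1, h2,
      fun i => (f i).sec (h3 i), ?_⟩
    filter_upwards [h4] with y h5
    obtain ⟨h5, h6⟩ := h5
    exact ⟨fun i => by rw [(f i).proj, h5], by rw [h6, lcMap₀_mk]⟩
  br := fun x e e' => by
    obtain ⟨β, a, q, h, rfl⟩ := exists_lcMk e
    obtain ⟨β', a', q', h', rfl⟩ := exists_lcMk e'
    rw [lcMk_br, lcMap₀_mk, lcMap₀_mk, lcMap₀_mk, lcMk_br]
    exact lcMk_congr rfl rfl fun i => (f i).br _ _ _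
  anchor := fun x e => by
    obtain ⟨β, a, q, h, rfl⟩ := exists_lcMk e
    rfl
  pair := fun x e e' => by
    obtain ⟨β, a, q, h, rfl⟩ := exists_lcMk e
    obtain ⟨β', a', q', h', rfl⟩ := exists_lcMk e'
    rw [lcMk_pair, lcMap₀_mk, lcMap₀_mk, lcMk_pair]
    simp only [(f _).pair]
  coanchor := fun x α => by
    rw [lcMk_coanchor, lcMk_coanchor, lcMap₀_mk]
    exact lcMk_congr rfl rfl fun i => map_zero _
  proj := fun x e => by
    obtain ⟨β, a, q, h, rfl⟩ := exists_lcMk e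
    rfl

variable (Q) in
/-- `[β, a, (qⱼ)] ↦ qᵢ + π†β` for the weights `cⱼ = δᵢⱼ`. -/
noncomputable def lcUnit₀ (i : Fin n) (hc : c = Pi.single i 1) (x : X.pt) :
    (lc c Q).Q.E x →ₗ[X.O x] (Q i).Q.E x :=
  lcLift (fun β _ q _ => q i + ((Q i).str x).coanchor β)
      (fun β β' a a' q q' h h' => by
        rw [map_add]; exact add_add_add_comm _ _ _ _)
      (fun r β a q h => by rw [map_smul, smul_add])
      (fun α => by
        have : ∑ j, algebraMap k (X.O x) (c j) • α j = α i := by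
          rw [Finset.sum_eq_single i] <;> simp +contextual [hc]
        rw [this, neg_add_cancel])

theorem lcUnit₀_mk (i : Fin n) (hc : c = Pi.single i 1) (x β a q h) :
    lcUnit₀ Q i hc x (lcMk c x β a q h) = q i + ((Q i).str x).coanchor β := rfl

variable (Q) in
/-- The canonical morphism `∑ⱼ δᵢⱼ Qⱼ → Qᵢ`. -/
noncomputable def lcUnit (i : Fin n) (hc : c = Pi.single i 1) : (lc c Q).Hom (Q i) where
  φ := lcUnit₀ Q i hc
  sec := fun {σ x} hq => by
    obtain ⟨β, a, q, h1, h2, h3, h4⟩ := lc_sec.1 hq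
    refine (Q i).Q.etale.congr ((Q i).Q.add (h3 i) ((Q i).coanchor_sec h1)) ?_
    filter_upwards [h4] with y h5
    obtain ⟨h5, h6⟩ := h5
    rw [h6, lcUnit₀_mk]
  br := fun x e e' => by
    obtain ⟨β, a, q, h, rfl⟩ := exists_lcMk e
    obtain ⟨β', a', q', h', rfl⟩ := exists_lcMk e'
    have h1 : (A.str x).anchor a = ((Q i).str x).anchor (q i) := by
      rw [← h i, ((Q i).isOver x).anchor]
    have h2 : (A.str x).anchor a' = ((Q i).str x).anchor (q' i) := by
      rw [← h' i, ((Q i).isOver x).anchor]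
    rw [lcMk_br, lcUnit₀_mk, lcUnit₀_mk, lcUnit₀_mk]
    simp only [map_add, AddMonoidHom.add_apply, CourantStr.br_coanchor, CourantStr.coanchor_br,
      CourantStr.anchor_coanchor, map_zero, AddMonoidHom.zero_apply, h1, h2, map_sub]
    abel
  anchor := fun x e => by
    obtain ⟨β, a, q, h, rfl⟩ := exists_lcMk e
    rw [lcUnit₀_mk, lcMk_anchor, map_add, CourantStr.anchor_coanchor, add_zero, ← h i,
      ((Q i).isOver x).anchor]
  pair := fun x e e' => by
    obtain ⟨β, a, q, h, rfl⟩ := exists_lcMk e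
    obtain ⟨β', a', q', h', rfl⟩ := exists_lcMk e'
    have h1 : (A.str x).anchor a = ((Q i).str x).anchor (q i) := by
      rw [← h i, ((Q i).isOver x).anchor]
    have h2 : (A.str x).anchor a' = ((Q i).str x).anchor (q' i) := by
      rw [← h' i, ((Q i).isOver x).anchor]
    rw [lcMk_pair, lcUnit₀_mk, lcUnit₀_mk, Finset.sum_eq_single i (by simp +contextual [hc])
      (by simp)]
    simp only [map_add, LinearMap.add_apply, CourantStr.pair_coanchor,
      CourantStr.anchor_coanchor, map_zero, LinearMap.zero_apply, h1, h2, hc,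
      Pi.single_eq_same, map_one, one_mul,
      ((Q i).str x).pair_symm (((Q i).str x).coanchor β)]
    ring
  coanchor := fun x α => by
    rw [lcMk_coanchor, lcUnit₀_mk, zero_add]
  proj := fun x e => by
    obtain ⟨β, a, q, h, rfl⟩ := exists_lcMk e
    rw [lcUnit₀_mk, map_add, ((Q i).isOver x).coanchor, add_zero, h i, lcMk_proj]

variable {m : ℕ} {b : Fin m → k} {M : Fin m → Fin n → k}

variable (Q) in
/-- `[β, a, (qᵢ)] ↦ [β, a, ([0, a, (qᵢ)])ⱼ]` -/
noncomputable def lcAssoc₀ (hc : ∀ i, c i = ∑ j, b j * M j i) (x : X.pt) :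
    (lc c Q).Q.E x →ₗ[X.O x] (lc b (fun j => lc (M j) Q)).Q.E x :=
  lcLift (fun β a q h => lcMk b x β a (fun j => lcMk (M j) x 0 a q h)
        (fun j => lcMk_proj _ _ _ _))
      (fun β β' a a' q q' h h' => by
        rw [lcMk_add]
        refine lcMk_congr rfl rfl fun j => ?_
        rw [lcMk_add]
        exact lcMk_congr (add_zero 0).symm rfl fun i => rfl)
      (fun r β a q h => by
        rw [lcMk_smul]
        refine lcMk_congr rfl rfl fun j => ?_
        rw [lcMk_smul]
        exact lcMk_congr (smul_zero r).symm rfl fun i => rfl)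
      (fun α => by
        refine Eq.trans ?_ (map_zero ((lc b fun j => lc (M j) Q).str x).coanchor)
        rw [lcMk_coanchor, lcMk_eq]
        refine ⟨fun j => ∑ i, algebraMap k (X.O x) (M j i) • α i, ?_, rfl, fun j => ?_⟩
        · simp only [hc, map_sum, map_mul, Finset.sum_smul, Finset.smul_sum, mul_smul, sub_zero]
          exact Finset.sum_comm
        · rw [sub_zero, ← map_neg, lcMk_coanchor]
          refine lcMk_eq.2 ⟨α, ?_, rfl, fun i => ?_⟩
          · simp
          · simp)

theorem lcAssoc₀_mk (hc : ∀ i, c i = ∑ j, b j * M j i) (x β a q h) :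
    lcAssoc₀ Q hc x (lcMk c x β a q h) =
      lcMk b x β a (fun j => lcMk (M j) x 0 a q h) (fun _ => lcMk_proj _ _ _ _) := rfl

variable (Q) in
/-- The canonical morphism `∑ᵢ (∑ⱼ bⱼ Mⱼᵢ) Qᵢ → ∑ⱼ bⱼ (∑ᵢ Mⱼᵢ Qᵢ)`. -/
noncomputable def lcAssoc (hc : ∀ i, c i = ∑ j, b j * M j i) :
    (lc c Q).Hom (lc b (fun j => lc (M j) Q)) where
  φ := lcAssoc₀ Q hc
  sec := fun {σ x} hq => by
    obtain ⟨β, a, q, h1, h2, h3, h4⟩ := lc_sec.1 hq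
    classical
    have h7 : ∀ j, ∃ s, (lc (M j) Q).Q.Sec s x ∧ ∀ᶠ y in 𝓝 x, ∃ h,
        s y = lcMk (M j) y 0 (a y) (fun i => q i y) h := fun j =>
      ⟨fun y => if h : ∀ i, (Q i).proj y (q i y) = a y then
          lcMk (M j) y 0 (a y) (fun i => q i y) h else 0,
        lc_sec.2 ⟨fun _ => 0, a, q, X.Ω.zero x, h2, h3, h4.mono fun y hy =>
          ⟨hy.choose, dif_pos hy.choose⟩⟩, h4.mono fun y hy => ⟨hy.choose, dif_pos hy.choose⟩⟩
    choose s hs hs' using h7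
    refine lc_sec.2 ⟨β, a, s, h1, h2, hs, ?_⟩
    filter_upwards [h4, eventually_all.2 hs'] with y h5 h8
    obtain ⟨h5, h6⟩ := h5
    have h9 : ∀ j, s j y = lcMk (M j) y 0 (a y) (fun i => q i y) h5 :=
      fun j => (h8 j).choose_spec
    refine ⟨fun j => by rw [h9 j, lcMk_proj], ?_⟩
    rw [h6, lcAssoc₀_mk]
    exact lcMk_congr rfl rfl fun j => (h9 j).symm
  br := fun x e e' => by
    obtain ⟨β, a, q, h, rfl⟩ := exists_lcMk e
    obtain ⟨β', a', q', h', rfl⟩ := exists_lcMk e'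
    rw [lcMk_br, lcAssoc₀_mk, lcAssoc₀_mk, lcAssoc₀_mk, lcMk_br]
    refine lcMk_congr rfl rfl fun j => ?_
    rw [lcMk_br]
    exact lcMk_congr (by simp) rfl fun i => rfl
  anchor := fun x e => by
    obtain ⟨β, a, q, h, rfl⟩ := exists_lcMk e
    rfl
  pair := fun x e e' => by
    obtain ⟨β, a, q, h, rfl⟩ := exists_lcMk e
    obtain ⟨β', a', q', h', rfl⟩ := exists_lcMk e'
    rw [lcAssoc₀_mk, lcAssoc₀_mk, lcMk_pair, lcMk_pair]
    congr 1
    simp only [lcMk_pair, map_zero, zero_add, hc, map_sum, map_mul, Finset.sum_mul,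
      Finset.mul_sum, mul_assoc]
    exact Finset.sum_comm
  coanchor := fun x α => by
    rw [lcMk_coanchor, lcAssoc₀_mk, lcMk_coanchor]
    refine lcMk_congr rfl rfl fun j => ?_
    exact map_zero ((lc (M j) Q).str x).coanchor
  proj := fun x e => by
    obtain ⟨β, a, q, h, rfl⟩ := exists_lcMk e
    rfl

end Maps
end CourantOver

namespace CExt
open CourantOver

theorem hom_ext {P Q : CExt A} {f g : P ⟶ Q} (h : ∀ x q, f.hom.φ x q = g.hom.φ x q) : f = g :=
  ObjectProperty.hom_ext _ (CourantOver.hom_ext h)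

/-- Every morphism of Courant extensions is an isomorphism. -/
noncomputable def isoOf {P Q : CExt A} (f : P ⟶ Q) : P ≅ Q where
  hom := f
  inv := ObjectProperty.homMk (f.hom.inv P.property Q.property)
  hom_inv_id := hom_ext fun x q => (f.hom.bijective P.property Q.property x).1
    (f.hom.φ_inv P.property Q.property x _)
  inv_hom_id := hom_ext fun x q => f.hom.φ_inv P.property Q.property x q

@[simp] theorem isoOf_hom {P Q : CExt A} (f : P ⟶ Q) : (isoOf f).hom = f := rfl

/-- The linear combination of Courant extensions. -/
noncomputable abbrev lc {n : ℕ} (c : Fin n → k) (Q : Fin n → CExt A) : CExt A :=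
  ⟨CourantOver.lc c fun i => (Q i).obj, lc_isExtension fun i => (Q i).property⟩

end CExt
end LinCombSheaf

section LinearCategories
open CategoryTheory
universe v w v' w'

/-- A `k`-module (for a field `k`: a `k`-vector space) in categories: a groupoid with linear
combinations `∑ cᵢ xᵢ` of finite families of objects, which are functorial, together with coherent
natural isomorphisms `∑ⱼ δᵢⱼ xⱼ ≅ xᵢ` and `∑ᵢ (∑ⱼ bⱼ Mⱼᵢ) xᵢ ≅ ∑ⱼ bⱼ (∑ᵢ Mⱼᵢ xᵢ)`. -/
class LinCat (k : Type) [CommRing k] (C : Type v) [Category.{w} C] where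
  isIso : ∀ {x y : C} (f : x ⟶ y), IsIso f
  lc {n : ℕ} (c : Fin n → k) (x : Fin n → C) : C
  map {n : ℕ} (c : Fin n → k) {x y : Fin n → C} (f : ∀ i, x i ⟶ y i) : lc c x ⟶ lc c y
  map_id {n : ℕ} (c : Fin n → k) (x : Fin n → C) : map c (fun i => 𝟙 (x i)) = 𝟙 (lc c x)
  map_comp {n : ℕ} (c : Fin n → k) {x y z : Fin n → C} (f : ∀ i, x i ⟶ y i)
    (g : ∀ i, y i ⟶ z i) : map c (fun i => f i ≫ g i) = map c f ≫ map c g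
  unit {n : ℕ} (i : Fin n) {c : Fin n → k} (hc : c = Pi.single i 1) (x : Fin n → C) : lc c x ≅ x i
  unit_nat {n : ℕ} (i : Fin n) {c : Fin n → k} (hc : c = Pi.single i 1) {x y : Fin n → C}
    (f : ∀ i, x i ⟶ y i) : map c f ≫ (unit i hc y).hom = (unit i hc x).hom ≫ f i
  assoc {m n : ℕ} {b : Fin m → k} {M : Fin m → Fin n → k} {c : Fin n → k}
    (hc : ∀ i, c i = ∑ j, b j * M j i) (x : Fin n → C) : lc c x ≅ lc b (fun j => lc (M j) x)
  assoc_nat {m n : ℕ} {b : Fin m → k} {M : Fin m → Fin n → k} {c : Fin n → k}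
    (hc : ∀ i, c i = ∑ j, b j * M j i) {x y : Fin n → C} (f : ∀ i, x i ⟶ y i) :
    map c f ≫ (assoc hc y).hom = (assoc hc x).hom ≫ map b (fun j => map (M j) f)
  unit_left {m n : ℕ} (j : Fin m) {b : Fin m → k} (hb : b = Pi.single j 1)
    (M : Fin m → Fin n → k) (hc : ∀ i, M j i = ∑ j', b j' * M j' i) (x : Fin n → C) :
    (assoc hc x).hom ≫ (unit j hb _).hom = 𝟙 (lc (M j) x)
  unit_right {n : ℕ} (c : Fin n → k) {M : Fin n → Fin n → k} (hM : ∀ i, M i = Pi.single i 1)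
    (hc : ∀ i, c i = ∑ j, c j * M j i) (x : Fin n → C) :
    (assoc hc x).hom ≫ map c (fun i => (unit i (hM i) x).hom) = 𝟙 (lc c x)
  assoc_assoc {l m n : ℕ} {a : Fin l → k} {M : Fin l → Fin m → k} {N : Fin m → Fin n → k}
    {b : Fin m → k} {c : Fin n → k} {P : Fin l → Fin n → k} (hb : ∀ j, b j = ∑ s, a s * M s j)
    (hc : ∀ i, c i = ∑ j, b j * N j i) (hP : ∀ s i, P s i = ∑ j, M s j * N j i)
    (hc' : ∀ i, c i = ∑ s, a s * P s i) (x : Fin n → C) :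
    (assoc hc x).hom ≫ (assoc hb (fun j => lc (N j) x)).hom =
      (assoc hc' x).hom ≫ map a (fun s => (assoc (hP s) x).hom)

/-- A morphism of `k`-modules in categories: a functor with natural isomorphisms
`F(∑ cᵢ xᵢ) ≅ ∑ cᵢ F(xᵢ)` which are compatible with the structure isomorphisms. -/
structure LinFunctor (k : Type) [CommRing k] {C : Type v} [Category.{w} C] {D : Type v'}
    [Category.{w'} D] (LC : LinCat k C) (LD : LinCat k D) (F : C ⥤ D) where
  iso {n : ℕ} (c : Fin n → k) (x : Fin n → C) :
    F.obj (LC.lc c x) ≅ LD.lc c (fun i => F.obj (x i))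
  nat {n : ℕ} (c : Fin n → k) {x y : Fin n → C} (f : ∀ i, x i ⟶ y i) :
    F.map (LC.map c f) ≫ (iso c y).hom = (iso c x).hom ≫ LD.map c (fun i => F.map (f i))
  unit {n : ℕ} (i : Fin n) {c : Fin n → k} (hc : c = Pi.single i 1) (x : Fin n → C) :
    (iso c x).hom ≫ (LD.unit i hc (fun i => F.obj (x i))).hom = F.map (LC.unit i hc x).hom
  assoc {m n : ℕ} {b : Fin m → k} {M : Fin m → Fin n → k} {c : Fin n → k}
    (hc : ∀ i, c i = ∑ j, b j * M j i) (x : Fin n → C) :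
    F.map (LC.assoc hc x).hom ≫ (iso b (fun j => LC.lc (M j) x)).hom ≫
        LD.map b (fun j => (iso (M j) x).hom) =
      (iso c x).hom ≫ (LD.assoc hc (fun i => F.obj (x i))).hom

/-- Restriction of the coefficients of linear combinations. -/
@[reducible] def LinCat.restrict {k k' : Type} [CommRing k] [CommRing k'] (φ : k' →+* k)
    {C : Type v} [Category.{w} C] (L : LinCat k C) : LinCat k' C where
  isIso := L.isIso
  lc c x := L.lc (fun i => φ (c i)) x
  map := fun {_} c {_ _} f => L.map (fun i => φ (c i)) f
  map_id := fun {_} c x => L.map_id _ x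
  map_comp := fun {_} c {_ _ _} f g => L.map_comp _ f g
  unit := fun {_} i {_} hc x => L.unit i (by
    subst hc
    funext j
    by_cases h : j = i
    · subst h
      simp
    · simp [Pi.single_apply, h]) x
  unit_nat := fun {_} i {_} hc {_ _} f => L.unit_nat i _ f
  assoc := fun {_ _ _ M _} hc x => L.assoc (M := fun j i => φ (M j i)) (fun i => by simp [hc]) x
  assoc_nat := fun {_ _ _ _ _} hc {_ _} f => L.assoc_nat _ f
  unit_left := fun {_ _} j {_} hb M hc x => L.unit_left j _ (fun j i => φ (M j i)) _ x
  unit_right := fun {_} c {_} hM hc x => L.unit_right (fun i => φ (c i)) _ _ x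
  assoc_assoc := fun {_ _ _ _ _ _ _ _ _} hb hc hP hc' x => L.assoc_assoc _ _ _ _ x

/-- The underlying Picard groupoid of a `k`-vector space in categories: (strictly commutative)
Picard groupoids are the `ℤ`-modules in categories. -/
abbrev LinCat.picard {k : Type} [CommRing k] {C : Type v} [Category.{w} C] (L : LinCat k C) :
    LinCat ℤ C := L.restrict (Int.castRingHom k)

end LinearCategories

section CExtLin
open CategoryTheory CourantOver
variable {k : Type} [Field k] {X Y : RSpace.{u} k}

/-- The category of Courant extensions of `A` as a `k`-vector space in categories. -/
noncomputable instance CExt.linCat (A : LieAlgd X) : LinCat k (CExt A) where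
  isIso f := (CExt.isoOf f).isIso_hom
  lc := CExt.lc
  map := fun {_} c {_ _} f => ObjectProperty.homMk (lcMap c fun i => (f i).hom)
  map_id := fun {_} c x => CExt.hom_ext fun x e => by
    obtain ⟨β, a, q, h, rfl⟩ := exists_lcMk e
    rfl
  map_comp := fun {_} c {_ _ _} f g => CExt.hom_ext fun x e => by
    obtain ⟨β, a, q, h, rfl⟩ := exists_lcMk e
    rfl
  unit := fun {_} i {_} hc x => CExt.isoOf (ObjectProperty.homMk (lcUnit (fun i => (x i).obj) i hc))
  unit_nat := fun {_} i {_} hc {_ _} f => CExt.hom_ext fun x e => by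
    obtain ⟨β, a, q, h, rfl⟩ := exists_lcMk e
    change (f i).hom.φ x (q i) + _ = (f i).hom.φ x (q i + _)
    rw [map_add, (f i).hom.coanchor]
  assoc := fun {_ _ _ _ _} hc x => CExt.isoOf (ObjectProperty.homMk (lcAssoc (fun i => (x i).obj) hc))
  assoc_nat := fun {_ _ _ _ _} hc {_ _} f => CExt.hom_ext fun x e => by
    obtain ⟨β, a, q, h, rfl⟩ := exists_lcMk e
    rfl
  unit_left := fun {_ _} j {_} hb M hc Q => CExt.hom_ext fun x e => by
    obtain ⟨β, a, q, h, rfl⟩ := exists_lcMk e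
    change lcMk (M j) x 0 a q h + lcMk (M j) x β 0 (fun _ => 0) (fun _ => map_zero _) =
      lcMk (M j) x β a q h
    rw [lcMk_add]
    exact lcMk_congr (zero_add _) (add_zero _) fun i => add_zero _
  unit_right := fun {_} c {M} hM hc Q => CExt.hom_ext fun x e => by
    obtain ⟨β, a, q, h, rfl⟩ := exists_lcMk e
    refine lcMk_congr rfl rfl fun i => ?_
    change q i + ((Q i).obj.str x).coanchor 0 = q i
    rw [map_zero, add_zero]
  assoc_assoc := fun {_ _ _ _ _ _ _ _ _} hb hc hP hc' Q => CExt.hom_ext fun x e => by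
    obtain ⟨β, a, q, h, rfl⟩ := exists_lcMk e
    rfl

/-- The inverse image functor on Courant extensions, provided that `f⁺⁺` preserves extensions. -/
noncomputable def CExt.pull (F : SpMap Y X) (A : LieAlgd X)
    (h : ∀ Q : CourantOver A, Q.IsExtension → (Q.pull F).IsExtension) :
    CExt A ⥤ CExt (A.pull F) :=
  ObjectProperty.lift _ (ObjectProperty.ι _ ⋙ CourantOver.pullFunctor F A)
    (fun Q => h Q.obj Q.property)

end CExtLin

section Manifolds
variable {K 𝕜 : Type} [RCLike K] [RCLike 𝕜] [NormedAlgebra K 𝕜]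
  {E : Type*} [NormedAddCommGroup E] [NormedSpace K E]
  {E' : Type*} [NormedAddCommGroup E'] [NormedSpace K E']
  (n : WithTop ℕ∞)

variable (K 𝕜 E) in
/-- The function `h` is of class `C^n` in a neighbourhood of `x`. -/
def SmoothNear {X : Type u} [TopologicalSpace X] [ChartedSpace E X] (h : X → 𝕜) (x : X) : Prop :=
  ∀ᶠ x' in 𝓝 x, ContMDiffAt 𝓘(K, E) 𝓘(K, 𝕜) n h x'

variable {X : Type u} [TopologicalSpace X] [ChartedSpace E X]
  {Y : Type u} [TopologicalSpace Y] [ChartedSpace E' Y]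

variable {n} in
theorem SmoothNear.add {g h : X → 𝕜} {x : X} (hg : SmoothNear K 𝕜 E n g x)
    (hh : SmoothNear K 𝕜 E n h x) : SmoothNear K 𝕜 E n (g + h) x := by
  filter_upwards [hg, hh] with y h1 h2
  exact h1.add h2

variable {n} in
theorem SmoothNear.mul {g h : X → 𝕜} {x : X} (hg : SmoothNear K 𝕜 E n g x)
    (hh : SmoothNear K 𝕜 E n h x) : SmoothNear K 𝕜 E n (g * h) x := by
  filter_upwards [hg, hh] with y h1 h2
  exact ((contDiff_mul (𝕜 := K) (𝔸 := 𝕜) (n := n)).contMDiff.contMDiffAt).comp y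
    (h1.prodMk_space h2)

variable (X) in
theorem SmoothNear.const (c : 𝕜) (x : X) : SmoothNear K 𝕜 E n (fun _ => c) x :=
  Eventually.of_forall fun _ => contMDiffAt_const

variable {n} in
theorem SmoothNear.congr {g h : X → 𝕜} {x : X} (hg : SmoothNear K 𝕜 E n g x)
    (hh : g =ᶠ[𝓝 x] h) : SmoothNear K 𝕜 E n h x := by
  filter_upwards [hg, hh.eventuallyEq_nhds] with y h1 h2
  exact h1.congr_of_eventuallyEq h2.symm

variable {n} in
theorem SmoothNear.comp {f : Y → X} (hf : ContMDiff 𝓘(K, E') 𝓘(K, E) n f) {h : X → 𝕜} {y : Y}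
    (hh : SmoothNear K 𝕜 E n h (f y)) : SmoothNear K 𝕜 E' n (h ∘ f) y := by
  filter_upwards [hf.continuous.continuousAt.eventually hh] with y' h1
  exact h1.comp y' (hf y')

variable (K 𝕜 E) in
/-- The ring of germs at `x` of `𝕜`-valued functions of class `C^n`. -/
def smoothGerms {X : Type u} [TopologicalSpace X] [ChartedSpace E X] (x : X) :
    Subring (Germ (𝓝 x) 𝕜) where
  carrier := {g | ∃ h : X → 𝕜, SmoothNear K 𝕜 E n h x ∧ g = (h : Germ (𝓝 x) 𝕜)}
  mul_mem' := by
    rintro _ _ ⟨g, hg, rfl⟩ ⟨h, hh, rfl⟩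
    exact ⟨g * h, hg.mul hh, rfl⟩
  one_mem' := ⟨fun _ => 1, SmoothNear.const n X 1 x, rfl⟩
  add_mem' := by
    rintro _ _ ⟨g, hg, rfl⟩ ⟨h, hh, rfl⟩
    exact ⟨g + h, hg.add hh, rfl⟩
  zero_mem' := ⟨fun _ => 0, SmoothNear.const n X 0 x, rfl⟩
  neg_mem' := by
    rintro _ ⟨g, hg, rfl⟩
    refine ⟨(fun _ => -1) * g, (SmoothNear.const n X (-1) x).mul hg, ?_⟩
    refine congrArg _ (funext fun y => ?_)
    simp

/-- Germs of constant functions. -/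
def smoothGerms.const (x : X) : 𝕜 →+* smoothGerms K 𝕜 E n x where
  toFun c := ⟨((fun _ => c : X → 𝕜) : Germ (𝓝 x) 𝕜), _, SmoothNear.const n X c x, rfl⟩
  map_one' := rfl
  map_mul' _ _ := rfl
  map_zero' := rfl
  map_add' _ _ := rfl

variable (K 𝕜 E X) in
/-- A manifold of class `C^n` with the sheaf of `𝕜`-valued functions of class `C^n`. -/
abbrev manifoldSpace : RSpace.{u} 𝕜 where
  pt := X
  O x := smoothGerms K 𝕜 E n x
  alg x := (smoothGerms.const n x).toAlgebra
  Sec s x := ∃ h : X → 𝕜, SmoothNear K 𝕜 E n h x ∧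
    ∀ᶠ x' in 𝓝 x, (s x' : Germ (𝓝 x') 𝕜) = (h : Germ (𝓝 x') 𝕜)
  etale :=
    { near := fun ⟨h, h1, h2⟩ => by
        filter_upwards [eventually_eventually_nhds.2 h1, eventually_eventually_nhds.2 h2]
          with x' h3 h4
        exact ⟨h, h3, h4⟩
      congr := fun ⟨h, h1, h2⟩ h3 => ⟨h, h1, by
        filter_upwards [h2, h3] with x' h4 h5
        rw [← h5, h4]⟩
      exists_sec := fun x e => by
        obtain ⟨_, h, hh, rfl⟩ := e
        classical
        refine ⟨fun x' => if hx : SmoothNear K 𝕜 E n h x' then ⟨_, h, hx, rfl⟩ else 0,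
          ⟨h, hh, ?_⟩, dif_pos hh⟩
        filter_upwards [eventually_eventually_nhds.2 hh] with x' hx
        rw [dif_pos (show SmoothNear K 𝕜 E n h x' from hx)]
      eq_near := fun {s t x} ⟨h, h1, h2⟩ ⟨g, g1, g2⟩ he => by
        have : h =ᶠ[𝓝 x] g := by
          refine Germ.coe_eq.1 ?_
          rw [← h2.self_of_nhds, ← g2.self_of_nhds, he]
        filter_upwards [h2, g2, this.eventuallyEq_nhds] with x' h3 h4 h5
        refine Subtype.ext ?_
        rw [h3, h4]
        exact Germ.coe_eq.2 h5 }
  add := fun ⟨h, h1, h2⟩ ⟨g, g1, g2⟩ => ⟨h + g, h1.add g1, by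
    filter_upwards [h2, g2] with x' h3 h4
    rw [Germ.coe_add, ← h3, ← h4]
    rfl⟩
  mul := fun ⟨h, h1, h2⟩ ⟨g, g1, g2⟩ => ⟨h * g, h1.mul g1, by
    filter_upwards [h2, g2] with x' h3 h4
    rw [Germ.coe_mul, ← h3, ← h4]
    rfl⟩
  const c x := ⟨fun _ => c, SmoothNear.const n X c x, Eventually.of_forall fun _ => rfl⟩

variable {n} in
variable (𝕜) in
/-- A map of class `C^n`, with the composition of functions with it. -/
def manifoldMap {f : Y → X} (hf : ContMDiff 𝓘(K, E') 𝓘(K, E) n f) :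
    SpMap (manifoldSpace K 𝕜 E' n Y) (manifoldSpace K 𝕜 E n X) where
  f := f
  cont := hf.continuous
  φ y :=
    { toFun := fun g => ⟨g.1.compTendsto f hf.continuous.continuousAt, by
        obtain ⟨_, h, hh, rfl⟩ := g
        exact ⟨h ∘ f, hh.comp hf, rfl⟩⟩
      map_one' := rfl
      map_mul' := by
        rintro ⟨_, g, hg, rfl⟩ ⟨_, h, hh, rfl⟩
        rfl
      map_zero' := rfl
      map_add' := by
        rintro ⟨_, g, hg, rfl⟩ ⟨_, h, hh, rfl⟩
        rfl }
  const y c := rfl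
  sec := fun {g y} ⟨h, h1, h2⟩ => ⟨h ∘ f, h1.comp hf, by
    filter_upwards [hf.continuous.continuousAt.eventually h2] with y' h3
    change (g (f y')).1.compTendsto f hf.continuous.continuousAt = _
    rw [h3]
    rfl⟩

end Manifolds

section Statement
variable {k : Type} [Field k] {X Y : RSpace.{u} k}

/-- A sheaf of modules which is locally free of finite rank. -/
def MSheaf.LocallyFree (M : MSheaf X) : Prop :=
  ∀ x, ∃ (r : ℕ) (e : Fin r → ∀ y, M.E y), (∀ i, M.Sec (e i) x) ∧ ∀ᶠ y in 𝓝 x,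
    LinearIndependent (X.O y) (fun i => e i y) ∧
      Submodule.span (X.O y) (Set.range fun i => e i y) = ⊤

variable (F : SpMap Y X)

/-- The class of `(t, ξ)` in `f⁺A`. -/
noncomputable def LieAlgd.pullMk (A : LieAlgd X) (y : Y.pt) (t : Y.O y ⊗[ℤ] A.A.E (F.f y))
    (ξ : Y.T.E y) (h : (t, ξ) ∈ MSheaf.interior (A.pullK F) y) : (A.pull F).A.E y :=
  Submodule.mkQ _ ⟨(t, ξ), h⟩

/-- The class of `(α, t, ξ)` in `f⁺⁺Q`. -/
noncomputable def CourantOver.pullMk {A : LieAlgd X} (Q : CourantOver A) (y : Y.pt) (α : Y.Ω.E y)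
    (t : Y.O y ⊗[ℤ] Q.Q.E (F.f y)) (ξ : Y.T.E y)
    (h : (α, t, ξ) ∈ MSheaf.interior (Q.pullK F) y) : (Q.pull F).Q.E y :=
  Submodule.mkQ _ ⟨(α, t, ξ), h⟩

open CategoryTheory CourantOver in
/-- The isomorphisms `f⁺⁺(∑ cᵢ Qᵢ) ≅ ∑ cᵢ f⁺⁺Qᵢ` of `Φ` are the canonical ones, which carry the
class of `(∑ₛ hₛ ⊗ [0, aₛ, (qₛᵢ)ᵢ], ξ)` to the class `[0, (∑ₛ hₛ ⊗ aₛ, ξ), (∑ₛ hₛ ⊗ qₛᵢ, ξ)ᵢ]`. -/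
def IsCanonical {A : LieAlgd X}
    {h : ∀ Q : CourantOver A, Q.IsExtension → (Q.pull F).IsExtension}
    (Φ : LinFunctor k (CExt.linCat A) (CExt.linCat (A.pull F)) (CExt.pull F A h)) : Prop :=
  ∀ {n : ℕ} (c : Fin n → k) (Q : Fin n → CExt A) (y : Y.pt) {m : ℕ} (h : Fin m → Y.O y)
    (a : Fin m → A.A.E (F.f y)) (q : Fin m → ∀ i, (Q i).obj.Q.E (F.f y))
    (hq : ∀ s i, (Q i).obj.proj (F.f y) (q s i) = a s) (ξ : Y.T.E y)
    (h₀ : (0, ∑ s, h s ⊗ₜ lcMk c (F.f y) 0 (a s) (q s) (hq s), ξ) ∈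
      MSheaf.interior ((lc c fun i => (Q i).obj).pullK F) y)
    (h₁ : (∑ s, h s ⊗ₜ a s, ξ) ∈ MSheaf.interior (A.pullK F) y)
    (h₂ : ∀ i, (0, ∑ s, h s ⊗ₜ q s i, ξ) ∈ MSheaf.interior ((Q i).obj.pullK F) y),
    ∃ hp, (Φ.iso c Q).hom.hom.φ y
        ((lc c fun i => (Q i).obj).pullMk F y 0 (∑ s, h s ⊗ₜ lcMk c (F.f y) 0 (a s) (q s) (hq s))
          ξ h₀) =
      lcMk (Q := fun i => (Q i).obj.pull F) c y 0 (A.pullMk F y (∑ s, h s ⊗ₜ a s) ξ h₁)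
        (fun i => (Q i).obj.pullMk F y 0 (∑ s, h s ⊗ₜ q s i) ξ (h₂ i)) hp

end Statement

/-!
The inverse image `f⁺⁺Q` is the quotient of the triples `(α, t, ξ)`, `t ∈ O_Y ⊗_ℤ Q`, whose last two
components have the same image in `f^* T_X`, by relations which make `t` bilinear over `O_X` and
which identify `1 ⊗ π†(dg)` with `d(f^* g)`.

*One-forms.* Everything rests on the existence of `f^* : Ω_X → Ω_Y` on stalks and on the fact that
`Ω_X` is generated by differentials (`SpMap.PullsForms`). Both follow from coordinates `uⱼ` with
partial derivatives `∂ⱼ`: the chain rule `ξ(f^* g) = ∑ⱼ f^*(∂ⱼ g) ξ(f^* uⱼ)` holds for every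
derivation `ξ`, since by first order Taylor expansion at each point both sides have the same values
(`RSpace.Values.Coordinates.chain_rule`). On manifolds the expansions come from Hadamard's lemma
(`exists_eq_add_clm_apply`), proved by integration along segments in the smooth case and by shifting
power series in the analytic case.

*Exactness.* As `A` is locally free, an extension `Q` has a linear retraction `r : Q → Ω_X` of the
co-anchor on each stalk. The functional `(α, ∑ hᵢ ⊗ qᵢ, ξ) ↦ α + ∑ hᵢ f^* r(qᵢ)` vanishes on the
relations, so that the co-anchor of `f⁺⁺Q` is injective; exactness in the middle is right exactness
of the tensor product (`CourantOver.pull_isExtension`).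

*Linear combinations.* Both `f⁺⁺(∑ cᵢ Qᵢ)` and `∑ cᵢ f⁺⁺Qᵢ` receive a map from the triples `(α, τ,
ξ)` with `τ ∈ O_Y ⊗ (Q₁ ×_A ⋯ ×_A Qₙ)` (`CourantOver.fibL`, `CourantOver.fibR`). The first one is
onto, and its kernel is contained in that of the second one, again by means of the retractions
(`CourantOver.fibR_eq_zero`). This defines the canonical map (`CourantOver.canon`). It is
compatible with all structures because they are given by the same formulas on triples, and it is
invertible because every morphism of extensions is. Naturality and the coherence conditions are
likewise checked on triples.
-/

/-! ### Inverse images of Courant extensions on stalks -/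

section StalkExact

variable {k : Type} {R T Ω S U Θ : Type u} [Field k] [CommRing R] [Algebra k R]
  [AddCommGroup T] [Module R T] [AddCommGroup Ω] [Module R Ω]
  [CommRing S] [Algebra k S] [AddCommGroup U] [Module S U] [AddCommGroup Θ] [Module S Θ]
  {𝒞 : Cartan k R T Ω} {𝒟 : Cartan k S U Θ} {φ : R →+* S}
  {Q A : Type u} [AddCommGroup Q] [Module R Q] [AddCommGroup A] [Module R A]
  {SQ : CourantStr 𝒞 Q}

/-- `φ^* : Ω → Θ` is a pull-back of one-forms along `φ`: it is `φ`-semilinear and commutes with the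
differentials of functions. -/
structure IsFormPull (𝒞 : Cartan k R T Ω) (𝒟 : Cartan k S U Θ) (φ : R →+* S) (fs : Ω →+ Θ) :
    Prop where
  smul : ∀ (g : R) (α : Ω), fs (g • α) = φ g • fs α
  d : ∀ g : R, fs (𝒞.d g) = 𝒟.d (φ g)

/-- A linear retraction `r` of the co-anchor defines a linear functional `α + ∑ hᵢ φ^*(r(qᵢ))` of
`(α, ∑ hᵢ ⊗ qᵢ, ξ)` which vanishes on the relations and restricts to the identity on one-forms;
this is what makes the co-anchor of the inverse image injective. -/
theorem add_sext_retraction_eq_zero {fs : Ω →+ Θ} (hfs : IsFormPull 𝒞 𝒟 φ fs) (r : Q →ₗ[R] Ω)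
    (hr : ∀ α, r (SQ.coanchor α) = α) {n : Θ × (S ⊗[ℤ] Q) × U} (hn : n ∈ pullN Θ U 𝒟 φ SQ) :
    n.1 + sext (fs.comp r.toAddMonoidHom) n.2.1 = 0 := by
  induction hn using Submodule.span_induction with
  | zero => simp
  | add x y _ _ hx hy =>
    rw [Prod.fst_add, Prod.snd_add, Prod.fst_add, map_add, add_add_add_comm, hx, hy, add_zero]
  | smul f x _ hx =>
    rw [Prod.smul_fst, Prod.smul_snd, Prod.smul_fst, map_smul, ← smul_add, hx, smul_zero]
  | mem x hx =>
    rcases hx with ⟨g, q, rfl⟩ | ⟨f, rfl⟩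
    · simp [hfs.smul]
    · simp [hr, hfs.d]

/-- The relations divided out identify all pulled back forms `φ^*(α)` with `1 ⊗ π†(α)`, not only
the exact ones. -/
theorem formPull_coanchor_mem_pullN (hd : Submodule.span R (Set.range 𝒞.d) = ⊤) {fs : Ω →+ Θ}
    (hfs : IsFormPull 𝒞 𝒟 φ fs) (α : Ω) :
    ((fs α, - ((1 : S) ⊗ₜ[ℤ] SQ.coanchor α), 0) : Θ × (S ⊗[ℤ] Q) × U) ∈ pullN Θ U 𝒟 φ SQ := by
  have hα : α ∈ Submodule.span R (Set.range 𝒞.d) := hd ▸ Submodule.mem_top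
  induction hα using Submodule.span_induction with
  | zero =>
    convert (pullN Θ U 𝒟 φ SQ).zero_mem using 1
    refine Prod.ext ?_ (Prod.ext ?_ ?_) <;> simp
  | add x y _ _ hx hy =>
    convert Submodule.add_mem _ hx hy using 1
    refine Prod.ext (map_add _ _ _) (Prod.ext ?_ (add_zero _).symm)
    simp only [map_add, TensorProduct.tmul_add, neg_add, Prod.snd_add, Prod.fst_add]
  | smul f x _ hx =>
    convert Submodule.add_mem _ (Submodule.smul_mem _ (φ f) hx)
      (genQ_mem 𝒟 SQ f (SQ.coanchor x)) using 1
    refine Prod.ext ?_ (Prod.ext ?_ (by simp))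
    · simp [hfs.smul]
    · simp only [map_smul, Prod.smul_mk, Prod.mk_add_mk, smul_neg, TensorProduct.smul_tmul',
        smul_eq_mul, mul_one]
      abel
  | mem x hx =>
    obtain ⟨g, rfl⟩ := hx
    rw [hfs.d]
    exact genD_mem 𝒟 SQ g

theorem sext_coanchor_mem_pullN (hd : Submodule.span R (Set.range 𝒞.d) = ⊤) {fs : Ω →+ Θ}
    (hfs : IsFormPull 𝒞 𝒟 φ fs) (ω : S ⊗[ℤ] Ω) :
    ((sext fs ω, - tmap S SQ.coanchor.toAddMonoidHom ω, 0) : Θ × (S ⊗[ℤ] Q) × U) ∈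
      pullN Θ U 𝒟 φ SQ := by
  induction ω using TensorProduct.induction_on with
  | zero =>
    convert (pullN Θ U 𝒟 φ SQ).zero_mem using 1
    refine Prod.ext ?_ (Prod.ext ?_ ?_) <;> simp
  | add x y hx hy =>
    convert Submodule.add_mem _ hx hy using 1
    refine Prod.ext (map_add _ _ _) (Prod.ext ?_ (add_zero _).symm)
    simp only [map_add, neg_add, Prod.snd_add, Prod.fst_add]
  | tmul h α =>
    convert Submodule.smul_mem _ h (formPull_coanchor_mem_pullN (SQ := SQ) hd hfs α) using 1
    refine Prod.ext (by simp) (Prod.ext ?_ (by simp))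
    simp [TensorProduct.smul_tmul']

theorem tmap_surjective {f : Q →+ A} (hf : Function.Surjective f) :
    Function.Surjective (tmap S f) := by
  intro t
  induction t using TensorProduct.induction_on with
  | zero => exact ⟨0, map_zero _⟩
  | tmul h a =>
    obtain ⟨q, rfl⟩ := hf a
    exact ⟨h ⊗ₜ q, tmap_tmul _ _ _ _⟩
  | add x y hx hy =>
    obtain ⟨x, rfl⟩ := hx
    obtain ⟨y, rfl⟩ := hy
    exact ⟨x + y, map_add _ _ _⟩

/-- Right exactness of `S ⊗_ℤ -`. -/
theorem exists_tmap_eq_of_tmap_eq_zero {B : Type u} [AddCommGroup B] {i : B →+ Q} {f : Q →+ A}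
    (hf : Function.Surjective f) (hi : ∀ q, f q = 0 → ∃ b, i b = q) (hfi : ∀ b, f (i b) = 0)
    {t : S ⊗[ℤ] Q} (ht : tmap S f t = 0) : ∃ w : S ⊗[ℤ] B, tmap S i w = t := by
  have e : ∀ {M N : Type u} [AddCommGroup M] [AddCommGroup N] (g : M →+ N) (s : S ⊗[ℤ] M),
      g.toIntLinearMap.lTensor S s = tmap S g s := by
    intro M N _ _ g s
    induction s using TensorProduct.induction_on with
    | zero => simp
    | add x y hx hy => rw [map_add, hx, hy, map_add]
    | tmul h q => simp
  have hex : Function.Exact i.toIntLinearMap f.toIntLinearMap := fun q =>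
    ⟨fun h => hi q h, fun ⟨b, hb⟩ => hb ▸ hfi b⟩
  obtain ⟨w, hw⟩ := (lTensor_exact S hex hf t).1 ((e f t).trans ht)
  exact ⟨w, (e i w).symm.trans hw⟩

/-- The relations defining `S ⊗_R A` lift to relations in the inverse image of `Q`. -/
theorem exists_lift_of_mem_pullLieN {p : Q →ₗ[R] A} (hp : Function.Surjective p)
    {w : (S ⊗[ℤ] A) × U} (hw : w ∈ pullLieN U φ A) :
    w.2 = 0 ∧ ∃ t : S ⊗[ℤ] Q, tmap S p.toAddMonoidHom t = w.1 ∧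
      ((0, t, 0) : Θ × (S ⊗[ℤ] Q) × U) ∈ pullN Θ U 𝒟 φ SQ := by
  induction hw using Submodule.span_induction with
  | zero => exact ⟨rfl, 0, map_zero _, Submodule.zero_mem _⟩
  | add x y _ _ hx hy =>
    obtain ⟨hx, t, ht, htN⟩ := hx
    obtain ⟨hy, s, hs, hsN⟩ := hy
    refine ⟨by rw [Prod.snd_add, hx, hy, add_zero], t + s,
      by rw [map_add, ht, hs, Prod.fst_add], ?_⟩
    convert Submodule.add_mem _ htN hsN using 1
    simp
  | smul f x _ hx =>
    obtain ⟨hx, t, ht, htN⟩ := hx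
    refine ⟨by rw [Prod.smul_snd, hx, smul_zero], f • t, by rw [map_smul, ht, Prod.smul_fst], ?_⟩
    convert Submodule.smul_mem _ f htN using 1
    simp
  | mem x hx =>
    obtain ⟨g, a, rfl⟩ := hx
    obtain ⟨q, rfl⟩ := hp a
    refine ⟨rfl, _, ?_, genQ_mem 𝒟 SQ g q⟩
    simp

/-- Exactness in the middle: an element of `S ⊗ Q` which vanishes in `S ⊗_R A` is, modulo the
relations, a one-form. -/
theorem exists_form_mem_pullN (hd : Submodule.span R (Set.range 𝒞.d) = ⊤) {fs : Ω →+ Θ}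
    (hfs : IsFormPull 𝒞 𝒟 φ fs) {p : Q →ₗ[R] A} (hp : Function.Surjective p)
    (hex : ∀ q, p q = 0 → ∃ α, SQ.coanchor α = q) (hp0 : ∀ α, p (SQ.coanchor α) = 0)
    {t : S ⊗[ℤ] Q} {ξ : U} (ht : (tmap S p.toAddMonoidHom t, ξ) ∈ pullLieN U φ A) :
    ξ = 0 ∧ ∃ γ : Θ, ((γ, t, 0) : Θ × (S ⊗[ℤ] Q) × U) ∈ pullN Θ U 𝒟 φ SQ := by
  obtain ⟨h1, s, hs, hsN⟩ := exists_lift_of_mem_pullLieN (Θ := Θ) (𝒟 := 𝒟) (SQ := SQ) hp ht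
  obtain ⟨ω, hω⟩ := exists_tmap_eq_of_tmap_eq_zero (S := S) (i := SQ.coanchor.toAddMonoidHom)
    (f := p.toAddMonoidHom) (t := t - s) hp hex hp0 (by rw [map_sub, hs, sub_self])
  refine ⟨h1, - sext fs ω, ?_⟩
  convert Submodule.sub_mem _ hsN (sext_coanchor_mem_pullN (SQ := SQ) (U := U) hd hfs ω) using 1
  refine Prod.ext (by simp) (Prod.ext ?_ (by simp))
  simp [hω]

/-- An extension of a projective module by one-forms splits. -/
theorem exists_retraction {p : Q →ₗ[R] A} (hp : Function.Surjective p)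
    (hex : ∀ q, p q = 0 → ∃ α, SQ.coanchor α = q) (hp0 : ∀ α, p (SQ.coanchor α) = 0)
    (hinj : Function.Injective SQ.coanchor) [Module.Projective R A] :
    ∃ r : Q →ₗ[R] Ω, ∀ α, r (SQ.coanchor α) = α := by
  obtain ⟨s, hs⟩ := Module.projective_lifting_property p LinearMap.id hp
  have hs' : ∀ a, p (s a) = a := fun a => LinearMap.congr_fun hs a
  -- `q - s(p(q))` is a one-form, which is unique as the co-anchor is injective
  choose r hr using fun q => hex (q - s (p q)) (by rw [map_sub, hs', sub_self])
  refine ⟨{ toFun := r, map_add' := fun a b => hinj ?_, map_smul' := fun f a => hinj ?_ },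
    fun α => hinj ?_⟩
  · simp only [map_add, hr]; abel
  · simp only [map_smul, hr, RingHom.id_apply, smul_sub]
  · change SQ.coanchor (r _) = _
    rw [hr, hp0, map_zero, sub_zero]

end StalkExact

section SheafExact

variable {k : Type} [Field k] {X Y : RSpace.{u} k}

/-- Along `F` one-forms can be pulled back, and one-forms on the target are generated by the
differentials of functions. -/
structure SpMap.PullsForms (F : SpMap Y X) : Prop where
  span_d : ∀ x, Submodule.span (X.O x) (Set.range (X.cartan x).d) = ⊤
  exists_formPull : ∀ y, ∃ fs : X.Ω.E (F.f y) →+ Y.Ω.E y,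
    IsFormPull (X.cartan (F.f y)) (Y.cartan y) (F.φ y) fs

theorem MSheaf.LocallyFree.projective {M : MSheaf X} (hM : M.LocallyFree) (x : X.pt) :
    Module.Projective (X.O x) (M.E x) := by
  obtain ⟨r, e, -, h⟩ := hM x
  obtain ⟨h1, h2⟩ := h.self_of_nhds
  exact Module.Projective.of_basis (Module.Basis.mk h1 h2.ge)

variable (F : SpMap Y X) {A : LieAlgd X} (Q : CourantOver A)

namespace CourantOver

variable {Q} in
theorem exists_retraction_of_isExtension (hA : A.A.LocallyFree) (hQ : Q.IsExtension) (x : X.pt) :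
    ∃ r : Q.Q.E x →ₗ[X.O x] X.Ω.E x, ∀ α, r ((Q.str x).coanchor α) = α :=
  have := hA.projective x
  exists_retraction (hQ.surjective x) (hQ.exact x) (Q.isOver x).coanchor (hQ.injective x)

theorem mem_pullK_iff {y : Y.pt} (u : (Q.pullP F).E y) :
    u ∈ Q.pullK F y ↔ Q.pullProj₀ F y u ∈ A.pullK F y :=
  forall_congr' fun g => Eq.congr_right (tact_tmap (F.φ y) (Q.proj (F.f y)) _ _
    (Q.isOver (F.f y)).anchor g u.2.1).symm

/-- Whether `(α, t, ξ)` belongs to the stalk of the fibre product depends only on the image of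
`(t, ξ)` in the inverse image of `A`. -/
theorem mem_interior_pullK_iff {y : Y.pt} (u : (Q.pullP F).E y) :
    u ∈ MSheaf.interior (M := Q.pullP F) (Q.pullK F) y ↔
      Q.pullProj₀ F y u ∈ MSheaf.interior (M := A.pullP F) (A.pullK F) y := by
  refine ⟨Q.pullProj₀_C F y u, fun h => ?_⟩
  obtain ⟨s, hs, rfl⟩ := (Q.pullP F).etale.exists_sec y u
  rw [MSheaf.mem_interior_iff (M := A.pullP F) (s := fun y' => Q.pullProj₀ F y' (s y'))
    (Q.pullProj₀_sec F hs)] at h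
  rw [MSheaf.mem_interior_iff hs]
  exact h.mono fun y' h' => (Q.mem_pullK_iff F _).2 h'

variable {Q F}

theorem exists_pullMk {y : Y.pt} (e : (Q.pull F).Q.E y) : ∃ α t ξ h, e = Q.pullMk F y α t ξ h := by
  obtain ⟨⟨⟨α, t, ξ⟩, h⟩, rfl⟩ := Submodule.mkQ_surjective _ e
  exact ⟨α, t, ξ, h, rfl⟩

theorem pullMk_eq {y : Y.pt} {α α' : Y.Ω.E y} {t t' : Y.O y ⊗[ℤ] Q.Q.E (F.f y)} {ξ ξ' : Y.T.E y}
    {h h'} : Q.pullMk F y α t ξ h = Q.pullMk F y α' t' ξ' h' ↔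
      (α - α', t - t', ξ - ξ') ∈
        pullN (Y.Ω.E y) (Y.T.E y) (Y.cartan y) (F.φ y) (Q.str (F.f y)) :=
  Submodule.Quotient.eq _

theorem pullMk_congr {y : Y.pt} {α α' : Y.Ω.E y} {t t' : Y.O y ⊗[ℤ] Q.Q.E (F.f y)}
    {ξ ξ' : Y.T.E y} {h h'} (h1 : α = α') (h2 : t = t') (h3 : ξ = ξ') :
    Q.pullMk F y α t ξ h = Q.pullMk F y α' t' ξ' h' := by
  subst h1 h2 h3
  rfl

theorem _root_.LieAlgd.pullMk_eq {y : Y.pt} {t t' : Y.O y ⊗[ℤ] A.A.E (F.f y)} {ξ ξ' : Y.T.E y}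
    {h h'} : A.pullMk F y t ξ h = A.pullMk F y t' ξ' h' ↔
      (t - t', ξ - ξ') ∈ pullLieN (Y.T.E y) (F.φ y) (A.A.E (F.f y)) :=
  Submodule.Quotient.eq _

theorem _root_.LieAlgd.pullMk_zero (y : Y.pt) :
    A.pullMk F y 0 0 (Submodule.zero_mem _) = 0 := map_zero (Submodule.mkQ _)

theorem pullMk_zero (y : Y.pt) : Q.pullMk F y 0 0 0 (Submodule.zero_mem _) = 0 :=
  map_zero (Submodule.mkQ _)

theorem tmap_proj_mem {y : Y.pt} {α : Y.Ω.E y} {t : Y.O y ⊗[ℤ] Q.Q.E (F.f y)} {ξ : Y.T.E y}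
    (h : (α, t, ξ) ∈ MSheaf.interior (M := Q.pullP F) (Q.pullK F) y) :
    (tmap (Y.O y) (Q.proj (F.f y)).toAddMonoidHom t, ξ) ∈
      MSheaf.interior (M := A.pullP F) (A.pullK F) y := Q.pullProj₀_C F y (α, t, ξ) h

theorem pullMk_proj {y : Y.pt} (α : Y.Ω.E y) (t : Y.O y ⊗[ℤ] Q.Q.E (F.f y)) (ξ : Y.T.E y) (h) :
    (Q.pull F).proj y (Q.pullMk F y α t ξ h) =
      A.pullMk F y (tmap (Y.O y) (Q.proj (F.f y)).toAddMonoidHom t) ξ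
        (tmap_proj_mem h) := rfl

theorem coanchor_mem (y : Y.pt) (α : Y.Ω.E y) :
    ((α, 0, 0) : (Q.pullP F).E y) ∈ MSheaf.interior (M := Q.pullP F) (Q.pullK F) y :=
  (Q.toCourantAlgd.pullSub F y).C_coanchor α

theorem pull_coanchor (y : Y.pt) (α : Y.Ω.E y) :
    ((Q.pull F).str y).coanchor α = Q.pullMk F y α 0 0 (coanchor_mem y α) := rfl

/-- Inverse images of Courant extensions of a locally free Lie algebroid are Courant extensions. -/
theorem pull_isExtension (hF : F.PullsForms) (hA : A.A.LocallyFree) (hQ : Q.IsExtension) :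
    (Q.pull F).IsExtension where
  injective y := by
    rw [injective_iff_map_eq_zero]
    intro α hα
    obtain ⟨fs, hfs⟩ := hF.exists_formPull y
    obtain ⟨r, hr⟩ := exists_retraction_of_isExtension hA hQ (F.f y)
    rw [pull_coanchor, ← pullMk_zero, pullMk_eq] at hα
    simpa using add_sext_retraction_eq_zero hfs r hr hα
  exact y e he := by
    obtain ⟨α, t, ξ, h, rfl⟩ := exists_pullMk e
    obtain ⟨fs, hfs⟩ := hF.exists_formPull y
    have he := LieAlgd.pullMk_eq.1
      ((pullMk_proj α t ξ h).symm.trans (he.trans (LieAlgd.pullMk_zero y).symm))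
    rw [sub_zero, sub_zero] at he
    obtain ⟨rfl, γ, hγ⟩ := exists_form_mem_pullN (hF.span_d _) hfs (hQ.surjective (F.f y))
      (hQ.exact (F.f y)) (Q.isOver (F.f y)).coanchor he
    refine ⟨α - γ, ?_⟩
    rw [pull_coanchor, pullMk_eq]
    convert Submodule.neg_mem _ hγ using 1
    refine Prod.ext ?_ (Prod.ext ?_ ?_) <;> simp
  surjective y a := by
    obtain ⟨⟨⟨t, ξ⟩, h⟩, rfl⟩ := Submodule.mkQ_surjective _ a
    obtain ⟨t, rfl⟩ := tmap_surjective (S := Y.O y) (f := (Q.proj (F.f y)).toAddMonoidHom)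
      (hQ.surjective (F.f y)) t
    exact ⟨Q.pullMk F y 0 t ξ ((Q.mem_interior_pullK_iff F (0, t, ξ)).2 h), rfl⟩

end CourantOver
end SheafExact

/-! ### Fibre products of Courant extensions -/

section FibreProduct

variable {k : Type} [Field k] {X Y : RSpace.{u} k}

/-- The subsheaf with stalks `C x`. -/
abbrev MSheaf.ofSub {M : MSheaf X} (C : ∀ x, Submodule (X.O x) (M.E x)) (hC : M.IsSub C) :
    MSheaf X where
  E x := C x
  Sec s x := M.Sec (fun y => (s y : M.E y)) x
  etale :=
    { near := fun h => M.etale.near h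
      congr := fun h h' => M.etale.congr h (h'.mono fun y hy => congrArg Subtype.val hy)
      exists_sec := fun x e => by
        classical
        obtain ⟨s, hs, h⟩ := M.etale.exists_sec x e.1
        have hx : s x ∈ C x := h ▸ e.2
        refine ⟨fun y => if h : s y ∈ C y then ⟨s y, h⟩ else 0, M.etale.congr hs ?_,
          (dif_pos hx).trans (Subtype.ext h)⟩
        filter_upwards [hC s x hs hx] with y hy
        rw [dif_pos hy]
      eq_near := fun h h' he => (M.etale.eq_near h h' (congrArg Subtype.val he)).mono
        fun y hy => Subtype.ext hy }
  add h h' := M.add h h'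
  smul hf h := M.smul hf h

namespace CourantOver
variable {A : LieAlgd X} {n : ℕ} (Q : Fin n → CourantOver A)

/-- The stalks of the fibre product `Q₁ ×_A ⋯ ×_A Qₙ`, whose elements are recorded together with
their common image in `A`. -/
def fib (x : X.pt) : Submodule (X.O x) (A.A.E x × ∀ i, (Q i).Q.E x) where
  carrier := {u | ∀ i, (Q i).proj x (u.2 i) = u.1}
  zero_mem' := fun i => by simp
  add_mem' := fun {u v} hu hv i => by simp [hu i, hv i]
  smul_mem' := fun f u hu i => by simp [hu i]

theorem fib_isSub : (A.A.prod (MSheaf.pi fun i => (Q i).Q)).IsSub (fib Q) :=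
  fun _ _ hs h => eventually_all.2 fun i =>
    A.A.etale.eq_near ((Q i).proj_sec (hs.2 i)) hs.1 (h i)

/-- The fibre product `Q₁ ×_A ⋯ ×_A Qₙ`. -/
abbrev fibSheaf : MSheaf X :=
  MSheaf.ofSub (M := A.A.prod (MSheaf.pi fun i => (Q i).Q)) (fib Q) (fib_isSub Q)

variable {Q}

/-- The component-wise bracket of the fibre product. -/
def fibBr (x : X.pt) : fib Q x →+ fib Q x →+ fib Q x :=
  biadd (fun u v => ⟨((A.str x).br u.1.1 v.1.1, fun i => ((Q i).str x).br (u.1.2 i) (v.1.2 i)),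
    fun i => by rw [((Q i).isOver x).map_br, u.2 i, v.2 i]⟩)
    (fun u u' v => Subtype.ext (Prod.ext (by simp) (funext fun i => by simp)))
    (fun u v v' => Subtype.ext (Prod.ext (by simp) (funext fun i => by simp)))

/-- The projection of the fibre product to `A`. -/
def fibProj (x : X.pt) : fib Q x →ₗ[X.O x] A.A.E x :=
  LinearMap.fst (X.O x) _ _ ∘ₗ (fib Q x).subtype

/-- The projection of the fibre product to `Qᵢ`. -/
def fibPr (i : Fin n) (x : X.pt) : fib Q x →ₗ[X.O x] (Q i).Q.E x :=
  LinearMap.proj i ∘ₗ LinearMap.snd (X.O x) _ _ ∘ₗ (fib Q x).subtype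

theorem proj_fibPr (i : Fin n) (x : X.pt) (u : fib Q x) :
    (Q i).proj x (fibPr i x u) = fibProj x u := u.2 i

variable (c : Fin n → k)

/-- The map from the fibre product to its push-out along `(αᵢ) ↦ ∑ cᵢ αᵢ`. -/
noncomputable def fibMk (x : X.pt) : fib Q x →ₗ[X.O x] (lc c Q).Q.E x where
  toFun u := lcMk c x 0 u.1.1 u.1.2 u.2
  map_add' u v := Eq.trans (lcMk_congr (add_zero _).symm rfl fun _ => rfl)
    (lcMk_add _ _ _ _ _ _ u.2 v.2).symm
  map_smul' f u := Eq.trans (lcMk_congr (smul_zero f).symm rfl fun _ => rfl)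
    (lcMk_smul f _ _ _ u.2).symm

theorem fibMk_apply (x : X.pt) (u : fib Q x) :
    fibMk c x u = lcMk c x 0 (fibProj x u) (fun i => fibPr i x u)
      (fun i => proj_fibPr i x u) := rfl

theorem fibMk_sec {u : ∀ x, fib Q x} {x : X.pt} (hu : (fibSheaf Q).Sec u x) :
    (lc c Q).Q.Sec (fun y => fibMk c y (u y)) x :=
  lc_sec.2 ⟨fun _ => 0, fun y => (u y).1.1, fun i y => (u y).1.2 i, X.Ω.zero x, hu.1, hu.2,
    Eventually.of_forall fun y => ⟨(u y).2, rfl⟩⟩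

theorem proj_fibMk (x : X.pt) (u : fib Q x) : (lc c Q).proj x (fibMk c x u) = fibProj x u := rfl

theorem fibMk_br (x : X.pt) (u v : fib Q x) :
    fibMk c x (fibBr x u v) = ((lc c Q).str x).br (fibMk c x u) (fibMk c x v) := by
  refine Eq.trans ?_ (lcMk_br _ _ _ _ _ _ _ _).symm
  exact lcMk_congr (by simp) rfl fun _ => rfl

theorem fibMk_pair (x : X.pt) (u v : fib Q x) :
    ((lc c Q).str x).pair (fibMk c x u) (fibMk c x v) =
      ∑ i, algebraMap k (X.O x) (c i) * ((Q i).str x).pair (fibPr i x u) (fibPr i x v) := by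
  refine (lcMk_pair _ _ _ _ _ _ _ _).trans ?_
  rw [map_zero, map_zero, zero_add, zero_add]
  rfl

theorem exists_fibMk (x : X.pt) (e : (lc c Q).Q.E x) :
    ∃ (β : X.Ω.E x) (u : fib Q x), e = fibMk c x u + ((lc c Q).str x).coanchor β := by
  obtain ⟨β, a, q, h, rfl⟩ := exists_lcMk e
  refine ⟨β, ⟨(a, q), h⟩, ?_⟩
  exact Eq.trans (lcMk_congr (zero_add _).symm (add_zero _).symm fun i => (add_zero _).symm)
    (lcMk_add _ _ _ _ _ _ h fun _ => map_zero _).symm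

end CourantOver
end FibreProduct

/-! ### The canonical isomorphism -/

/-- A linear map descends along a surjection whose kernel it kills. -/
theorem exists_linearMap_apply_eq {R M N P : Type u} [CommRing R] [AddCommGroup M] [Module R M]
    [AddCommGroup N] [Module R N] [AddCommGroup P] [Module R P] {f : M →ₗ[R] N}
    (hf : Function.Surjective f) (g : M →ₗ[R] P) (h : ∀ m, f m = 0 → g m = 0) :
    ∃ e : N →ₗ[R] P, ∀ m, e (f m) = g m := by
  have hk : LinearMap.ker f ≤ LinearMap.ker g := fun m hm => h m hm
  refine ⟨(LinearMap.ker f).liftQ g hk ∘ₗ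
    (f.quotKerEquivOfSurjective hf).symm.toLinearMap, fun m => ?_⟩
  have : (f.quotKerEquivOfSurjective hf).symm (f m) = (LinearMap.ker f).mkQ m := by
    rw [LinearEquiv.symm_apply_eq]
    rfl
  exact (congrArg ((LinearMap.ker f).liftQ g hk) this).trans (Submodule.liftQ_apply _ _ _)

section Canonical

variable {k : Type} [Field k] {X Y : RSpace.{u} k} (F : SpMap Y X) {A : LieAlgd X}

namespace CourantOver

section PullMk

variable {F} {Q : CourantOver A}

theorem pullBr_mem {y : Y.pt} {α β : Y.Ω.E y} {t s : Y.O y ⊗[ℤ] Q.Q.E (F.f y)} {ξ η : Y.T.E y}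
    (h : (α, t, ξ) ∈ MSheaf.interior (M := Q.pullP F) (Q.pullK F) y)
    (h' : (β, s, η) ∈ MSheaf.interior (M := Q.pullP F) (Q.pullK F) y) :
    ((Y.cartan y).L ξ β - ((Y.cartan y).L η α - (Y.cartan y).d ((Y.cartan y).ι η α)) +
        dpair (Y.cartan y) ((Q.str (F.f y)).pairS (F.φ y)) t s,
      brT (Q.str (F.f y)).br t s - derT (Y.cartan y) _ η t + derT (Y.cartan y) _ ξ s,
      (Y.cartan y).lie ξ η) ∈ MSheaf.interior (M := Q.pullP F) (Q.pullK F) y :=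
  (Q.toCourantAlgd.pullSub F y).C_br (α, t, ξ) h (β, s, η) h'

theorem _root_.LieAlgd.pullBr_mem {y : Y.pt} {t s : Y.O y ⊗[ℤ] A.A.E (F.f y)} {ξ η : Y.T.E y}
    (h : (t, ξ) ∈ MSheaf.interior (M := A.pullP F) (A.pullK F) y)
    (h' : (s, η) ∈ MSheaf.interior (M := A.pullP F) (A.pullK F) y) :
    (brT (A.str (F.f y)).br t s - derT (Y.cartan y) _ η t + derT (Y.cartan y) _ ξ s,
      (Y.cartan y).lie ξ η) ∈ MSheaf.interior (M := A.pullP F) (A.pullK F) y :=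
  (A.pullSub F y).C_br (t, ξ) h (s, η) h'

theorem pullMk_br {y : Y.pt} {α β : Y.Ω.E y} {t s : Y.O y ⊗[ℤ] Q.Q.E (F.f y)} {ξ η : Y.T.E y}
    (h : (α, t, ξ) ∈ MSheaf.interior (M := Q.pullP F) (Q.pullK F) y)
    (h' : (β, s, η) ∈ MSheaf.interior (M := Q.pullP F) (Q.pullK F) y) :
    ((Q.pull F).str y).br (Q.pullMk F y α t ξ h) (Q.pullMk F y β s η h') =
      Q.pullMk F y ((Y.cartan y).L ξ β - ((Y.cartan y).L η α -
          (Y.cartan y).d ((Y.cartan y).ι η α)) +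
          dpair (Y.cartan y) ((Q.str (F.f y)).pairS (F.φ y)) t s)
        (brT (Q.str (F.f y)).br t s - derT (Y.cartan y) _ η t + derT (Y.cartan y) _ ξ s)
        ((Y.cartan y).lie ξ η) (pullBr_mem h h') := rfl

theorem pullMk_pair {y : Y.pt} {α β : Y.Ω.E y} {t s : Y.O y ⊗[ℤ] Q.Q.E (F.f y)} {ξ η : Y.T.E y}
    (h : (α, t, ξ) ∈ MSheaf.interior (M := Q.pullP F) (Q.pullK F) y)
    (h' : (β, s, η) ∈ MSheaf.interior (M := Q.pullP F) (Q.pullK F) y) :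
    ((Q.pull F).str y).pair (Q.pullMk F y α t ξ h) (Q.pullMk F y β s η h') =
      (Y.cartan y).ι ξ β + (Y.cartan y).ι η α + sext₂ ((Q.str (F.f y)).pairS (F.φ y)) t s :=
  quotPair_mk _ _ _ (Q.toCourantAlgd.pullSub F y).N_pair (Q.toCourantAlgd.pullSub F y).pair_symm
    (⟨(α, t, ξ), h⟩ : (Q.toCourantAlgd.pullSub F y).C) ⟨(β, s, η), h'⟩

theorem pullMk_add {y : Y.pt} {α β : Y.Ω.E y} {t s : Y.O y ⊗[ℤ] Q.Q.E (F.f y)} {ξ η : Y.T.E y}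
    (h : (α, t, ξ) ∈ MSheaf.interior (M := Q.pullP F) (Q.pullK F) y)
    (h' : (β, s, η) ∈ MSheaf.interior (M := Q.pullP F) (Q.pullK F) y) :
    Q.pullMk F y α t ξ h + Q.pullMk F y β s η h' =
      Q.pullMk F y (α + β) (t + s) (ξ + η) (Submodule.add_mem _ h h') := rfl

theorem pullMk_smul {y : Y.pt} (f : Y.O y) {α : Y.Ω.E y} {t : Y.O y ⊗[ℤ] Q.Q.E (F.f y)}
    {ξ : Y.T.E y} (h : (α, t, ξ) ∈ MSheaf.interior (M := Q.pullP F) (Q.pullK F) y) :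
    f • Q.pullMk F y α t ξ h =
      Q.pullMk F y (f • α) (f • t) (f • ξ)
        (Submodule.smul_mem (M := (Q.pullP F).E y) _ (x := (α, t, ξ)) f h) := rfl

theorem pullMk_sec {α : ∀ y, Y.Ω.E y} {t : ∀ y, Y.O y ⊗[ℤ] Q.Q.E (F.f y)} {ξ : ∀ y, Y.T.E y}
    {y : Y.pt} (hα : Y.Ω.Sec α y) (ht : F.TSec Q.Q t y) (hξ : Y.T.Sec ξ y)
    {σ : ∀ y, (Q.pull F).Q.E y}
    (hσ : ∀ᶠ y' in 𝓝 y, ∃ h, σ y' = Q.pullMk F y' (α y') (t y') (ξ y') h) :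
    (Q.pull F).Q.Sec σ y := ⟨fun y' => (α y', t y', ξ y'), ⟨hα, ht, hξ⟩, hσ⟩

theorem _root_.LieAlgd.pullMk_br {y : Y.pt} {t s : Y.O y ⊗[ℤ] A.A.E (F.f y)} {ξ η : Y.T.E y}
    (h : (t, ξ) ∈ MSheaf.interior (M := A.pullP F) (A.pullK F) y)
    (h' : (s, η) ∈ MSheaf.interior (M := A.pullP F) (A.pullK F) y) :
    ((A.pull F).str y).br (A.pullMk F y t ξ h) (A.pullMk F y s η h') =
      A.pullMk F y (brT (A.str (F.f y)).br t s - derT (Y.cartan y) _ η t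
        + derT (Y.cartan y) _ ξ s) ((Y.cartan y).lie ξ η) (LieAlgd.pullBr_mem h h') := rfl

theorem _root_.LieAlgd.pullMk_sec {t : ∀ y, Y.O y ⊗[ℤ] A.A.E (F.f y)} {ξ : ∀ y, Y.T.E y}
    {y : Y.pt} (ht : F.TSec A.A t y) (hξ : Y.T.Sec ξ y) {σ : ∀ y, (A.pull F).A.E y}
    (hσ : ∀ᶠ y' in 𝓝 y, ∃ h, σ y' = A.pullMk F y' (t y') (ξ y') h) :
    (A.pull F).A.Sec σ y := ⟨fun y' => (t y', ξ y'), ⟨ht, hξ⟩, hσ⟩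

theorem _root_.LieAlgd.pullMk_congr {y : Y.pt} {t t' : Y.O y ⊗[ℤ] A.A.E (F.f y)}
    {ξ ξ' : Y.T.E y} {h h'} (h1 : t = t') (h2 : ξ = ξ') :
    A.pullMk F y t ξ h = A.pullMk F y t' ξ' h' := by
  subst h1 h2
  rfl

theorem mem_interior_of_tmap_proj {y : Y.pt} {t : Y.O y ⊗[ℤ] Q.Q.E (F.f y)} {ξ : Y.T.E y}
    (h : (tmap (Y.O y) (Q.proj (F.f y)).toAddMonoidHom t, ξ) ∈
      MSheaf.interior (M := A.pullP F) (A.pullK F) y) (α : Y.Ω.E y) :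
    (α, t, ξ) ∈ MSheaf.interior (M := Q.pullP F) (Q.pullK F) y :=
  (Q.mem_interior_pullK_iff F (α, t, ξ)).2 h

end PullMk

variable {n : ℕ} {Q : Fin n → CourantOver A} (c : Fin n → k)

theorem tmap_proj_fibPr {y : Y.pt} (τ : Y.O y ⊗[ℤ] fib Q (F.f y)) (i : Fin n) :
    tmap (Y.O y) ((Q i).proj (F.f y)).toAddMonoidHom
      (tmap (Y.O y) (fibPr i (F.f y)).toAddMonoidHom τ) =
      tmap (Y.O y) (fibProj (F.f y)).toAddMonoidHom τ := by
  rw [tmap_comp]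
  congr 1
  congr 1
  exact AddMonoidHom.ext fun u => proj_fibPr i _ u

theorem tmap_proj_fibMk {y : Y.pt} (τ : Y.O y ⊗[ℤ] fib Q (F.f y)) :
    tmap (Y.O y) ((lc c Q).proj (F.f y)).toAddMonoidHom
      (tmap (Y.O y) (fibMk c (F.f y)).toAddMonoidHom τ) =
      tmap (Y.O y) (fibProj (F.f y)).toAddMonoidHom τ := by
  rw [tmap_comp]
  rfl

variable (Q) in
/-- The triples `(α, τ, ξ)` with `τ ∈ O_Y ⊗ (Q₁ ×_A ⋯ ×_A Qₙ)` such that `τ` and `ξ` have the same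
image in `f^* T_X`. They parametrize both sides of the canonical isomorphism. -/
noncomputable def fibK (y : Y.pt) :
    Submodule (Y.O y) (Y.Ω.E y × (Y.O y ⊗[ℤ] fib Q (F.f y)) × Y.T.E y) :=
  (MSheaf.interior (M := A.pullP F) (A.pullK F) y).comap
    (((tmap (Y.O y) (fibProj (F.f y)).toAddMonoidHom).prodMap LinearMap.id) ∘ₗ
      LinearMap.snd (Y.O y) (Y.Ω.E y) ((Y.O y ⊗[ℤ] fib Q (F.f y)) × Y.T.E y))

variable {F}

theorem fibK_A {y : Y.pt} {α : Y.Ω.E y} {τ : Y.O y ⊗[ℤ] fib Q (F.f y)} {ξ : Y.T.E y}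
    (h : (α, τ, ξ) ∈ fibK F Q y) : (tmap (Y.O y) (fibProj (F.f y)).toAddMonoidHom τ, ξ) ∈
      MSheaf.interior (M := A.pullP F) (A.pullK F) y := h

theorem fibK_lc {y : Y.pt} {α : Y.Ω.E y} {τ : Y.O y ⊗[ℤ] fib Q (F.f y)} {ξ : Y.T.E y}
    (h : (α, τ, ξ) ∈ fibK F Q y) : (α, tmap (Y.O y) (fibMk c (F.f y)).toAddMonoidHom τ, ξ) ∈
      MSheaf.interior (M := (lc c Q).pullP F) ((lc c Q).pullK F) y :=
  mem_interior_of_tmap_proj (by rw [tmap_proj_fibMk]; exact h) α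

theorem fibK_Q {y : Y.pt} {α : Y.Ω.E y} {τ : Y.O y ⊗[ℤ] fib Q (F.f y)} {ξ : Y.T.E y}
    (h : (α, τ, ξ) ∈ fibK F Q y) (i : Fin n) :
    (0, tmap (Y.O y) (fibPr i (F.f y)).toAddMonoidHom τ, ξ) ∈
      MSheaf.interior (M := (Q i).pullP F) ((Q i).pullK F) y :=
  mem_interior_of_tmap_proj (by rw [tmap_proj_fibPr]; exact h) 0

/-- The class of `(α, [0, τ], ξ)` in the inverse image of the linear combination. -/
noncomputable def fibL (y : Y.pt) (α : Y.Ω.E y) (τ : Y.O y ⊗[ℤ] fib Q (F.f y)) (ξ : Y.T.E y)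
    (h : (α, τ, ξ) ∈ fibK F Q y) : ((lc c Q).pull F).Q.E y :=
  (lc c Q).pullMk F y α (tmap (Y.O y) (fibMk c (F.f y)).toAddMonoidHom τ) ξ (fibK_lc c h)

/-- The class of `[α, (τ, ξ), (τᵢ, ξ)ᵢ]` in the linear combination of the inverse images. -/
noncomputable def fibR (y : Y.pt) (α : Y.Ω.E y) (τ : Y.O y ⊗[ℤ] fib Q (F.f y)) (ξ : Y.T.E y)
    (h : (α, τ, ξ) ∈ fibK F Q y) : (lc c fun i => (Q i).pull F).Q.E y :=
  lcMk (Q := fun i => (Q i).pull F) c y α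
    (A.pullMk F y (tmap (Y.O y) (fibProj (F.f y)).toAddMonoidHom τ) ξ (fibK_A h))
    (fun i => (Q i).pullMk F y 0 (tmap (Y.O y) (fibPr i (F.f y)).toAddMonoidHom τ) ξ (fibK_Q h i))
    (fun i => (pullMk_proj _ _ _ _).trans (LieAlgd.pullMk_congr (tmap_proj_fibPr F τ i) rfl))

/-- Modulo the relations, every element of `f^*(∑ cᵢ Qᵢ)` comes from the fibre product of the `Qᵢ`,
up to a one-form on `Y`. -/
theorem exists_sub_tmap_fibMk_mem_pullN (hF : F.PullsForms) {y : Y.pt}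
    (t : Y.O y ⊗[ℤ] (lc c Q).Q.E (F.f y)) :
    ∃ (γ : Y.Ω.E y) (τ : Y.O y ⊗[ℤ] fib Q (F.f y)),
      tmap (Y.O y) ((lc c Q).proj (F.f y)).toAddMonoidHom t =
        tmap (Y.O y) (fibProj (F.f y)).toAddMonoidHom τ ∧
      (γ, t - tmap (Y.O y) (fibMk c (F.f y)).toAddMonoidHom τ, 0) ∈
        pullN (Y.Ω.E y) (Y.T.E y) (Y.cartan y) (F.φ y) ((lc c Q).str (F.f y)) := by
  obtain ⟨fs, hfs⟩ := hF.exists_formPull y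
  induction t using TensorProduct.induction_on with
  | zero =>
    refine ⟨0, 0, by rw [map_zero, map_zero], ?_⟩
    convert Submodule.zero_mem _ using 1
    simp
  | add s t hs ht =>
    obtain ⟨γ, τ, h1, h⟩ := hs
    obtain ⟨γ', τ', h1', h'⟩ := ht
    refine ⟨γ + γ', τ + τ', by rw [map_add, map_add, h1, h1'], ?_⟩
    convert Submodule.add_mem _ h h' using 1
    refine Prod.ext rfl (Prod.ext ?_ (add_zero _).symm)
    simp only [map_add, Prod.snd_add, Prod.fst_add]
    abel
  | tmul j e =>
    obtain ⟨β, u, rfl⟩ := exists_fibMk c (F.f y) e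
    refine ⟨- (j • fs β), j ⊗ₜ u, ?_, ?_⟩
    · rw [tmap_tmul, tmap_tmul]
      congr 1
      exact (map_add ((lc c Q).proj (F.f y)) (fibMk c (F.f y) u) _).trans
        ((congrArg (_ + ·) (((lc c Q).isOver (F.f y)).coanchor β)).trans (add_zero _))
    · convert Submodule.neg_mem _ (Submodule.smul_mem _ j
        (formPull_coanchor_mem_pullN (SQ := (lc c Q).str (F.f y)) (U := Y.T.E y)
          (hF.span_d _) hfs β)) using 1
      refine Prod.ext rfl (Prod.ext ?_ (by simp))
      simp [TensorProduct.tmul_add, TensorProduct.smul_tmul']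

theorem exists_fibL (hF : F.PullsForms) {y : Y.pt} (e : ((lc c Q).pull F).Q.E y) :
    ∃ α τ ξ h, e = fibL c y α τ ξ h := by
  obtain ⟨α, t, ξ, h, rfl⟩ := exists_pullMk e
  obtain ⟨γ, τ, h1, h2⟩ := exists_sub_tmap_fibMk_mem_pullN c hF t
  have h3 := tmap_proj_mem h
  rw [h1] at h3
  refine ⟨α - γ, τ, ξ, h3, pullMk_eq.2 ?_⟩
  rw [sub_sub_cancel, sub_self]
  exact h2

/-- The two parametrizations have the same relations. A relation on the left gives one-forms `γᵢ`
with `τᵢ = - π†(γᵢ)` in `f⁺⁺Qᵢ`; the retractions of the co-anchors show that `α = ∑ cᵢ γᵢ`. -/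
theorem fibR_eq_zero (hF : F.PullsForms) (hA : A.A.LocallyFree) (hQ : ∀ i, (Q i).IsExtension)
    {y : Y.pt} {α : Y.Ω.E y} {τ : Y.O y ⊗[ℤ] fib Q (F.f y)} {ξ : Y.T.E y}
    (h : (α, τ, ξ) ∈ fibK F Q y) (hL : fibL c y α τ ξ h = 0) : fibR c y α τ ξ h = 0 := by
  obtain ⟨fs, hfs⟩ := hF.exists_formPull y
  choose r hr using fun i => exists_retraction_of_isExtension hA (hQ i) (F.f y)
  have hN := pullMk_eq.1 (hL.trans (pullMk_zero y).symm)
  rw [sub_zero, sub_zero, sub_zero] at hN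
  have hAN := LieAlgd.pullMk_eq.1 ((pullMk_proj _ _ _ (fibK_lc c h)).symm.trans
    ((congrArg (((lc c Q).pull F).proj y) hL).trans
      ((map_zero _).trans (LieAlgd.pullMk_zero y).symm)))
  rw [sub_zero, sub_zero, tmap_proj_fibMk] at hAN
  have hi : ∀ i, ∃ γ : Y.Ω.E y, (γ, tmap (Y.O y) (fibPr i (F.f y)).toAddMonoidHom τ, 0) ∈
      pullN (Y.Ω.E y) (Y.T.E y) (Y.cartan y) (F.φ y) ((Q i).str (F.f y)) := fun i =>
    (exists_form_mem_pullN (hF.span_d _) hfs ((hQ i).surjective (F.f y))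
      ((hQ i).exact (F.f y)) ((Q i).isOver (F.f y)).coanchor
      ((tmap_proj_fibPr F τ i).symm ▸ hAN)).2
  choose γ hγ using hi
  have hξ : ξ = 0 := (exists_lift_of_mem_pullLieN (Θ := Y.Ω.E y) (𝒟 := Y.cartan y)
    (SQ := (lc c Q).str (F.f y)) ((lc_isExtension hQ).surjective (F.f y)) hAN).1
  subst hξ
  -- the retraction `[β, a, (qᵢ)] ↦ β + ∑ cᵢ rᵢ(qᵢ)` of the co-anchor of the linear combination
  let ρ : (lc c Q).Q.E (F.f y) →ₗ[X.O (F.f y)] X.Ω.E (F.f y) :=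
    lcLift (fun β _ q _ => β + ∑ i, algebraMap k (X.O (F.f y)) (c i) • r i (q i))
      (fun β β' a a' q q' h h' => by
        simp only [map_add, smul_add, Finset.sum_add_distrib]
        abel)
      (fun f β a q h => by
        simp only [map_smul, smul_add, Finset.smul_sum, smul_comm f])
      (fun α => by
        simp only [map_neg, hr, smul_neg, Finset.sum_neg_distrib, add_neg_cancel])
  have hρ : ∀ β, ρ (((lc c Q).str (F.f y)).coanchor β) = β := fun β => by
    rw [lcMk_coanchor, lcLift_mk]
    simp
  have hρ' : ∀ u, ρ (fibMk c (F.f y) u) =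
      ∑ i, algebraMap k (X.O (F.f y)) (c i) • r i (fibPr i (F.f y) u) := fun u => by
    rw [fibMk_apply, lcLift_mk, zero_add]
  have h1 : α + sext (fs.comp ρ.toAddMonoidHom)
      (tmap (Y.O y) (fibMk c (F.f y)).toAddMonoidHom τ) = 0 :=
    add_sext_retraction_eq_zero hfs ρ hρ hN
  have h2 : sext (fs.comp ρ.toAddMonoidHom) (tmap (Y.O y) (fibMk c (F.f y)).toAddMonoidHom τ) =
      ∑ i, algebraMap k (Y.O y) (c i) • sext (fs.comp (r i).toAddMonoidHom)
        (tmap (Y.O y) (fibPr i (F.f y)).toAddMonoidHom τ) := by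
    generalize τ = τ'
    induction τ' using TensorProduct.induction_on with
    | zero => simp
    | add s t hs ht => simp only [map_add, hs, ht, smul_add, Finset.sum_add_distrib]
    | tmul j u =>
      simp only [tmap_tmul, sext_tmul, AddMonoidHom.comp_apply, LinearMap.toAddMonoidHom_coe, hρ',
        map_sum, hfs.smul, F.const, Finset.smul_sum]
      exact Finset.sum_congr rfl fun i _ => smul_comm _ _ _
  have h3 : ∀ i, γ i + sext (fs.comp (r i).toAddMonoidHom)
      (tmap (Y.O y) (fibPr i (F.f y)).toAddMonoidHom τ) = 0 :=
    fun i => add_sext_retraction_eq_zero hfs (r i) (hr i) (hγ i)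
  have h4 : α = ∑ i, algebraMap k (Y.O y) (c i) • γ i := by
    rw [eq_neg_of_add_eq_zero_left h1, h2, ← Finset.sum_neg_distrib]
    exact Finset.sum_congr rfl fun i _ => by rw [eq_neg_of_add_eq_zero_left (h3 i), smul_neg]
  refine Eq.trans ?_ (map_zero ((lc c fun i => (Q i).pull F).str y).coanchor)
  rw [lcMk_coanchor]
  refine lcMk_eq.2 ⟨γ, by rw [sub_zero, h4], ?_, fun i => ?_⟩
  · rw [← LieAlgd.pullMk_zero, LieAlgd.pullMk_eq, sub_zero, sub_zero]
    exact hAN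
  · rw [sub_zero, eq_neg_iff_add_eq_zero, pull_coanchor, pullMk_add, ← pullMk_zero, pullMk_eq]
    simpa using hγ i

/-- The left parametrization as a linear map. -/
noncomputable def fibLHom (y : Y.pt) : fibK F Q y →ₗ[Y.O y] ((lc c Q).pull F).Q.E y where
  toFun z := fibL c y z.1.1 z.1.2.1 z.1.2.2 z.2
  map_add' z z' := Eq.trans (pullMk_congr rfl (map_add _ _ _) rfl)
    (pullMk_add (fibK_lc c z.2) (fibK_lc c z'.2)).symm
  map_smul' f z := Eq.trans (pullMk_congr rfl (map_smul _ _ _) rfl)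
    (pullMk_smul f (fibK_lc c z.2)).symm

/-- The right parametrization as a linear map. -/
noncomputable def fibRHom (y : Y.pt) :
    fibK F Q y →ₗ[Y.O y] (lc c fun i => (Q i).pull F).Q.E y where
  toFun z := fibR c y z.1.1 z.1.2.1 z.1.2.2 z.2
  map_add' z z' := by
    refine Eq.trans ?_ (lcMk_add (Q := fun i => (Q i).pull F) _ _ _ _ _ _ _ _).symm
    exact lcMk_congr rfl (LieAlgd.pullMk_congr (map_add _ _ _) rfl)
      fun i => pullMk_congr (add_zero 0).symm (map_add _ _ _) rfl
  map_smul' f z := by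
    refine Eq.trans ?_ (lcMk_smul (Q := fun i => (Q i).pull F) f _ _ _ _).symm
    exact lcMk_congr rfl (LieAlgd.pullMk_congr (map_smul _ _ _) rfl)
      fun i => pullMk_congr (smul_zero f).symm (map_smul _ _ _) rfl

theorem fibLHom_surjective (hF : F.PullsForms) (y : Y.pt) :
    Function.Surjective (fibLHom (F := F) (Q := Q) c y) := fun e => by
  obtain ⟨α, τ, ξ, h, rfl⟩ := exists_fibL c hF e
  exact ⟨⟨(α, τ, ξ), h⟩, rfl⟩

theorem exists_canon₀ (hF : F.PullsForms) (hA : A.A.LocallyFree) (hQ : ∀ i, (Q i).IsExtension)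
    (y : Y.pt) : ∃ g : ((lc c Q).pull F).Q.E y →ₗ[Y.O y] (lc c fun i => (Q i).pull F).Q.E y,
      ∀ z, g (fibLHom c y z) = fibRHom c y z :=
  exists_linearMap_apply_eq (fibLHom_surjective c hF y) (fibRHom c y)
    fun z hz => fibR_eq_zero c hF hA hQ z.2 hz

/-- The canonical map `f⁺⁺(∑ cᵢ Qᵢ) → ∑ cᵢ f⁺⁺Qᵢ` on stalks. -/
noncomputable def canon₀ (hF : F.PullsForms) (hA : A.A.LocallyFree) (hQ : ∀ i, (Q i).IsExtension)
    (y : Y.pt) : ((lc c Q).pull F).Q.E y →ₗ[Y.O y] (lc c fun i => (Q i).pull F).Q.E y :=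
  (exists_canon₀ c hF hA hQ y).choose

theorem canon₀_fibL (hF : F.PullsForms) (hA : A.A.LocallyFree) (hQ : ∀ i, (Q i).IsExtension)
    {y : Y.pt} {α : Y.Ω.E y} {τ : Y.O y ⊗[ℤ] fib Q (F.f y)} {ξ : Y.T.E y}
    (h : (α, τ, ξ) ∈ fibK F Q y) :
    canon₀ c hF hA hQ y (fibL c y α τ ξ h) = fibR c y α τ ξ h :=
  (exists_canon₀ c hF hA hQ y).choose_spec ⟨(α, τ, ξ), h⟩

end CourantOver
end Canonical

/-! ### The canonical isomorphism as a morphism of Courant extensions -/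

section CanonicalHom

variable {k : Type} [Field k] {X Y : RSpace.{u} k} {F : SpMap Y X} {A : LieAlgd X}

namespace CourantOver

variable {n : ℕ} {Q : Fin n → CourantOver A} (c : Fin n → k)

theorem eventually_mem_fibK {α : ∀ y, Y.Ω.E y} {τ : ∀ y, Y.O y ⊗[ℤ] fib Q (F.f y)}
    {ξ : ∀ y, Y.T.E y} {y : Y.pt} (hτ : F.TSec (fibSheaf Q) τ y) (hξ : Y.T.Sec ξ y)
    (h : (α y, τ y, ξ y) ∈ fibK F Q y) : ∀ᶠ y' in 𝓝 y, (α y', τ y', ξ y') ∈ fibK F Q y' :=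
  MSheaf.interior_isSub (M := A.pullP F) (A.pullK F)
    (fun y => (tmap (Y.O y) (fibProj (F.f y)).toAddMonoidHom (τ y), ξ y)) y
    ⟨F.sec_tmap (M := fibSheaf Q) (N := A.A) (fun x => (fibProj x).toAddMonoidHom)
      (fun _ hq => hq.1) hτ, hξ⟩ h

theorem fibL_sec {α : ∀ y, Y.Ω.E y} {τ : ∀ y, Y.O y ⊗[ℤ] fib Q (F.f y)} {ξ : ∀ y, Y.T.E y}
    {y : Y.pt} (hα : Y.Ω.Sec α y) (hτ : F.TSec (fibSheaf Q) τ y) (hξ : Y.T.Sec ξ y)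
    {σ : ∀ y, ((lc c Q).pull F).Q.E y}
    (hσ : ∀ᶠ y' in 𝓝 y, ∃ h, σ y' = fibL c y' (α y') (τ y') (ξ y') h) :
    ((lc c Q).pull F).Q.Sec σ y :=
  pullMk_sec hα (F.sec_tmap (M := fibSheaf Q) (N := (lc c Q).Q)
    (fun x => (fibMk c x).toAddMonoidHom) (fun _ hq => fibMk_sec c hq) hτ) hξ
    (hσ.mono fun _ ⟨h, e⟩ => ⟨fibK_lc c h, e⟩)

theorem fibR_sec {α : ∀ y, Y.Ω.E y} {τ : ∀ y, Y.O y ⊗[ℤ] fib Q (F.f y)} {ξ : ∀ y, Y.T.E y}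
    {y : Y.pt} (hα : Y.Ω.Sec α y) (hτ : F.TSec (fibSheaf Q) τ y) (hξ : Y.T.Sec ξ y)
    {σ : ∀ y, (lc c fun i => (Q i).pull F).Q.E y}
    (hσ : ∀ᶠ y' in 𝓝 y, ∃ h, σ y' = fibR c y' (α y') (τ y') (ξ y') h) :
    (lc c fun i => (Q i).pull F).Q.Sec σ y := by
  classical
  refine lc_sec.2 ⟨α, fun y' => if h : (α y', τ y', ξ y') ∈ fibK F Q y' then
      A.pullMk F y' (tmap (Y.O y') (fibProj (F.f y')).toAddMonoidHom (τ y')) (ξ y') (fibK_A h)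
      else 0, fun i y' => if h : (α y', τ y', ξ y') ∈ fibK F Q y' then
      (Q i).pullMk F y' 0 (tmap (Y.O y') (fibPr i (F.f y')).toAddMonoidHom (τ y')) (ξ y')
        (fibK_Q h i) else 0, hα, ?_, fun i => ?_, ?_⟩
  · exact LieAlgd.pullMk_sec (F.sec_tmap (M := fibSheaf Q) (N := A.A)
      (fun x => (fibProj x).toAddMonoidHom) (fun _ hq => hq.1) hτ) hξ
      (hσ.mono fun y' ⟨h, _⟩ => ⟨fibK_A h, dif_pos h⟩)
  · exact pullMk_sec (Y.Ω.zero y) (F.sec_tmap (M := fibSheaf Q) (N := (Q i).Q)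
      (fun x => (fibPr i x).toAddMonoidHom) (fun _ hq => hq.2 i) hτ) hξ
      (hσ.mono fun y' ⟨h, _⟩ => ⟨fibK_Q h i, dif_pos h⟩)
  · filter_upwards [hσ] with y' ⟨h, e⟩
    refine ⟨fun i => ?_, e.trans (lcMk_congr rfl (dif_pos h).symm fun i => Eq.symm ?_)⟩
    · rw [dif_pos h, dif_pos h]
      exact (pullMk_proj _ _ _ _).trans (LieAlgd.pullMk_congr (tmap_proj_fibPr F _ i) rfl)
    · exact dif_pos h

/-- Near `y` a section of the left hand side is parametrized by sections of the fibre product, as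
the parametrization is surjective on the stalk at `y`. -/
theorem canon₀_sec (hF : F.PullsForms) (hA : A.A.LocallyFree) (hQ : ∀ i, (Q i).IsExtension)
    {σ : ∀ y, ((lc c Q).pull F).Q.E y} {y : Y.pt} (hσ : ((lc c Q).pull F).Q.Sec σ y) :
    (lc c fun i => (Q i).pull F).Q.Sec (fun y' => canon₀ c hF hA hQ y' (σ y')) y := by
  classical
  obtain ⟨α, τ, ξ, h, e⟩ := exists_fibL c hF (σ y)
  obtain ⟨α, hα, rfl⟩ := Y.Ω.etale.exists_sec y α
  obtain ⟨τ, hτ, rfl⟩ := (F.tens (fibSheaf Q)).etale.exists_sec y τ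
  obtain ⟨ξ, hξ, rfl⟩ := Y.T.etale.exists_sec y ξ
  have hK := eventually_mem_fibK hτ hξ h
  have hL : ∀ᶠ y' in 𝓝 y, ∃ h, (if h : (α y', τ y', ξ y') ∈ fibK F Q y' then
      fibL c y' (α y') (τ y') (ξ y') h else 0) = fibL c y' (α y') (τ y') (ξ y') h :=
    hK.mono fun _ h => ⟨h, dif_pos h⟩
  have hs := ((lc c Q).pull F).Q.etale.eq_near hσ (fibL_sec c hα hτ hξ hL)
    (e.trans (dif_pos h).symm)
  refine fibR_sec c hα hτ hξ ?_
  filter_upwards [hs, hK] with y' h1 h2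
  refine ⟨h2, ?_⟩
  rw [h1, dif_pos h2, canon₀_fibL]

theorem sext₂_fibMk {y : Y.pt} (τ τ' : Y.O y ⊗[ℤ] fib Q (F.f y)) :
    sext₂ (((lc c Q).str (F.f y)).pairS (F.φ y))
      (tmap (Y.O y) (fibMk c (F.f y)).toAddMonoidHom τ)
      (tmap (Y.O y) (fibMk c (F.f y)).toAddMonoidHom τ') =
    ∑ i, algebraMap k (Y.O y) (c i) * sext₂ (((Q i).str (F.f y)).pairS (F.φ y))
      (tmap (Y.O y) (fibPr i (F.f y)).toAddMonoidHom τ)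
      (tmap (Y.O y) (fibPr i (F.f y)).toAddMonoidHom τ') := by
  induction τ using TensorProduct.induction_on with
  | zero => simp
  | add s t hs ht =>
    simp only [map_add, LinearMap.add_apply, hs, ht, mul_add, Finset.sum_add_distrib]
  | tmul j u =>
    induction τ' using TensorProduct.induction_on with
    | zero => simp
    | add s t hs ht => simp only [map_add, hs, ht, mul_add, Finset.sum_add_distrib]
    | tmul l v =>
      simp only [tmap_tmul, sext₂_tmul, CourantStr.pairS, biadd_apply,
        LinearMap.toAddMonoidHom_coe, fibMk_pair, map_sum, map_mul, F.const, smul_eq_mul,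
        Finset.mul_sum]
      exact Finset.sum_congr rfl fun i _ => by ring

theorem dpair_fibMk {y : Y.pt} (τ τ' : Y.O y ⊗[ℤ] fib Q (F.f y)) :
    dpair (Y.cartan y) (((lc c Q).str (F.f y)).pairS (F.φ y))
      (tmap (Y.O y) (fibMk c (F.f y)).toAddMonoidHom τ)
      (tmap (Y.O y) (fibMk c (F.f y)).toAddMonoidHom τ') =
    ∑ i, algebraMap k (Y.O y) (c i) • dpair (Y.cartan y) (((Q i).str (F.f y)).pairS (F.φ y))
      (tmap (Y.O y) (fibPr i (F.f y)).toAddMonoidHom τ)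
      (tmap (Y.O y) (fibPr i (F.f y)).toAddMonoidHom τ') := by
  induction τ using TensorProduct.induction_on with
  | zero => simp
  | add s t hs ht =>
    simp only [map_add, AddMonoidHom.add_apply, hs, ht, smul_add, Finset.sum_add_distrib]
  | tmul j u =>
    induction τ' using TensorProduct.induction_on with
    | zero => simp
    | add s t hs ht => simp only [map_add, hs, ht, smul_add, Finset.sum_add_distrib]
    | tmul l v =>
      simp only [tmap_tmul, dpair_tmul, CourantStr.pairS, biadd_apply,
        LinearMap.toAddMonoidHom_coe, fibMk_pair, map_sum, map_mul, F.const,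
        Finset.sum_smul, Finset.smul_sum, mul_smul]
      exact Finset.sum_congr rfl fun i _ => smul_comm _ _ _

theorem fibBr_mem {y : Y.pt} {α β γ : Y.Ω.E y} {τ τ' : Y.O y ⊗[ℤ] fib Q (F.f y)}
    {ξ η : Y.T.E y} (h : (α, τ, ξ) ∈ fibK F Q y) (h' : (β, τ', η) ∈ fibK F Q y) :
    (γ, brT (fibBr (F.f y)) τ τ' - derT (Y.cartan y) _ η τ + derT (Y.cartan y) _ ξ τ',
      (Y.cartan y).lie ξ η) ∈ fibK F Q y := by
  have := LieAlgd.pullBr_mem (fibK_A h) (fibK_A h')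
  rw [← tmap_brT (fibProj (F.f y)).toAddMonoidHom (fibBr (F.f y)) (A.str (F.f y)).br
    (fun _ _ => rfl), ← tmap_derT, ← tmap_derT, ← map_sub, ← map_add] at this
  exact this

theorem fibL_br {y : Y.pt} {α β : Y.Ω.E y} {τ τ' : Y.O y ⊗[ℤ] fib Q (F.f y)}
    {ξ η : Y.T.E y} (h : (α, τ, ξ) ∈ fibK F Q y) (h' : (β, τ', η) ∈ fibK F Q y) :
    (((lc c Q).pull F).str y).br (fibL c y α τ ξ h) (fibL c y β τ' η h') =
      fibL c y ((Y.cartan y).L ξ β - ((Y.cartan y).L η α - (Y.cartan y).d ((Y.cartan y).ι η α)) +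
        ∑ i, algebraMap k (Y.O y) (c i) • dpair (Y.cartan y)
          (((Q i).str (F.f y)).pairS (F.φ y))
          (tmap (Y.O y) (fibPr i (F.f y)).toAddMonoidHom τ)
          (tmap (Y.O y) (fibPr i (F.f y)).toAddMonoidHom τ'))
        (brT (fibBr (F.f y)) τ τ' - derT (Y.cartan y) _ η τ + derT (Y.cartan y) _ ξ τ')
        ((Y.cartan y).lie ξ η) (fibBr_mem h h') := by
  refine (pullMk_br (fibK_lc c h) (fibK_lc c h')).trans (pullMk_congr ?_ ?_ rfl)
  · rw [dpair_fibMk]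
  · rw [map_add, map_sub, tmap_brT (fibMk c (F.f y)).toAddMonoidHom (fibBr (F.f y))
      ((lc c Q).str (F.f y)).br (fun u v => fibMk_br c (F.f y) u v), tmap_derT, tmap_derT]

/-- The brackets of the `f⁺⁺Qᵢ` produce one-forms in each component, which the push-out collects
with the coefficients `cᵢ`; they add up to the one-form in `fibL_br`. -/
theorem fibR_br {y : Y.pt} {α β : Y.Ω.E y} {τ τ' : Y.O y ⊗[ℤ] fib Q (F.f y)}
    {ξ η : Y.T.E y} (h : (α, τ, ξ) ∈ fibK F Q y) (h' : (β, τ', η) ∈ fibK F Q y) :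
    ((lc c fun i => (Q i).pull F).str y).br (fibR c y α τ ξ h) (fibR c y β τ' η h') =
      fibR c y ((Y.cartan y).L ξ β - ((Y.cartan y).L η α - (Y.cartan y).d ((Y.cartan y).ι η α)) +
        ∑ i, algebraMap k (Y.O y) (c i) • dpair (Y.cartan y)
          (((Q i).str (F.f y)).pairS (F.φ y))
          (tmap (Y.O y) (fibPr i (F.f y)).toAddMonoidHom τ)
          (tmap (Y.O y) (fibPr i (F.f y)).toAddMonoidHom τ'))
        (brT (fibBr (F.f y)) τ τ' - derT (Y.cartan y) _ η τ + derT (Y.cartan y) _ ξ τ')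
        ((Y.cartan y).lie ξ η) (fibBr_mem h h') := by
  refine (lcMk_br (Q := fun i => (Q i).pull F) _ _ _ _ _ _ _ _).trans (Eq.symm ?_)
  refine lcMk_eq.2 ⟨fun i => dpair (Y.cartan y) (((Q i).str (F.f y)).pairS (F.φ y))
          (tmap (Y.O y) (fibPr i (F.f y)).toAddMonoidHom τ)
          (tmap (Y.O y) (fibPr i (F.f y)).toAddMonoidHom τ'), ?_, ?_, fun i => ?_⟩
  · change _ - ((Y.cartan y).L ξ β - (Y.cartan y).L η α +
      (Y.cartan y).d ((Y.cartan y).ι η α)) = _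
    abel
  · refine Eq.trans (LieAlgd.pullMk_congr ?_ rfl)
      (LieAlgd.pullMk_br (fibK_A h) (fibK_A h')).symm
    rw [map_add, map_sub, tmap_brT (fibProj (F.f y)).toAddMonoidHom (fibBr (F.f y))
      (A.str (F.f y)).br (fun _ _ => rfl), tmap_derT, tmap_derT]
  · rw [pullMk_br (fibK_Q h i) (fibK_Q h' i), sub_eq_iff_eq_add, neg_add_eq_sub,
      eq_sub_iff_add_eq, pull_coanchor, pullMk_add]
    refine pullMk_congr (by simp) ?_ (add_zero _)
    rw [map_add, map_sub, tmap_brT (fibPr i (F.f y)).toAddMonoidHom (fibBr (F.f y))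
      ((Q i).str (F.f y)).br (fun _ _ => rfl), tmap_derT, tmap_derT, add_zero]

theorem zero_mem_fibK {y : Y.pt} (α : Y.Ω.E y) :
    (α, (0 : Y.O y ⊗[ℤ] fib Q (F.f y)), (0 : Y.T.E y)) ∈ fibK F Q y := by
  have : ((0 : Y.O y ⊗[ℤ] A.A.E (F.f y)), (0 : Y.T.E y)) ∈
    MSheaf.interior (M := A.pullP F) (A.pullK F) y := Submodule.zero_mem _
  rw [← map_zero (tmap (Y.O y) (fibProj (Q := Q) (F.f y)).toAddMonoidHom)] at this
  exact this

variable (Q) in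
/-- The canonical map `f⁺⁺(∑ cᵢ Qᵢ) → ∑ cᵢ f⁺⁺Qᵢ`. -/
noncomputable def canon (hF : F.PullsForms) (hA : A.A.LocallyFree)
    (hQ : ∀ i, (Q i).IsExtension) : ((lc c Q).pull F).Hom (lc c fun i => (Q i).pull F) where
  φ := canon₀ c hF hA hQ
  sec := canon₀_sec c hF hA hQ
  br y e e' := by
    obtain ⟨α, τ, ξ, h, rfl⟩ := exists_fibL c hF e
    obtain ⟨β, τ', η, h', rfl⟩ := exists_fibL c hF e'
    rw [fibL_br, canon₀_fibL, canon₀_fibL, canon₀_fibL, fibR_br]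
  anchor y e := by
    obtain ⟨α, τ, ξ, h, rfl⟩ := exists_fibL c hF e
    rw [canon₀_fibL]
    rfl
  pair y e e' := by
    obtain ⟨α, τ, ξ, h, rfl⟩ := exists_fibL c hF e
    obtain ⟨β, τ', η, h', rfl⟩ := exists_fibL c hF e'
    rw [canon₀_fibL, canon₀_fibL]
    refine (lcMk_pair (Q := fun i => (Q i).pull F) _ _ _ _ _ _ _ _).trans
      (Eq.trans ?_ (pullMk_pair (fibK_lc c h) (fibK_lc c h')).symm)
    rw [sext₂_fibMk]
    refine congrArg₂ (· + ·) rfl (Finset.sum_congr rfl fun i _ => congrArg (_ * ·) ?_)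
    refine (pullMk_pair (fibK_Q h i) (fibK_Q h' i)).trans ?_
    rw [map_zero, map_zero, zero_add, zero_add]
  coanchor y α := by
    have h1 : (((lc c Q).pull F).str y).coanchor α = fibL c y α 0 0 (zero_mem_fibK α) :=
      (pull_coanchor _ _).trans (pullMk_congr rfl (map_zero _).symm rfl)
    rw [h1, canon₀_fibL]
    exact lcMk_congr rfl ((LieAlgd.pullMk_congr (map_zero _) rfl).trans (LieAlgd.pullMk_zero y))
      fun i => (pullMk_congr rfl (map_zero _) rfl).trans (pullMk_zero y)
  proj y e := by
    obtain ⟨α, τ, ξ, h, rfl⟩ := exists_fibL c hF e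
    rw [canon₀_fibL]
    exact ((pullMk_proj _ _ _ _).trans
      (LieAlgd.pullMk_congr (tmap_proj_fibMk F c τ) rfl)).symm

theorem canon_fibL (hF : F.PullsForms) (hA : A.A.LocallyFree) (hQ : ∀ i, (Q i).IsExtension)
    {y : Y.pt} {α : Y.Ω.E y} {τ : Y.O y ⊗[ℤ] fib Q (F.f y)} {ξ : Y.T.E y}
    (h : (α, τ, ξ) ∈ fibK F Q y) :
    (canon Q c hF hA hQ).φ y (fibL c y α τ ξ h) = fibR c y α τ ξ h :=
  canon₀_fibL c hF hA hQ h

theorem pullMap_pullMk {P R : CourantOver A} (ψ : P.Hom R) (y : Y.pt) (α : Y.Ω.E y)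
    (t : Y.O y ⊗[ℤ] P.Q.E (F.f y)) (ξ : Y.T.E y) (h) :
    (pullMap F ψ).φ y (P.pullMk F y α t ξ h) =
      R.pullMk F y α (tmap (Y.O y) (ψ.φ (F.f y)).toAddMonoidHom t) ξ
        (pullMap₀_C F ψ y (α, t, ξ) h) := rfl

theorem tmap_congr_comp {S B C D E : Type u} [CommRing S] [AddCommGroup B] [AddCommGroup C]
    [AddCommGroup D] [AddCommGroup E] {f : B →+ C} {g : C →+ E} {f' : B →+ D} {g' : D →+ E}
    (h : ∀ b, g (f b) = g' (f' b)) (t : S ⊗[ℤ] B) :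
    tmap S g (tmap S f t) = tmap S g' (tmap S f' t) := by
  rw [tmap_comp, tmap_comp]
  exact congrArg (fun e => tmap S e t) (AddMonoidHom.ext h)

/-- The map of fibre products induced by morphisms `Qᵢ → Rᵢ`. -/
def fibMap {R : Fin n → CourantOver A} (ψ : ∀ i, (Q i).Hom (R i)) (x : X.pt) :
    fib Q x →+ fib R x where
  toFun u := ⟨(u.1.1, fun i => (ψ i).φ x (u.1.2 i)), fun i => ((ψ i).proj x _).trans (u.2 i)⟩
  map_zero' := Subtype.ext (Prod.ext rfl (funext fun _ => map_zero _))
  map_add' _ _ := Subtype.ext (Prod.ext rfl (funext fun _ => map_add _ _ _))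

theorem fibMap_mem {R : Fin n → CourantOver A} (ψ : ∀ i, (Q i).Hom (R i)) {y : Y.pt}
    {α : Y.Ω.E y} {τ : Y.O y ⊗[ℤ] fib Q (F.f y)} {ξ : Y.T.E y} (h : (α, τ, ξ) ∈ fibK F Q y) :
    (α, tmap (Y.O y) (fibMap ψ (F.f y)) τ, ξ) ∈ fibK F R y := by
  have h1 : tmap (Y.O y) (fibProj (F.f y)).toAddMonoidHom (tmap (Y.O y) (fibMap ψ (F.f y)) τ) =
      tmap (Y.O y) (fibProj (F.f y)).toAddMonoidHom τ := tmap_comp _ _ _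
  have h2 := fibK_A h
  rw [← h1] at h2
  exact h2

theorem canon_nat (hF : F.PullsForms) (hA : A.A.LocallyFree) (hQ : ∀ i, (Q i).IsExtension)
    {R : Fin n → CourantOver A} (hR : ∀ i, (R i).IsExtension) (ψ : ∀ i, (Q i).Hom (R i)) (y : Y.pt)
    (e : ((lc c Q).pull F).Q.E y) :
    (canon R c hF hA hR).φ y ((pullMap F (lcMap c ψ)).φ y e) =
      (lcMap c fun i => pullMap F (ψ i)).φ y ((canon Q c hF hA hQ).φ y e) := by
  obtain ⟨α, τ, ξ, h, rfl⟩ := exists_fibL c hF e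
  have h1 : (pullMap F (lcMap c ψ)).φ y (fibL c y α τ ξ h) =
      fibL c y α (tmap (Y.O y) (fibMap ψ (F.f y)) τ) ξ (fibMap_mem ψ h) :=
    (pullMap_pullMk _ _ _ _ _ _).trans
      (pullMk_congr rfl (tmap_congr_comp (f := (fibMk c (F.f y)).toAddMonoidHom)
        (g := ((lcMap c ψ).φ (F.f y)).toAddMonoidHom) (f' := fibMap ψ (F.f y))
        (g' := (fibMk c (F.f y)).toAddMonoidHom) (fun _ => rfl) τ) rfl)
  rw [h1, canon_fibL, canon_fibL]
  refine Eq.trans ?_ (lcMap₀_mk (Q := fun i => (Q i).pull F)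
    (fun i => pullMap F (ψ i)) _ _ _ _ _).symm
  exact lcMk_congr rfl (LieAlgd.pullMk_congr (tmap_comp _ _ _) rfl) fun i =>
    Eq.trans (pullMk_congr rfl (tmap_congr_comp (f := fibMap ψ (F.f y))
        (g := (fibPr i (F.f y)).toAddMonoidHom) (f' := (fibPr i (F.f y)).toAddMonoidHom)
        (g' := ((ψ i).φ (F.f y)).toAddMonoidHom) (fun _ => rfl) τ) rfl)
      (pullMap_pullMk (ψ i) _ _ _ _ (fibK_Q h i)).symm

theorem canon_unit (hF : F.PullsForms) (hA : A.A.LocallyFree) (hQ : ∀ i, (Q i).IsExtension)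
    (i : Fin n) (hc : c = Pi.single i 1) (y : Y.pt) (e : ((lc c Q).pull F).Q.E y) :
    (lcUnit (fun i => (Q i).pull F) i hc).φ y ((canon Q c hF hA hQ).φ y e) =
      (pullMap F (lcUnit Q i hc)).φ y e := by
  obtain ⟨α, τ, ξ, h, rfl⟩ := exists_fibL c hF e
  rw [canon_fibL]
  refine (lcUnit₀_mk (Q := fun i => (Q i).pull F) i hc _ _ _ _ _).trans ?_
  refine Eq.trans ?_ (pullMap_pullMk (lcUnit Q i hc) _ _ _ _ (fibK_lc c h)).symm
  rw [pull_coanchor, pullMk_add]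
  refine pullMk_congr (zero_add _) ?_ (add_zero _)
  rw [add_zero, tmap_comp]
  refine congrArg (fun e => tmap (Y.O y) e τ) (AddMonoidHom.ext fun u => ?_)
  refine Eq.trans ?_ (lcUnit₀_mk (Q := Q) i hc _ _ _ _ _).symm
  rw [map_zero, add_zero]
  rfl

variable {m : ℕ} {b : Fin m → k} {M : Fin m → Fin n → k}

variable (M) in
/-- The map from the fibre product of the `Qᵢ` to that of the linear combinations
`∑ᵢ Mⱼᵢ Qᵢ`. -/
noncomputable def fibAssoc (x : X.pt) : fib Q x →+ fib (fun j => lc (M j) Q) x where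
  toFun u := ⟨(fibProj x u, fun j => fibMk (M j) x u), fun j => proj_fibMk (M j) x u⟩
  map_zero' := Subtype.ext (Prod.ext rfl (funext fun _ => map_zero _))
  map_add' _ _ := Subtype.ext (Prod.ext rfl (funext fun _ => map_add _ _ _))

variable (M) in
theorem fibAssoc_mem {y : Y.pt}
    {α : Y.Ω.E y} {τ : Y.O y ⊗[ℤ] fib Q (F.f y)} {ξ : Y.T.E y} (h : (α, τ, ξ) ∈ fibK F Q y) :
    (α, tmap (Y.O y) (fibAssoc M (F.f y)) τ, ξ) ∈ fibK F (fun j => lc (M j) Q) y := by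
  have h1 : tmap (Y.O y) (fibProj (F.f y)).toAddMonoidHom
      (tmap (Y.O y) (fibAssoc M (F.f y)) τ) =
      tmap (Y.O y) (fibProj (F.f y)).toAddMonoidHom τ := tmap_comp _ _ _
  have h2 := fibK_A h
  rw [← h1] at h2
  exact h2

theorem canon_assoc (hF : F.PullsForms) (hA : A.A.LocallyFree) (hQ : ∀ i, (Q i).IsExtension)
    (hc : ∀ i, c i = ∑ j, b j * M j i) (y : Y.pt) (e : ((lc c Q).pull F).Q.E y) :
    (lcMap b fun j => canon Q (M j) hF hA hQ).φ y
      ((canon (fun j => lc (M j) Q) b hF hA fun _ => lc_isExtension hQ).φ y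
        ((pullMap F (lcAssoc Q hc)).φ y e)) =
      (lcAssoc (fun i => (Q i).pull F) hc).φ y ((canon Q c hF hA hQ).φ y e) := by
  obtain ⟨α, τ, ξ, h, rfl⟩ := exists_fibL c hF e
  have h1 : (pullMap F (lcAssoc Q hc)).φ y (fibL c y α τ ξ h) =
      fibL b y α (tmap (Y.O y) (fibAssoc M (F.f y)) τ) ξ (fibAssoc_mem M h) :=
    (pullMap_pullMk _ _ _ _ _ _).trans
      (pullMk_congr rfl (tmap_congr_comp (f := (fibMk c (F.f y)).toAddMonoidHom)
        (g := ((lcAssoc Q hc).φ (F.f y)).toAddMonoidHom) (f' := fibAssoc M (F.f y))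
        (g' := (fibMk b (F.f y)).toAddMonoidHom) (fun _ => rfl) τ) rfl)
  rw [h1, canon_fibL, canon_fibL]
  refine Eq.trans ?_ (lcAssoc₀_mk (Q := fun i => (Q i).pull F) hc _ _ _ _ _).symm
  refine (lcMap₀_mk (Q := fun j => (lc (M j) Q).pull F) _ _ _ _ _ _).trans ?_
  refine lcMk_congr rfl (LieAlgd.pullMk_congr (tmap_comp _ _ _) rfl) fun j => ?_
  refine Eq.trans (congrArg ((canon Q (M j) hF hA hQ).φ y) ?_)
    (canon_fibL (M j) hF hA hQ (α := 0) (fibK_A h))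
  exact pullMk_congr rfl (tmap_comp _ _ _) rfl

end CourantOver

/-! ### Inverse images as a morphism of vector spaces in categories -/

section LinFunctor
open CategoryTheory CourantOver

namespace CExt

variable (hF : F.PullsForms) (hA : A.A.LocallyFree)
  (h : ∀ Q : CourantOver A, Q.IsExtension → (Q.pull F).IsExtension)

/-- The canonical isomorphism `f⁺⁺(∑ cᵢ Qᵢ) ≅ ∑ cᵢ f⁺⁺Qᵢ`. -/
noncomputable def pullLc {n : ℕ} (c : Fin n → k) (Q : Fin n → CExt A) :
    (CExt.pull F A h).obj (CExt.lc c Q) ≅ CExt.lc c fun i => (CExt.pull F A h).obj (Q i) :=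
  CExt.isoOf (P := (CExt.pull F A h).obj (CExt.lc c Q))
    (Q := CExt.lc c fun i => (CExt.pull F A h).obj (Q i))
    (ObjectProperty.homMk (canon (fun i => (Q i).obj) c hF hA fun i => (Q i).property))

theorem pullLc_nat {n : ℕ} (c : Fin n → k) {x x' : Fin n → CExt A} (f : ∀ i, x i ⟶ x' i) :
    (CExt.pull F A h).map ((CExt.linCat A).map c f) ≫ (pullLc hF hA h c x').hom =
      (pullLc hF hA h c x).hom ≫
        (CExt.linCat (A.pull F)).map c (fun i => (CExt.pull F A h).map (f i)) :=
  CExt.hom_ext fun y e => canon_nat (Q := fun i => (x i).obj)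
    (R := fun i => (x' i).obj) c hF hA (fun i => (x i).property) (fun i => (x' i).property)
    (fun i => (f i).hom) y e

theorem pullLc_unit {n : ℕ} (i : Fin n) {c : Fin n → k} (hc : c = Pi.single i 1)
    (x : Fin n → CExt A) :
    (pullLc hF hA h c x).hom ≫
        ((CExt.linCat (A.pull F)).unit i hc fun i => (CExt.pull F A h).obj (x i)).hom =
      (CExt.pull F A h).map ((CExt.linCat A).unit i hc x).hom :=
  CExt.hom_ext fun y e => canon_unit (Q := fun i => (x i).obj) c hF hA
    (fun i => (x i).property) i hc y e

set_option maxHeartbeats 2000000 in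
theorem pullLc_assoc {m n : ℕ} {b : Fin m → k} {M : Fin m → Fin n → k} {c : Fin n → k}
    (hc : ∀ i, c i = ∑ j, b j * M j i) (x : Fin n → CExt A) :
    (CExt.pull F A h).map ((CExt.linCat A).assoc hc x).hom ≫
        (pullLc hF hA h b fun j => CExt.lc (M j) x).hom ≫
        (CExt.linCat (A.pull F)).map b (fun j => (pullLc hF hA h (M j) x).hom) =
      (pullLc hF hA h c x).hom ≫
        ((CExt.linCat (A.pull F)).assoc hc fun i => (CExt.pull F A h).obj (x i)).hom :=
  CExt.hom_ext fun y e => canon_assoc (Q := fun i => (x i).obj) (b := b) (M := M) c hF hA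
      (fun i => (x i).property) hc y e

/-- The inverse image functor as a morphism of `k`-vector spaces in categories. -/
noncomputable def pullLinFunctor :
    LinFunctor k (CExt.linCat A) (CExt.linCat (A.pull F)) (CExt.pull F A h) where
  iso := pullLc hF hA h
  nat := pullLc_nat hF hA h
  unit := pullLc_unit hF hA h
  assoc := pullLc_assoc hF hA h

end CExt

theorem CExt.isCanonical_pullLinFunctor (hF : F.PullsForms) (hA : A.A.LocallyFree)
    (h : ∀ Q : CourantOver A, Q.IsExtension → (Q.pull F).IsExtension) :
    IsCanonical F (CExt.pullLinFunctor hF hA h) := by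
  intro n c Q y m r a q hq ξ h₀ h₁ h₂
  let u : Fin m → fib (fun i => (Q i).obj) (F.f y) := fun s => ⟨(a s, q s), hq s⟩
  have hA' : tmap (Y.O y) (fibProj (F.f y)).toAddMonoidHom (∑ s, r s ⊗ₜ[ℤ] u s) =
      ∑ s, r s ⊗ₜ a s := by
    simp only [map_sum, tmap_tmul]
    rfl
  have hQ' : ∀ i, tmap (Y.O y) (fibPr i (F.f y)).toAddMonoidHom (∑ s, r s ⊗ₜ[ℤ] u s) =
      ∑ s, r s ⊗ₜ q s i := fun i => by
    simp only [map_sum, tmap_tmul]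
    rfl
  have hL' : tmap (Y.O y) (fibMk c (F.f y)).toAddMonoidHom (∑ s, r s ⊗ₜ[ℤ] u s) =
      ∑ s, r s ⊗ₜ lcMk c (F.f y) 0 (a s) (q s) (hq s) := by
    simp only [map_sum, tmap_tmul]
    rfl
  have hm : ((0 : Y.Ω.E y), ∑ s, r s ⊗ₜ[ℤ] u s, ξ) ∈ fibK F (fun i => (Q i).obj) y := by
    have := h₁
    rw [← hA'] at this
    exact this
  refine ⟨fun i => (pullMk_proj _ _ _ _).trans (LieAlgd.pullMk_congr ?_ rfl), ?_⟩
  · rw [← hQ' i]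
    exact (tmap_proj_fibPr F (Q := fun i => (Q i).obj) _ i).trans hA'
  · refine (congrArg ((canon (fun i => (Q i).obj) c hF hA fun i => (Q i).property).φ y)
      (pullMk_congr rfl hL'.symm rfl)).trans ((canon_fibL c hF hA _ hm).trans ?_)
    exact lcMk_congr rfl (LieAlgd.pullMk_congr hA' rfl) fun i => pullMk_congr rfl (hQ' i) rfl

universe v w v' w'

/-- Restriction of the coefficients of a morphism of modules in categories. -/
def LinFunctor.restrict {k k' : Type} [CommRing k] [CommRing k'] (φ : k' →+* k) {C : Type v}
    [Category.{w} C] {D : Type v'} [Category.{w'} D] {LC : LinCat k C} {LD : LinCat k D}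
    {G : C ⥤ D} (Φ : LinFunctor k LC LD G) : LinFunctor k' (LC.restrict φ) (LD.restrict φ) G where
  iso c x := Φ.iso (fun i => φ (c i)) x
  nat c _ _ f := Φ.nat (fun i => φ (c i)) f
  unit i _ _ x := Φ.unit i _ x
  assoc {_ _ _ M _} _ x := Φ.assoc (M := fun j i => φ (M j i)) _ x

end LinFunctor
end CanonicalHom

/-! ### Spaces with coordinates -/

section Coordinates

variable {k : Type} [Field k] {X Y : RSpace.{u} k}

/-- Values at points of the germs of functions on `X`, such that functions are determined by their
values. -/
structure RSpace.Values (X : RSpace.{u} k) where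
  val : ∀ x, X.O x →ₐ[k] k
  ext : ∀ {f g : ∀ x, X.O x} {x}, X.Sec f x → X.Sec g x →
    (∀ᶠ y in 𝓝 x, val y (f y) = val y (g y)) → f x = g x

/-- Coordinates near `x`: functions `uⱼ` and vector fields `∂ⱼ` such that near `x` every function
has first order Taylor expansions in the `uⱼ` with the values of `∂ⱼ g` as linear coefficients. -/
structure RSpace.Values.Coordinates (V : X.Values) (x : X.pt) where
  r : ℕ
  u : Fin r → ∀ y, X.O y
  D : Fin r → ∀ y, Derivation k (X.O y) (X.O y)
  u_sec : ∀ j, X.Sec (u j) x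
  D_good : ∀ j, X.derData.Good (D j) x
  taylor : ∀ᶠ y in 𝓝 x, ∀ g : X.O y, ∃ a : Fin r → X.O y,
    g = algebraMap k _ (V.val y g) +
      ∑ j, (u j y - algebraMap k _ (V.val y (u j y))) * a j ∧
    ∀ j, V.val y (a j) = V.val y (D j y g)

/-- One-forms are determined near a point by their contractions with vector fields. -/
theorem RSpace.sec_ι_ext {α β : ∀ y, Y.Ω.E y} {y : Y.pt} (hα : Y.Ω.Sec α y) (hβ : Y.Ω.Sec β y)
    (h : ∀ᶠ y' in 𝓝 y, ∀ ξ, (Y.cartan y').ι ξ (α y') = (Y.cartan y').ι ξ (β y')) :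
    α y = β y := by
  obtain ⟨θ, hθ, h1⟩ := hα
  obtain ⟨θ', hθ', h1'⟩ := hβ
  rw [h1.self_of_nhds, h1'.self_of_nhds]
  refine GermData.germ_congr hθ ?_
  filter_upwards [h, h1, h1', Y.formData.near hθ, Y.formData.near hθ'] with y' h h1 h1' h2 h2'
  refine LinearMap.ext fun ξ => ?_
  have := h ξ
  rw [h1, h1'] at this
  exact (ι_germ ξ h2).symm.trans (this.trans (ι_germ ξ h2'))

/-- Vector fields are determined near a point by their action on functions. -/
theorem RSpace.sec_act_ext {δ δ' : ∀ y, Y.T.E y} {y : Y.pt} (hδ : Y.T.Sec δ y)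
    (hδ' : Y.T.Sec δ' y)
    (h : ∀ᶠ y' in 𝓝 y, ∀ g, (Y.cartan y').act (δ y') g = (Y.cartan y').act (δ' y') g) :
    δ y = δ' y := by
  obtain ⟨D, hD, h1⟩ := hδ
  obtain ⟨D', hD', h1'⟩ := hδ'
  rw [h1.self_of_nhds, h1'.self_of_nhds]
  refine GermData.germ_congr hD ?_
  filter_upwards [h, h1, h1', Y.derData.near hD, Y.derData.near hD'] with y' h h1 h1' h2 h2'
  refine Derivation.ext fun g => ?_
  have := h g
  rw [h1, h1'] at this
  exact (act_germ h2 g).symm.trans (this.trans (act_germ h2' g))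

/-- The chain rule for a vector field along `F`; both sides have the same values, by first order
Taylor expansion at each point. -/
theorem RSpace.Values.Coordinates.chain_rule {F : SpMap Y X} {VX : X.Values} {VY : Y.Values}
    (hF : ∀ y g, VY.val y (F.φ y g) = VX.val (F.f y) g) {y : Y.pt}
    (C : VX.Coordinates (F.f y)) :
    ∀ᶠ y' in 𝓝 y, ∀ (ξ : Y.T.E y') (g : X.O (F.f y')), (Y.cartan y').act ξ (F.φ y' g) =
      ∑ j, F.φ y' (C.D j (F.f y') g) * (Y.cartan y').act ξ (F.φ y' (C.u j (F.f y'))) := by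
  have key : ∀ᶠ x in 𝓝 (F.f y), (∀ g : X.O x, ∃ a : Fin C.r → X.O x,
      g = algebraMap k _ (VX.val x g) +
        ∑ j, (C.u j x - algebraMap k _ (VX.val x (C.u j x))) * a j ∧
      ∀ j, VX.val x (a j) = VX.val x (C.D j x g)) ∧
      (∀ j, X.Sec (C.u j) x) ∧ ∀ j, X.derData.Good (C.D j) x := by
    filter_upwards [C.taylor, eventually_all.2 fun j => X.etale.near (C.u_sec j),
      eventually_all.2 fun j => X.derData.near (C.D_good j)] with x h1 h2 h3
    exact ⟨h1, h2, h3⟩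
  filter_upwards [eventually_eventually_nhds.2 (F.cont.continuousAt.eventually key)] with y' hy' ξ g
  obtain ⟨g, hg, rfl⟩ := X.etale.exists_sec (F.f y') g
  obtain ⟨ξ, hξ, rfl⟩ := Y.T.etale.exists_sec y' ξ
  obtain ⟨-, hu, hD⟩ := hy'.self_of_nhds
  refine VY.ext (f := fun y' => (Y.cartan y').act (ξ y') (F.φ y' (g (F.f y'))))
    (g := fun y' => ∑ j, F.φ y' (C.D j (F.f y') (g (F.f y'))) *
      (Y.cartan y').act (ξ y') (F.φ y' (C.u j (F.f y'))))
    (RSpace.cartan_act hξ (F.sec hg)) ?_ ?_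
  · exact RSpace.sum _ _ fun j => Y.mul (F.sec ((hD j).self_of_nhds g hg))
      (RSpace.cartan_act hξ (F.sec (hu j)))
  · filter_upwards [hy'] with z hz
    obtain ⟨a, ha, ha'⟩ := hz.1 (g (F.f z))
    have h1 : F.φ z (g (F.f z)) = algebraMap k _ (VX.val (F.f z) (g (F.f z))) +
        ∑ j, (F.φ z (C.u j (F.f z)) - algebraMap k _ (VX.val (F.f z) (C.u j (F.f z)))) *
          F.φ z (a j) := by
      conv_lhs => rw [ha]
      simp only [map_add, map_sum, map_mul, map_sub, F.const]
    rw [h1]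
    simp only [map_add, map_sum, map_mul, (Y.cartan z).act_mul, map_sub, (Y.cartan z).act_const,
      hF, ← ha', AlgHom.commutes, Algebra.algebraMap_self_apply, sub_self, zero_mul, zero_add,
      sub_zero]
    exact Finset.sum_congr rfl fun j _ => mul_comm _ _

/-- If the target has coordinates, then one-forms can be pulled back by
`α ↦ ∑ⱼ F^*(α(∂ⱼ)) d(F^*uⱼ)`. -/
theorem SpMap.pullsForms_of_coordinates {F : SpMap Y X} (VX : X.Values) (VY : Y.Values)
    (hF : ∀ y g, VY.val y (F.φ y g) = VX.val (F.f y) g)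
    (C : ∀ x, Nonempty (VX.Coordinates x)) : F.PullsForms where
  span_d x := by
    obtain ⟨C⟩ := C x
    refine eq_top_iff.2 fun α _ => ?_
    obtain ⟨α, hα, rfl⟩ := X.Ω.etale.exists_sec x α
    have h1 := RSpace.sec_ι_ext (Y := X) (β := fun y =>
      ∑ j, (X.cartan y).ι (X.derData.germ y (C.D j)) (α y) • (X.cartan y).d (C.u j y)) hα
      (X.Ω.sum _ (fun j y => (X.cartan y).ι (X.derData.germ y (C.D j)) (α y) •
        (X.cartan y).d (C.u j y)) fun j => X.Ω.smul
          (RSpace.cartan_ι (GermData.germ_sec (C.D_good j)) hα) (RSpace.cartan_d (C.u_sec j))) ?_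
    · rw [h1]
      exact Submodule.sum_mem _ fun j _ => Submodule.smul_mem _ _ (Submodule.subset_span ⟨_, rfl⟩)
    · -- the chain rule for the identity: `ξ = ∑ⱼ ξ(uⱼ) ∂ⱼ`
      let I : SpMap X X :=
        { f := id, cont := continuous_id, φ := fun x => RingHom.id _, const := fun _ _ => rfl
          sec := fun h => h }
      filter_upwards [eventually_eventually_nhds.2
        (C.chain_rule (F := I) (VX := VX) (VY := VX) (fun _ _ => rfl)),
        eventually_all.2 fun j => (X.etale.near (C.u_sec j)).and
          (X.derData.near (C.D_good j))] with y hy1 hy2 ξ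
      have hy := And.intro hy1 hy2
      have h2 : ξ = ∑ j, (X.cartan y).act ξ (C.u j y) • X.derData.germ y (C.D j) := by
        obtain ⟨ξ, hξ, rfl⟩ := X.T.etale.exists_sec y ξ
        refine RSpace.sec_act_ext (δ' := fun y => ∑ j, (X.cartan y).act (ξ y) (C.u j y) •
          X.derData.germ y (C.D j)) hξ (X.T.sum _ (fun j y => (X.cartan y).act (ξ y) (C.u j y) •
            X.derData.germ y (C.D j)) fun j => X.T.smul (RSpace.cartan_act hξ (hy.2 j).1)
              (GermData.germ_sec (hy.2 j).2)) ?_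
        filter_upwards [hy.1, eventually_all.2 fun j => X.derData.near (hy.2 j).2]
          with z hz hz' g
        refine (hz (ξ z) g).trans ?_
        simp only [map_sum, AddMonoidHom.finsetSum_apply, (X.cartan z).act_smul]
        refine Finset.sum_congr rfl fun j _ => ?_
        rw [mul_comm]
        exact congrArg (_ * ·) (RSpace.act_germ (hz' j) g).symm
      conv_lhs => rw [h2]
      simp only [map_sum, map_smul, LinearMap.sum_apply, LinearMap.smul_apply, smul_eq_mul,
        (X.cartan y).ι_d]
      exact Finset.sum_congr rfl fun j _ => mul_comm _ _
  exists_formPull y := by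
    obtain ⟨C⟩ := C (F.f y)
    refine ⟨AddMonoidHom.mk' (fun α => ∑ j, F.φ y ((X.cartan (F.f y)).ι
      (X.derData.germ (F.f y) (C.D j)) α) • (Y.cartan y).d (F.φ y (C.u j (F.f y))))
      (fun α β => by simp only [map_add, add_smul, Finset.sum_add_distrib]), fun g α => ?_,
      fun g => ?_⟩
    · simp only [AddMonoidHom.mk'_apply, map_smul, smul_eq_mul, map_mul, mul_smul,
        Finset.smul_sum]
    · obtain ⟨g, hg, rfl⟩ := X.etale.exists_sec (F.f y) g
      simp only [AddMonoidHom.mk'_apply, (X.cartan (F.f y)).ι_d]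
      have hD : ∀ᶠ y' in 𝓝 y, ∀ j, X.derData.Good (C.D j) (F.f y') :=
        F.cont.continuousAt.eventually (eventually_all.2 fun j => X.derData.near (C.D_good j))
      refine RSpace.sec_ι_ext (α := fun y => ∑ j, F.φ y ((X.cartan (F.f y)).act
        (X.derData.germ (F.f y) (C.D j)) (g (F.f y))) • (Y.cartan y).d (F.φ y (C.u j (F.f y))))
        (β := fun y => (Y.cartan y).d (F.φ y (g (F.f y))))
        (Y.Ω.sum _ (fun j y => F.φ y ((X.cartan (F.f y)).act
          (X.derData.germ (F.f y) (C.D j)) (g (F.f y))) • (Y.cartan y).d (F.φ y (C.u j (F.f y))))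
          fun j => Y.Ω.smul (F.sec (RSpace.cartan_act (GermData.germ_sec (C.D_good j)) hg))
            (RSpace.cartan_d (F.sec (C.u_sec j)))) (RSpace.cartan_d (F.sec hg)) ?_
      filter_upwards [C.chain_rule hF, hD] with z hz hz' ξ
      rw [(Y.cartan z).ι_d, hz]
      simp only [map_sum, map_smul, smul_eq_mul, (Y.cartan z).ι_d]
      refine Finset.sum_congr rfl fun j _ => ?_
      congr 2
      exact RSpace.act_germ (hz' j) _

end Coordinates

/-! ### Hadamard's lemma -/

section Hadamard

universe v

variable {K : Type} [RCLike K] {E : Type v} [NormedAddCommGroup E] [NormedSpace K E]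

/-- The weighted mean `∫₀¹ tʲ g(x₀ + t(x - x₀)) dt` of `g` over the segment from `x₀` to `x`. -/
noncomputable def segmentMean {G : Type v} [NormedAddCommGroup G] [NormedSpace K G]
    [NormedSpace ℝ G] (x₀ : E) (j : ℕ) (g : E → G) (x : E) : G :=
  ∫ t in (0 : ℝ)..1, (t : K) ^ j • g (x₀ + (t : K) • (x - x₀))

theorem segment_mem_ball {x₀ x : E} {r t : ℝ} (hx : x ∈ Metric.ball x₀ r)
    (ht : t ∈ Set.uIcc (0 : ℝ) 1) : x₀ + (t : K) • (x - x₀) ∈ Metric.ball x₀ r := by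
  rw [Set.uIcc_of_le zero_le_one] at ht
  rw [mem_ball_iff_norm] at hx ⊢
  rw [add_sub_cancel_left, norm_smul, RCLike.norm_ofReal, abs_of_nonneg ht.1]
  exact (mul_le_of_le_one_left (norm_nonneg _) ht.2).trans_lt hx

theorem continuousOn_segment {G : Type v} [NormedAddCommGroup G] [NormedSpace K G]
    {x₀ x : E} {r : ℝ} {g : E → G} (hg : ContinuousOn g (Metric.ball x₀ r))
    (hx : x ∈ Metric.ball x₀ r) (j : ℕ) :
    ContinuousOn (fun t : ℝ => (t : K) ^ j • g (x₀ + (t : K) • (x - x₀))) (Set.uIcc 0 1) := by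
  refine ContinuousOn.smul (by fun_prop) (hg.comp (by fun_prop) fun t ht => segment_mem_ball hx ht)

/-- Differentiation under the integral sign; the derivative is again a weighted mean. -/
theorem hasFDerivAt_segmentMean [FiniteDimensional K E] {G : Type v} [NormedAddCommGroup G]
    [NormedSpace K G] [NormedSpace ℝ G] {x₀ x : E} {r : ℝ} {g : E → G}
    (hg : ContDiffOn K 1 g (Metric.ball x₀ r)) (hx : x ∈ Metric.ball x₀ r) (j : ℕ) :
    HasFDerivAt (segmentMean (K := K) x₀ j g)
      (segmentMean (K := K) x₀ (j + 1) (fderiv K g) x) x := by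
  have : ProperSpace E := FiniteDimensional.proper_rclike K E
  obtain ⟨ρ, hρ, hρr⟩ := exists_between (Metric.mem_ball.1 hx)
  have hg' : ContinuousOn (fderiv K g) (Metric.ball x₀ r) :=
    hg.continuousOn_fderiv_of_isOpen Metric.isOpen_ball le_rfl
  obtain ⟨C, hC⟩ := (isCompact_closedBall x₀ ρ).exists_bound_of_continuousOn
    (hg'.mono (Metric.closedBall_subset_ball hρr))
  refine intervalIntegral.hasFDerivAt_integral_of_dominated_of_fderiv_le
    (F := fun x (t : ℝ) => (t : K) ^ j • g (x₀ + (t : K) • (x - x₀)))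
    (F' := fun x (t : ℝ) => (t : K) ^ (j + 1) • fderiv K g (x₀ + (t : K) • (x - x₀)))
    (s := Metric.ball x₀ ρ) (bound := fun _ => C) (Metric.isOpen_ball.mem_nhds hρ) ?_ ?_ ?_ ?_
    intervalIntegrable_const ?_
  · filter_upwards [Metric.isOpen_ball.mem_nhds hx] with y hy
    exact ((continuousOn_segment hg.continuousOn hy j).mono
      Set.uIoc_subset_uIcc).aestronglyMeasurable measurableSet_uIoc
  · exact (continuousOn_segment hg.continuousOn hx j).intervalIntegrable
  · exact ((continuousOn_segment hg' hx (j + 1)).mono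
      Set.uIoc_subset_uIcc).aestronglyMeasurable measurableSet_uIoc
  · refine Eventually.of_forall fun t ht y hy => ?_
    have ht' := Set.uIoc_subset_uIcc ht
    have h1 := hC _ (Metric.ball_subset_closedBall (segment_mem_ball (K := K) hy ht'))
    rw [Set.uIcc_of_le zero_le_one] at ht'
    rw [norm_smul, norm_pow, RCLike.norm_ofReal, abs_of_nonneg ht'.1]
    exact (mul_le_of_le_one_left (norm_nonneg _) (pow_le_one₀ ht'.1 ht'.2)).trans h1
  · refine Eventually.of_forall fun t ht y hy => ?_
    have h1 := segment_mem_ball (K := K) (Metric.ball_subset_ball hρr.le hy)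
      (Set.uIoc_subset_uIcc ht)
    have h2 := ((hg.differentiableOn one_ne_zero).differentiableAt
      (Metric.isOpen_ball.mem_nhds h1)).hasFDerivAt
    have h3 : HasFDerivAt (fun y : E => x₀ + (t : K) • (y - x₀))
        ((t : K) • ContinuousLinearMap.id K E) y :=
      (((hasFDerivAt_id y).sub_const x₀).const_smul (t : K)).const_add x₀
    refine ((h2.comp y h3).const_smul ((t : K) ^ j)).congr_fderiv ?_
    ext v
    simp only [smul_apply, ContinuousLinearMap.comp_apply,
      ContinuousLinearMap.id_apply, map_smul, pow_succ, mul_smul]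

theorem contDiffOn_segmentMean [FiniteDimensional K E] (m : ℕ) {x₀ : E} {r : ℝ} :
    ∀ {G : Type v} [NormedAddCommGroup G] [NormedSpace K G] [NormedSpace ℝ G] {g : E → G}
      (j : ℕ), ContDiffOn K (m + 1) g (Metric.ball x₀ r) →
      ContDiffOn K m (segmentMean (K := K) x₀ j g) (Metric.ball x₀ r) := by
  induction m with
  | zero =>
    intro G _ _ _ g j hg
    refine contDiffOn_zero.2 fun x hx => ?_
    exact (hasFDerivAt_segmentMean (by simpa using hg) hx j).continuousAt.continuousWithinAt
  | succ m ih =>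
    intro G _ _ _ g j hg
    have h1 : ContDiffOn K 1 g (Metric.ball x₀ r) := hg.of_le (by simp)
    have h2 := fun x hx => hasFDerivAt_segmentMean (x := x) h1 hx j
    push_cast
    rw [contDiffOn_succ_iff_fderiv_of_isOpen Metric.isOpen_ball]
    refine ⟨fun x hx => (h2 x hx).differentiableAt.differentiableWithinAt, by simp, ?_⟩
    refine (ih (j + 1) (hg.fderiv_of_isOpen Metric.isOpen_ball ?_)).congr
      fun x hx => (h2 x hx).fderiv
    push_cast
    exact le_rfl

/-- Hadamard's lemma for analytic functions: shift the power series. -/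
theorem AnalyticAt.exists_eq_add_clm_apply {G : Type*} [NormedAddCommGroup G] [NormedSpace K G]
    [CompleteSpace G] {h : E → G} {x₀ : E} (hh : AnalyticAt K h x₀) :
    ∃ g : E → E →L[K] G, AnalyticAt K g x₀ ∧ ∀ᶠ x in 𝓝 x₀, h x = h x₀ + g x (x - x₀) := by
  obtain ⟨p, r, hp⟩ := hh
  have hpos : 0 < p.shift.radius := by
    rw [FormalMultilinearSeries.radius_shift]
    exact hp.r_pos.trans_le hp.r_le
  have hq : HasFPowerSeriesOnBall (fun x => p.shift.sum (x - x₀)) p.shift x₀ p.shift.radius := by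
    simpa using (p.shift.hasFPowerSeriesOnBall hpos).comp_sub x₀
  refine ⟨fun x => p.shift.sum (x - x₀), hq.analyticAt, ?_⟩
  have hu : p.shift.unshift (h x₀) = p := by
    funext m
    cases m with
    | zero =>
      ext v
      exact (hp.coeff_zero v).symm
    | succ m => exact ContinuousMultilinearMap.uncurry_curryRight _
  have h1 := hq.unshift (z := h x₀)
  rw [hu] at h1
  filter_upwards [Metric.eball_mem_nhds x₀ hp.r_pos, Metric.eball_mem_nhds x₀ hpos]
    with x hx hx'
  exact (hp.hasSum_sub hx).unique (h1.hasSum_sub hx')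

/-- Hadamard's lemma for smooth functions: integrate the derivative along segments. -/
theorem exists_eq_add_clm_apply_of_contDiffOn_infty [FiniteDimensional K E] {G : Type}
    [NormedAddCommGroup G] [NormedSpace K G] [NormedSpace ℝ G] [CompleteSpace G] {h : E → G}
    {x₀ : E} {r : ℝ} (hh : ContDiffOn K ((⊤ : ℕ∞) : WithTop ℕ∞) h (Metric.ball x₀ r)) :
    ∃ g : E → E →L[K] G, ContDiffOn K ((⊤ : ℕ∞) : WithTop ℕ∞) g (Metric.ball x₀ r) ∧
      ∀ x ∈ Metric.ball x₀ r, h x = h x₀ + g x (x - x₀) := by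
  have hd : ContDiffOn K ((⊤ : ℕ∞) : WithTop ℕ∞) (fderiv K h) (Metric.ball x₀ r) :=
    hh.fderiv_of_isOpen Metric.isOpen_ball (by simp)
  refine ⟨segmentMean (K := K) x₀ 0 (fderiv K h), contDiffOn_infty.2 fun m =>
    contDiffOn_segmentMean m 0 (hd.of_le (by exact_mod_cast le_top)), fun x hx => ?_⟩
  have hc := continuousOn_segment (K := K) hd.continuousOn hx 0
  have h1 : ∀ t ∈ Set.uIcc (0 : ℝ) 1, HasDerivAt (fun t : ℝ => h (x₀ + (t : K) • (x - x₀)))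
      (((t : K) ^ 0 • fderiv K h (x₀ + (t : K) • (x - x₀))) (x - x₀)) t := by
    intro t ht
    have h2 := ((hh.differentiableOn (by simp)).differentiableAt
      (Metric.isOpen_ball.mem_nhds (segment_mem_ball (K := K) hx ht))).hasFDerivAt
    have h3 : HasDerivAt (fun s : K => x₀ + s • (x - x₀)) (x - x₀) (t : K) := by
      simpa using ((hasDerivAt_id (t : K)).smul_const (x - x₀)).const_add x₀
    have h4 := (h2.comp_hasDerivAt (t : K) h3).scomp t
      (RCLike.ofRealCLM (K := K)).hasDerivAt
    simpa [Function.comp_def] using h4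
  have h5 := intervalIntegral.integral_eq_sub_of_hasDerivAt h1
    (hc.clm_apply continuousOn_const).intervalIntegrable
  rw [← ContinuousLinearMap.intervalIntegral_apply hc.intervalIntegrable] at h5
  change segmentMean x₀ 0 (fderiv K h) x (x - x₀) = _ at h5
  rw [h5]
  simp

/-- **Hadamard's lemma** for smooth and analytic functions. The value of `g` at `x₀` is the
derivative of `h`, by the product rule. -/
theorem exists_eq_add_clm_apply [FiniteDimensional K E] {G : Type}
    [NormedAddCommGroup G] [NormedSpace K G] [NormedSpace ℝ G] [CompleteSpace G]
    {n : WithTop ℕ∞} (hn : n = ((⊤ : ℕ∞) : WithTop ℕ∞) ∨ n = ⊤) {h : E → G} {x₀ : E}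
    (hh : ∀ᶠ x in 𝓝 x₀, ContDiffAt K n h x) :
    ∃ g : E → E →L[K] G, (∀ᶠ x in 𝓝 x₀, ContDiffAt K n g x) ∧
      (∀ᶠ x in 𝓝 x₀, h x = h x₀ + g x (x - x₀)) ∧ g x₀ = fderiv K h x₀ := by
  suffices H : ∃ g : E → E →L[K] G, (∀ᶠ x in 𝓝 x₀, ContDiffAt K n g x) ∧
      ∀ᶠ x in 𝓝 x₀, h x = h x₀ + g x (x - x₀) by
    obtain ⟨g, hg, hgh⟩ := H
    refine ⟨g, hg, hgh, ?_⟩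
    have hn0 : n ≠ 0 := by rcases hn with rfl | rfl <;> simp
    have h1 := (hg.self_of_nhds.differentiableAt hn0).hasFDerivAt.clm_apply
      ((hasFDerivAt_id x₀).sub_const x₀)
    have h2 := (h1.const_add (h x₀)).congr_of_eventuallyEq hgh
    rw [h2.fderiv]
    ext v
    simp
  rcases hn with rfl | rfl
  · obtain ⟨r, hr, hr'⟩ := Metric.eventually_nhds_iff_ball.1 hh
    obtain ⟨g, hg, hgh⟩ := exists_eq_add_clm_apply_of_contDiffOn_infty
      (fun x hx => (hr' x hx).contDiffWithinAt)
    have hb := Metric.ball_mem_nhds x₀ hr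
    exact ⟨g, (eventually_mem_nhds_iff.2 hb).mono fun x hx => hg.contDiffAt hx,
      Filter.mem_of_superset hb hgh⟩
  · obtain ⟨g, hg, hgh⟩ := AnalyticAt.exists_eq_add_clm_apply
      (hh.self_of_nhds.analyticAt)
    exact ⟨g, hg.eventually_analyticAt.mono fun x hx => hx.contDiffAt, hgh⟩

end Hadamard

/-! ### Coordinates on manifolds -/

section ManifoldCoordinates

variable {K 𝕜 : Type} [RCLike K] [RCLike 𝕜] [NormedAlgebra K 𝕜]
  {E : Type*} [NormedAddCommGroup E] [NormedSpace K E] {n : WithTop ℕ∞}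
  {X : Type u} [TopologicalSpace X] [ChartedSpace E X]

/-- The algebra structure of the stalks of `manifoldSpace`, found by instance search also where
`(manifoldSpace K 𝕜 E n X).O x` has been unfolded. -/
instance (x : X) : Algebra 𝕜 (smoothGerms K 𝕜 E n x) := (smoothGerms.const n x).toAlgebra

variable (K E n) in
open Classical in
/-- The germ of `h` at `x` (zero, if `h` is not of class `C^n` near `x`). -/
noncomputable def smoothGerms.germ (h : X → 𝕜) (x : X) : smoothGerms K 𝕜 E n x :=
  if hx : SmoothNear K 𝕜 E n h x then ⟨_, h, hx, rfl⟩ else 0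

theorem smoothGerms.germ_of {h : X → 𝕜} {x : X} (hx : SmoothNear K 𝕜 E n h x) :
    smoothGerms.germ K E n h x = ⟨_, h, hx, rfl⟩ := dif_pos hx

theorem smoothGerms.germ_sec {h : X → 𝕜} {x : X} (hx : SmoothNear K 𝕜 E n h x) :
    (manifoldSpace K 𝕜 E n X).Sec (smoothGerms.germ K E n h) x := by
  refine ⟨h, hx, ?_⟩
  filter_upwards [eventually_eventually_nhds.2 hx] with x' hx'
  rw [germ_of hx']

/-- The values of germs of functions. -/
noncomputable def manifoldValues : (manifoldSpace K 𝕜 E n X).Values where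
  val x :=
    { toFun := fun g => g.1.value
      map_one' := rfl
      map_mul' := by
        rintro ⟨_, g, hg, rfl⟩ ⟨_, h, hh, rfl⟩
        rfl
      map_zero' := rfl
      map_add' := by
        rintro ⟨_, g, hg, rfl⟩ ⟨_, h, hh, rfl⟩
        rfl
      commutes' := fun _ => rfl }
  ext := by
    rintro f g x ⟨h, -, h2⟩ ⟨h', -, h2'⟩ he
    refine Subtype.ext ?_
    rw [h2.self_of_nhds, h2'.self_of_nhds]
    refine Germ.coe_eq.2 ?_
    filter_upwards [h2, h2', he] with y h3 h3' h4
    change (f y).1.value = (g y).1.value at h4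
    rwa [h3, h3'] at h4

theorem manifoldValues_germ {h : X → 𝕜} {x : X} (hx : SmoothNear K 𝕜 E n h x) :
    manifoldValues.val x (smoothGerms.germ K E n h x) = h x := by
  rw [smoothGerms.germ_of hx]
  rfl

variable [IsManifold 𝓘(K, E) n X]

theorem SmoothNear.contDiffAt_chart {h : X → 𝕜} {x₀ x : X} (hh : SmoothNear K 𝕜 E n h x)
    (hx : x ∈ (chartAt E x₀).source) :
    ∀ᶠ p in 𝓝 (chartAt E x₀ x), ContDiffAt K n (h ∘ (chartAt E x₀).symm) p := by
  have h1 : Tendsto (chartAt E x₀).symm (𝓝 (chartAt E x₀ x)) (𝓝 x) := by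
    have := (chartAt E x₀).continuousAt_symm ((chartAt E x₀).map_source hx)
    rwa [ContinuousAt, (chartAt E x₀).left_inv hx] at this
  filter_upwards [h1.eventually hh,
    (chartAt E x₀).open_target.mem_nhds ((chartAt E x₀).map_source hx)] with p h2 h3
  exact (h2.comp p ((contMDiffOn_chart_symm (I := 𝓘(K, E))).contMDiffAt
    ((chartAt E x₀).open_target.mem_nhds h3))).contDiffAt

theorem smoothNear_comp_chart {g : E → 𝕜} {x₀ x : X} (hx : x ∈ (chartAt E x₀).source)
    (hg : ∀ᶠ p in 𝓝 (chartAt E x₀ x), ContDiffAt K n g p) :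
    SmoothNear K 𝕜 E n (fun y => g (chartAt E x₀ y)) x := by
  filter_upwards [((chartAt E x₀).continuousAt hx).eventually hg,
    (chartAt E x₀).open_source.mem_nhds hx] with y h1 h2
  exact h1.contMDiffAt.comp y ((contMDiffOn_chart (I := 𝓘(K, E))).contMDiffAt
    ((chartAt E x₀).open_source.mem_nhds h2))

variable (K) in
/-- The derivative of `h` in the direction `v`, in the chart at `x₀`. -/
noncomputable def chartDeriv (x₀ : X) (v : E) (h : X → 𝕜) (x : X) : 𝕜 :=
  fderiv K (h ∘ (chartAt E x₀).symm) (chartAt E x₀ x) v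

omit [IsManifold 𝓘(K, E) n X] in
theorem chartDeriv_congr {x₀ x : X} {v : E} {h h' : X → 𝕜} (hx : x ∈ (chartAt E x₀).source)
    (hh : h =ᶠ[𝓝 x] h') : chartDeriv K x₀ v h =ᶠ[𝓝 x] chartDeriv K x₀ v h' := by
  filter_upwards [hh.eventuallyEq_nhds, (chartAt E x₀).open_source.mem_nhds hx] with y h1 h2
  have h3 : Tendsto (chartAt E x₀).symm (𝓝 (chartAt E x₀ y)) (𝓝 y) := by
    have := (chartAt E x₀).continuousAt_symm ((chartAt E x₀).map_source h2)
    rwa [ContinuousAt, (chartAt E x₀).left_inv h2] at this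
  exact congrArg (fun L => L v) (Filter.EventuallyEq.fderiv_eq (𝕜 := K) (h1.comp_tendsto h3))

variable (hn : n = ((⊤ : ℕ∞) : WithTop ℕ∞) ∨ n = ⊤)
include hn

theorem SmoothNear.chartDeriv {x₀ x : X} (v : E) {h : X → 𝕜} (hx : x ∈ (chartAt E x₀).source)
    (hh : SmoothNear K 𝕜 E n h x) : SmoothNear K 𝕜 E n (chartDeriv K x₀ v h) x := by
  refine smoothNear_comp_chart hx (g := fun p => fderiv K (h ∘ (chartAt E x₀).symm) p v) ?_
  filter_upwards [hh.contDiffAt_chart hx] with p hp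
  exact (hp.fderiv_right (by rcases hn with rfl | rfl <;> simp)).clm_apply contDiffAt_const

theorem SmoothNear.differentiableAt_chart {x₀ x : X} {h : X → 𝕜}
    (hx : x ∈ (chartAt E x₀).source) (hh : SmoothNear K 𝕜 E n h x) :
    ∀ᶠ y in 𝓝 x, DifferentiableAt K (h ∘ (chartAt E x₀).symm) (chartAt E x₀ y) := by
  filter_upwards [((chartAt E x₀).continuousAt hx).eventually (hh.contDiffAt_chart hx)] with y hy
  exact hy.differentiableAt (by rcases hn with rfl | rfl <;> simp)

theorem chartDeriv_add {x₀ x : X} {v : E} {h h' : X → 𝕜} (hx : x ∈ (chartAt E x₀).source)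
    (hh : SmoothNear K 𝕜 E n h x) (hh' : SmoothNear K 𝕜 E n h' x) :
    chartDeriv K x₀ v (h + h') =ᶠ[𝓝 x] chartDeriv K x₀ v h + chartDeriv K x₀ v h' := by
  filter_upwards [hh.differentiableAt_chart hn hx, hh'.differentiableAt_chart hn hx] with y h1 h2
  exact congrArg (fun L => L v) (fderiv_add h1 h2)

theorem chartDeriv_mul {x₀ x : X} {v : E} {h h' : X → 𝕜} (hx : x ∈ (chartAt E x₀).source)
    (hh : SmoothNear K 𝕜 E n h x) (hh' : SmoothNear K 𝕜 E n h' x) :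
    chartDeriv K x₀ v (h * h') =ᶠ[𝓝 x]
      h * chartDeriv K x₀ v h' + h' * chartDeriv K x₀ v h := by
  filter_upwards [hh.differentiableAt_chart hn hx, hh'.differentiableAt_chart hn hx,
    (chartAt E x₀).open_source.mem_nhds hx] with y h1 h2 h3
  refine (congrArg (fun L => L v) (fderiv_mul h1 h2)).trans ?_
  simp [chartDeriv, (chartAt E x₀).left_inv h3]

/-- The derivation of the germs of functions at `x` given by a constant vector field in the chart
at `x₀`. Nothing is claimed if `x` is outside the chart. -/
theorem exists_chartDerivation (x₀ : X) (v : E) (x : X) :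
    ∃ D : Derivation 𝕜 ((manifoldSpace K 𝕜 E n X).O x) ((manifoldSpace K 𝕜 E n X).O x),
      x ∈ (chartAt E x₀).source → ∀ (h : X → 𝕜) (hh : SmoothNear K 𝕜 E n h x),
        (D ⟨_, h, hh, rfl⟩).1 = (chartDeriv K x₀ v h : Germ (𝓝 x) 𝕜) := by
  by_cases hx : x ∈ (chartAt E x₀).source
  swap
  · exact ⟨0, fun h => absurd h hx⟩
  -- the derivative of a chosen representative; by `hD₀` the choice does not matter
  let D₀ (g : smoothGerms K 𝕜 E n x) : smoothGerms K 𝕜 E n x :=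
    ⟨_, _, g.2.choose_spec.1.chartDeriv hn v hx, rfl⟩
  have hD₀ (h : X → 𝕜) (hh : SmoothNear K 𝕜 E n h x) :
      D₀ ⟨_, h, hh, rfl⟩ = ⟨_, _, hh.chartDeriv hn v hx, rfl⟩ := by
    have h1 : ∃ g : X → 𝕜, SmoothNear K 𝕜 E n g x ∧ (h : Germ (𝓝 x) 𝕜) = (g : Germ (𝓝 x) 𝕜) :=
      ⟨h, hh, rfl⟩
    exact Subtype.ext (Germ.coe_eq.2
      (chartDeriv_congr hx (Germ.coe_eq.1 h1.choose_spec.2.symm)))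
  have hadd : ∀ g g', D₀ (g + g') = D₀ g + D₀ g' := by
    rintro ⟨_, g, hg, rfl⟩ ⟨_, g', hg', rfl⟩
    rw [hD₀ g hg, hD₀ g' hg']
    refine (hD₀ (g + g') (hg.add hg')).trans (Subtype.ext ?_)
    exact Germ.coe_eq.2 (chartDeriv_add hn hx hg hg')
  have hmul : ∀ g g', D₀ (g * g') = g * D₀ g' + g' * D₀ g := by
    rintro ⟨_, g, hg, rfl⟩ ⟨_, g', hg', rfl⟩
    rw [hD₀ g hg, hD₀ g' hg']
    refine (hD₀ (g * g') (hg.mul hg')).trans (Subtype.ext ?_)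
    exact Germ.coe_eq.2 (chartDeriv_mul hn hx hg hg')
  have hconst : ∀ c, D₀ (smoothGerms.const n x c) = 0 := by
    intro c
    refine (hD₀ (fun _ => c) (SmoothNear.const n X c x)).trans (Subtype.ext ?_)
    refine congrArg (fun g : X → 𝕜 => (g : Germ (𝓝 x) 𝕜)) (funext fun y => ?_)
    change fderiv K (fun _ => c) _ v = 0
    simp
  let D : (manifoldSpace K 𝕜 E n X).O x →ₗ[𝕜] (manifoldSpace K 𝕜 E n X).O x :=
    { toFun := D₀
      map_add' := hadd
      map_smul' := fun c g => by
        change D₀ (smoothGerms.const n x c * g) = smoothGerms.const n x c * D₀ g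
        rw [hmul, hconst, mul_zero, add_zero] }
  exact ⟨Derivation.mk' D hmul, fun _ h hh => congrArg Subtype.val (hD₀ h hh)⟩

/-- Manifolds have coordinates: the coordinates of a chart and the corresponding partial
derivatives, with Hadamard's lemma for the Taylor expansions. -/
theorem manifoldValues_coordinates [FiniteDimensional K E] (x₀ : X) :
    Nonempty ((manifoldValues (K := K) (𝕜 := 𝕜) (E := E) (n := n) (X := X)).Coordinates x₀) := by
  choose D hD using fun v : E => exists_chartDerivation (K := K) (𝕜 := 𝕜) (n := n) hn x₀ v
  let b := Module.finBasis K E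
  let U (j : Fin (Module.finrank K E)) (x : X) : 𝕜 := algebraMap K 𝕜 (b.coord j (chartAt E x₀ x))
  have hU (j) {x : X} (hx : x ∈ (chartAt E x₀).source) : SmoothNear K 𝕜 E n (U j) x :=
    smoothNear_comp_chart (g := fun p => algebraMap K 𝕜 (b.coord j p)) hx
      (Eventually.of_forall fun p => ((algebraMapCLM K 𝕜).comp
        (LinearMap.toContinuousLinearMap (b.coord j))).contDiff.contDiffAt)
  have hs := (chartAt E x₀).open_source.mem_nhds (mem_chart_source E x₀)
  refine ⟨⟨Module.finrank K E, fun j => smoothGerms.germ K E n (U j), fun j => D (b j),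
    fun j => smoothGerms.germ_sec (hU j (mem_chart_source E x₀)), fun j => ?_, ?_⟩⟩
  · filter_upwards [hs] with x hx
    rintro s ⟨h, hh, hsh⟩
    refine ⟨_, hh.chartDeriv hn (b j) hx, ?_⟩
    filter_upwards [hsh, (chartAt E x₀).open_source.mem_nhds hx,
      eventually_eventually_nhds.2 hh] with y h1 h2 h3
    rw [← hD (b j) y h2 h h3]
    have h4 : s y = ⟨_, h, h3, rfl⟩ := Subtype.ext h1
    rw [h4]
  · filter_upwards [hs] with y hy
    rintro ⟨_, h, hh, rfl⟩
    obtain ⟨G, hG, hGh, hGd⟩ := exists_eq_add_clm_apply hn (hh.contDiffAt_chart hy)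
    have hGs (j) : SmoothNear K 𝕜 E n (fun x => G (chartAt E x₀ x) (b j)) y :=
      smoothNear_comp_chart (g := fun p => G p (b j)) hy
        (hG.mono fun p hp => hp.clm_apply contDiffAt_const)
    -- `h = h(y) + ∑ⱼ (uⱼ - uⱼ(y)) G(bⱼ)` near `y`, by comparison of values
    refine ⟨fun j => smoothGerms.germ K E n (fun x => G (chartAt E x₀ x) (b j)) y, ?_,
      fun j => ?_⟩
    · rw [← smoothGerms.germ_of hh, manifoldValues_germ hh]
      simp only [manifoldValues_germ (hU _ hy), sub_eq_add_neg, ← map_neg]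
      refine manifoldValues.ext (f := smoothGerms.germ K E n h)
        (g := fun x => algebraMap 𝕜 _ (h y) + ∑ j, (smoothGerms.germ K E n (U j) x +
          algebraMap 𝕜 _ (-U j y)) *
            smoothGerms.germ K E n (fun x => G (chartAt E x₀ x) (b j)) x)
        (smoothGerms.germ_sec hh) ?_ ?_
      · exact RSpace.add _ (RSpace.const _ _ _) (RSpace.sum _ _ fun j =>
          RSpace.mul _ (RSpace.add _ (smoothGerms.germ_sec (hU j hy)) (RSpace.const _ _ _))
            (smoothGerms.germ_sec (hGs j)))
      · filter_upwards [eventually_eventually_nhds.2 hh, (chartAt E x₀).open_source.mem_nhds hy,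
          eventually_all.2 fun j => eventually_eventually_nhds.2 (hGs j),
          ((chartAt E x₀).continuousAt hy).eventually hGh] with x h1 h2 h3 h4
        rw [manifoldValues_germ h1]
        simp only [map_add, map_sum, map_mul, AlgHom.commutes, Algebra.algebraMap_self_apply,
          manifoldValues_germ (hU _ h2), manifoldValues_germ (h3 _)]
        rw [Function.comp_apply, Function.comp_apply, (chartAt E x₀).left_inv h2,
          (chartAt E x₀).left_inv hy] at h4
        rw [h4]
        congr 1
        conv_lhs => rw [← b.sum_repr (chartAt E x₀ x - chartAt E x₀ y)]
        rw [map_sum]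
        refine Finset.sum_congr rfl fun j _ => ?_
        rw [map_smul, Algebra.smul_def]
        simp [U, sub_eq_add_neg]
    · rw [manifoldValues_germ (hGs j), hGd]
      change _ = (D (b j) y ⟨_, h, hh, rfl⟩).1.value
      rw [hD (b j) y hy h hh]
      rfl

/-- One-forms can be pulled back along maps of manifolds. -/
theorem manifoldMap_pullsForms [FiniteDimensional K E] {E' : Type*} [NormedAddCommGroup E']
    [NormedSpace K E'] {Y : Type u} [TopologicalSpace Y] [ChartedSpace E' Y] {f : Y → X}
    (hf : ContMDiff 𝓘(K, E') 𝓘(K, E) n f) : (manifoldMap 𝕜 hf).PullsForms := by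
  refine SpMap.pullsForms_of_coordinates manifoldValues manifoldValues ?_
    (manifoldValues_coordinates hn)
  rintro y ⟨_, h, hh, rfl⟩
  rfl

end ManifoldCoordinates

/-! ### Inverse images along maps of manifolds -/

theorem mainTheorem6 {K 𝕜 : Type} [RCLike K] [RCLike 𝕜] [NormedAlgebra K 𝕜]
    {E : Type*} [NormedAddCommGroup E] [NormedSpace K E] [FiniteDimensional K E]
    {E' : Type*} [NormedAddCommGroup E'] [NormedSpace K E'] [FiniteDimensional K E']
    {n : WithTop ℕ∞} (hn : n = ((⊤ : ℕ∞) : WithTop ℕ∞) ∨ n = ⊤)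
    {X : Type u} [TopologicalSpace X] [ChartedSpace E X] [IsManifold 𝓘(K, E) n X]
    {Y : Type u} [TopologicalSpace Y] [ChartedSpace E' Y] [IsManifold 𝓘(K, E') n Y]
    {f : Y → X} (hf : ContMDiff 𝓘(K, E') 𝓘(K, E) n f)
    (A : LieAlgd (manifoldSpace K 𝕜 E n X)) (hA : A.A.LocallyFree) :
    ∃ h : ∀ Q : CourantOver A, Q.IsExtension → (Q.pull (manifoldMap 𝕜 hf)).IsExtension,
      (∃ Φ : LinFunctor 𝕜 (CExt.linCat A) (CExt.linCat (A.pull (manifoldMap 𝕜 hf)))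
          (CExt.pull (manifoldMap 𝕜 hf) A h), IsCanonical (manifoldMap 𝕜 hf) Φ) ∧
        Nonempty (LinFunctor ℤ (CExt.linCat A).picard
          (CExt.linCat (A.pull (manifoldMap 𝕜 hf))).picard
          (CExt.pull (manifoldMap 𝕜 hf) A h)) := by
  have hF := manifoldMap_pullsForms (𝕜 := 𝕜) hn hf
  let h : ∀ Q : CourantOver A, Q.IsExtension → (Q.pull (manifoldMap 𝕜 hf)).IsExtension :=
    fun _ hQ => CourantOver.pull_isExtension hF hA hQ
  let Φ := CExt.pullLinFunctor hF hA h
  exact ⟨h, ⟨Φ, CExt.isCanonical_pullLinFunctor hF hA h⟩, ⟨Φ.restrict (Int.castRingHom 𝕜)⟩⟩
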